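/- Let $d\ge 2$. Let $\mathrm{Rat}_d^{fm}$ be the space of degree-$d$ rational maps $f$ of $\widehat{\mathbb C}$ together with an ordering $(x_1,\dots,x_{d+1})$ of their fixed points (with multiplicity), and $\mathrm{rat}_d^{fm}$ its quotient by Möbius conjugation $\phi\cdot(f;x_i)=(\phi f\phi^{-1};\phi(x_i))$. A rational map is hyperbolic if it expands a smooth conformal metric, defined near its Julia set, by a factor larger than some $C>1$ on the Julia set. A quasi-Blaschke product is a hyperbolic rational map whose Julia set is a quasi-circle and which maps each of its two Fatou components to itself. Let $\mathcal{QB}_d^{fm}\subset \mathrm{rat}_d^{fm}$ be the set of classes of marked quasi-Blaschke products that have a representative for which $x_1=0$ and $x_2=\infty$ are attracting and $x_3,\dots,x_{d+1}$ lie in counter-clockwise order on the Julia set. It is an open subset (a hyperbolic component) of $\mathrm{rat}_d^{fm}$; all its elements have $d+1$ distinct fixed points, so that it is a complex manifold, whose tangent spaces are those of $\mathrm{rat}_d^{fm}$. Let $J$ be its almost complex structure (multiplication by $i$). Let $\mathcal B_d^{fm}\subset\mathcal{QB}_d^{fm}$ be the set of classes that contain a Blaschke product, i.e. a rational map $f$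 with $f^{-1}(\Delta)=\Delta$ for the open unit disk $\Delta$. For $[f]\in\mathcal B_d^{fm}$ let $T_{[f]}\mathcal B_d^{fm}$ be the set of velocities at $[f]$ of the smooth curves through $[f]$ contained in $\mathcal B_d^{fm}$ (those with a smooth lift to $\mathrm{Rat}_d^{fm}$). Then, for every $[f]\in\mathcal B_d^{fm}$, the set $T_{[f]}\mathcal B_d^{fm}$ is a real linear subspace of $T_{[f]}\mathcal{QB}_d^{fm}$, and $$T_{[f]}\mathcal{QB}_d^{fm}=T_{[f]}\mathcal B_d^{fm}\oplus J\cdot T_{[f]}\mathcal B_d^{fm}.$$ -/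

import Mathlib

open Polynomial Filter Topology Set
open scoped OnePoint

noncomputable section

namespace QuasiBlaschke

/-! ### The Riemann sphere `OnePoint ℂ` -/

/-- The chordal metric of the Riemann sphere:
`2|z - w| / (√(1+|z|²) √(1+|w|²))` for finite `z, w`, and `2 / √(1+|z|²)` between `z` and `∞`. -/
def chordal (p q : OnePoint ℂ) : ℝ :=
  p.elim (q.elim 0 fun w => 2 / √(1 + ‖w‖ ^ 2)) fun z =>
    q.elim (2 / √(1 + ‖z‖ ^ 2)) fun w =>
      2 * ‖z - w‖ / (√(1 + ‖z‖ ^ 2) * √(1 + ‖w‖ ^ 2))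

/-- The coordinate `w ↦ 1 / w` at infinity, as a map `ℂ → OnePoint ℂ`. -/
def coordInfty (w : ℂ) : OnePoint ℂ := if w = 0 then ∞ else ((w⁻¹ : ℂ) : OnePoint ℂ)

/-- The unit disk, as a subset of the sphere. -/
def unitDisk : Set (OnePoint ℂ) := (fun z : ℂ => (z : OnePoint ℂ)) '' Metric.ball 0 1

/-- The unit circle, as a subset of the sphere. -/
def unitCircle : Set (OnePoint ℂ) := (fun z : ℂ => (z : OnePoint ℂ)) '' Metric.sphere 0 1

/-- `s` is the norm of the derivative of `f` at `p` with respect to the spherical metric. At a fixed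
point of a holomorphic map it is the modulus of the multiplier. -/
def HasSphericalDeriv (f : OnePoint ℂ → OnePoint ℂ) (p : OnePoint ℂ) (s : ℝ) : Prop :=
  Tendsto (fun q => chordal (f q) (f p) / chordal q p) (𝓝[≠] p) (𝓝 s)

/-- `p` is an attracting fixed point: its multiplier has modulus less than one
(superattracting points are included). -/
def IsAttractingFixedPoint (f : OnePoint ℂ → OnePoint ℂ) (p : OnePoint ℂ) : Prop :=
  f p = p ∧ ∃ s < 1, HasSphericalDeriv f p s

/-- Quasiconformal homeomorphisms of the sphere (metric definition): the linear dilatation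
`limsup_{r → 0} max_{|y - p| ≤ r} |h y - h p| / min_{|y' - p| ≥ r} |h y' - h p|` is bounded
uniformly in `p`. -/
def IsQuasiconformal (h : OnePoint ℂ ≃ₜ OnePoint ℂ) : Prop :=
  ∃ H : ℝ, ∀ p, ∀ᶠ r in 𝓝[>] (0 : ℝ), ∀ y y', chordal y p ≤ r → r ≤ chordal y' p →
    chordal (h y) (h p) ≤ H * chordal (h y') (h p)

/-- A quasi-circle is the image of the round circle under a quasiconformal homeomorphism of the
sphere. -/
def IsQuasiCircle (K : Set (OnePoint ℂ)) : Prop :=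
  ∃ h : OnePoint ℂ ≃ₜ OnePoint ℂ, IsQuasiconformal h ∧ h '' unitCircle = K

/-! ### Fatou and Julia sets, hyperbolicity -/

/-- The iterates of `f` form a normal family on `U` in the sense of Montel: every subsequence of
`(fⁿ)` has a further subsequence that converges locally uniformly on `U` (for the chordal
metric). -/
def IsNormalOn (f : OnePoint ℂ → OnePoint ℂ) (U : Set (OnePoint ℂ)) : Prop :=
  ∀ a : ℕ → ℕ, StrictMono a → ∃ b : ℕ → ℕ, StrictMono b ∧ ∃ g : OnePoint ℂ → OnePoint ℂ,
    ∀ p ∈ U, ∀ ε > 0, ∃ V ∈ 𝓝 p, ∀ᶠ k in atTop, ∀ q ∈ V,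
      chordal (f^[a (b k)] q) (g q) < ε

/-- The largest open set on which the iterates form a normal family. -/
def fatouSet (f : OnePoint ℂ → OnePoint ℂ) : Set (OnePoint ℂ) :=
  {p | ∃ U, IsOpen U ∧ p ∈ U ∧ IsNormalOn f U}

def juliaSet (f : OnePoint ℂ → OnePoint ℂ) : Set (OnePoint ℂ) := (fatouSet f)ᶜ

/-- There is a smooth conformal metric on a neighbourhood `U` of the Julia set, written as
`ρ` times the spherical metric with `ρ > 0` smooth on `U`, for which `‖f'‖ > C > 1` on the Julia
set. -/
def IsHyperbolic (f : OnePoint ℂ → OnePoint ℂ) : Prop :=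
  ∃ (U : Set (OnePoint ℂ)) (ρ : OnePoint ℂ → ℝ) (C : ℝ),
    IsOpen U ∧ juliaSet f ⊆ U ∧ (∀ p ∈ U, 0 < ρ p) ∧
    ContDiffOn ℝ ((⊤ : ℕ∞) : WithTop ℕ∞) (fun z : ℂ => ρ (z : OnePoint ℂ))
      {z : ℂ | (z : OnePoint ℂ) ∈ U} ∧
    ContDiffOn ℝ ((⊤ : ℕ∞) : WithTop ℕ∞) (fun w : ℂ => ρ (coordInfty w))
      {w : ℂ | coordInfty w ∈ U} ∧
    1 < C ∧ ∀ p ∈ juliaSet f, ∃ s, HasSphericalDeriv f p s ∧ C < ρ (f p) * s / ρ p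

/-- Hyperbolic, the Julia set is a quasi-circle, and each Fatou component is mapped to itself. -/
def IsQuasiBlaschke (f : OnePoint ℂ → OnePoint ℂ) : Prop :=
  IsHyperbolic f ∧ IsQuasiCircle (juliaSet f) ∧
    ∀ p ∈ fatouSet f,
      f '' connectedComponentIn (fatouSet f) p = connectedComponentIn (fatouSet f) p

/-- For a rational map `f`: it restricts to a proper self-map of the unit disk. -/
def IsBlaschke (f : OnePoint ℂ → OnePoint ℂ) : Prop := f ⁻¹' unitDisk = unitDisk

/-! ### Rational maps with marked fixed points -/

/-- Coefficients `(a, b)` of a pair of polynomials `∑ aⱼ zʲ`, `∑ bⱼ zʲ` of degree at most `d`. -/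
abbrev Coeff (d : ℕ) : Type := (Fin (d + 1) → ℂ) × (Fin (d + 1) → ℂ)

def toPoly {d : ℕ} (a : Fin (d + 1) → ℂ) : ℂ[X] := ∑ j, C (a j) * X ^ (j : ℕ)

/-- The self-map `z ↦ (∑ aⱼ zʲ) / (∑ bⱼ zʲ)` of the sphere. -/
def toMap {d : ℕ} (F : Coeff d) (p : OnePoint ℂ) : OnePoint ℂ :=
  p.elim
    (if F.2 (Fin.last d) = 0 then ∞
      else ((F.1 (Fin.last d) / F.2 (Fin.last d) : ℂ) : OnePoint ℂ))
    fun z => if (toPoly F.2).eval z = 0 then ∞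
      else (((toPoly F.1).eval z / (toPoly F.2).eval z : ℂ) : OnePoint ℂ)

/-- The `d + 1` fixed points with multiplicity: the zeros of `z · den - num`, regarded as a form of
degree `d + 1`. -/
def fixedPoints {d : ℕ} (F : Coeff d) : Multiset (OnePoint ℂ) :=
  (X * toPoly F.2 - toPoly F.1).roots.map (fun z : ℂ => (z : OnePoint ℂ)) +
    Multiset.replicate (d + 1 - (X * toPoly F.2 - toPoly F.1).natDegree) ∞

/-- A rational map of degree `d`, given by homogeneous coordinates (so that two coefficient pairs
that differ by a scalar give the same map), with an ordering of its `d + 1` fixed points. -/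
structure MarkedRat (d : ℕ) where
  coeff : Coeff d
  mark : Fin (d + 1) → OnePoint ℂ
  coprime : IsCoprime (toPoly coeff.1) (toPoly coeff.2)
  degree_eq : max (toPoly coeff.1).natDegree (toPoly coeff.2).natDegree = d
  mark_eq : Finset.univ.val.map mark = fixedPoints coeff

/-- The rational map of the sphere underlying a marked map. -/
def MarkedRat.map {d : ℕ} (m : MarkedRat d) : OnePoint ℂ → OnePoint ℂ := toMap m.coeff

/-- Conjugacy by a Möbius transformation that respects the markings. -/
instance conjSetoid (d : ℕ) : Setoid (MarkedRat d) where
  r m n := ∃ g : GL (Fin 2) ℂ, (∀ p, n.map (g • p) = g • m.map p) ∧ ∀ i, n.mark i = g • m.mark i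
  iseqv :=
    { refl := fun m => ⟨1, by simp, by simp⟩
      symm := by
        rintro m n ⟨g, h1, h2⟩
        refine ⟨g⁻¹, fun p => ?_, fun i => ?_⟩
        · have h := h1 (g⁻¹ • p)
          rw [smul_inv_smul] at h
          rw [h, inv_smul_smul]
        · rw [h2, inv_smul_smul]
      trans := by
        rintro m n k ⟨g, h1, h2⟩ ⟨g', h1', h2'⟩
        refine ⟨g' * g, fun p => ?_, fun i => ?_⟩
        · rw [mul_smul, mul_smul, h1', h1]
        · rw [h2', h2, mul_smul] }

/-- The moduli space of rational maps of degree `d` with marked fixed points. -/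
def Moduli (d : ℕ) : Type := Quotient (conjSetoid d)

def MarkedRat.toModuli {d : ℕ} (m : MarkedRat d) : Moduli d := Quotient.mk (conjSetoid d) m

/-! ### The spaces of quasi-Blaschke and Blaschke products -/

/-- The fixed points `0` and `∞` are the first two marked points and are attracting, and
the others lie in counter-clockwise order on the Julia set: the Julia set has a simple closed
parametrisation `t ↦ exp (L t)`, of period one and winding number `+1` about `0`, that visits the
other marked points in the given order within one period. -/
def IsStandardOrdered {d : ℕ} (m : MarkedRat d) : Prop :=
  m.mark 0 = ((0 : ℂ) : OnePoint ℂ) ∧ m.mark 1 = ∞ ∧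
  IsAttractingFixedPoint m.map ((0 : ℂ) : OnePoint ℂ) ∧ IsAttractingFixedPoint m.map ∞ ∧
  ∃ L : ℝ → ℂ, Continuous L ∧ (∀ t, L (t + 1) = L t + 2 * Real.pi * Complex.I) ∧
    InjOn (fun t => Complex.exp (L t)) (Ico 0 1) ∧
    range (fun t => ((Complex.exp (L t) : ℂ) : OnePoint ℂ)) = juliaSet m.map ∧
    ∃ s : Fin (d + 1) → ℝ,
      (∀ i : Fin (d + 1), 2 ≤ (i : ℕ) → m.mark i = ((Complex.exp (L (s i)) : ℂ) : OnePoint ℂ)) ∧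
      ∀ i j : Fin (d + 1), 2 ≤ (i : ℕ) → i < j → s i < s j ∧ s j < s i + 1

/-- Quasi-Blaschke products with marked fixed points, of the standard marking type: after
conjugation by some Möbius transformation, the first two marked points are the attracting fixed
points `0` and `∞`, and the others are in counter-clockwise order on the Julia set. -/
def quasiBlaschkeMarked (d : ℕ) : Set (MarkedRat d) :=
  {m | IsQuasiBlaschke m.map ∧ ∃ n : MarkedRat d, n.toModuli = m.toModuli ∧ IsStandardOrdered n}

/-- The space of conjugacy classes of quasi-Blaschke products with marked fixed points. -/
def quasiBlaschkeSpace (d : ℕ) : Set (Moduli d) := MarkedRat.toModuli '' quasiBlaschkeMarked d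

/-- The classes in `quasiBlaschkeSpace d` of Blaschke products. -/
def blaschkeLocus (d : ℕ) : Set (Moduli d) :=
  {c ∈ quasiBlaschkeSpace d | ∃ m : MarkedRat d, m.toModuli = c ∧ IsBlaschke m.map}

/-! ### Tangent spaces

Homogeneous coordinates embed the space of rational maps of degree `d` as an open subset of the
projective space of `Coeff d`. At a map with `d + 1` distinct fixed points (for instance a
hyperbolic one) the marking does not change the local structure: the fixed points move
holomorphically with the map. -/

/-- `∑ aⱼ uʲ vᵈ⁻ʲ` where `(u, v) = adj(g) (X, 1)`. -/
def substAdj {d : ℕ} (g : Matrix (Fin 2) (Fin 2) ℂ) (a : Fin (d + 1) → ℂ) : ℂ[X] :=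
  ∑ j, C (a j) * (C (g 1 1) * X - C (g 0 1)) ^ (j : ℕ) *
    (C (g 0 0) - C (g 1 0) * X) ^ (d - (j : ℕ))

/-- Homogeneous coordinates of the conjugate `g ∘ F ∘ g⁻¹`, normalised as `g ∘ F ∘ adj g`. As `g`
runs through `GL₂(ℂ)` these are exactly all homogeneous coordinates of all conjugates of `F`. -/
def conjCoeff {d : ℕ} (g : Matrix (Fin 2) (Fin 2) ℂ) (F : Coeff d) : Coeff d :=
  (fun k => g 0 0 * (substAdj g F.1).coeff k + g 0 1 * (substAdj g F.2).coeff k,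
   fun k => g 1 0 * (substAdj g F.1).coeff k + g 1 1 * (substAdj g F.2).coeff k)

/-- The tangent space at `F` of the orbit of `F` under conjugation and scaling: the image of the
differential of `g ↦ g ∘ F ∘ adj g` at the identity. -/
def orbitTangent {d : ℕ} (F : Coeff d) : Submodule ℂ (Coeff d) :=
  Submodule.span ℂ
    (range fun ξ : Matrix (Fin 2) (Fin 2) ℂ => deriv (fun s : ℂ => conjCoeff (1 + s • ξ) F) 0)

/-- The complex tangent space, at the class of `m`, of the moduli space of rational maps with marked
fixed points, for `m` with `d + 1` distinct fixed points: the tangent space of the space of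
coordinates modulo that of the orbit. It is also the tangent space of `quasiBlaschkeSpace d`, which
is open in the moduli space. -/
abbrev ModuliTangent {d : ℕ} (m : MarkedRat d) : Type := Coeff d ⧸ orbitTangent m.coeff

/-- The almost complex structure: multiplication by `i` on the tangent space. -/
def almostComplex {d : ℕ} (m : MarkedRat d) : ModuliTangent m →ₗ[ℝ] ModuliTangent m :=
  (Complex.I • (LinearMap.id : ModuliTangent m →ₗ[ℂ] ModuliTangent m)).restrictScalars ℝ

/-- The velocities at `m` of the smooth curves of marked maps `c : (-ε, ε) → MarkedRat d` with
`c 0 = m` whose classes stay in `S`, as vectors of the tangent space of the moduli space. -/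
def velocities {d : ℕ} (S : Set (Moduli d)) (m : MarkedRat d) : Set (ModuliTangent m) :=
  {v | ∃ ε > 0, ∃ c : ℝ → MarkedRat d, c 0 = m ∧
    ContDiffOn ℝ ((⊤ : ℕ∞) : WithTop ℕ∞) (fun t => (c t).coeff) (Ioo (-ε) ε) ∧
    ContinuousOn (fun t => (c t).mark) (Ioo (-ε) ε) ∧
    (∀ t ∈ Ioo (-ε) ε, (c t).toModuli ∈ S) ∧
    (orbitTangent m.coeff).mkQ (deriv (fun t => (c t).coeff) 0) = v}

end QuasiBlaschke

end

noncomputable section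

namespace QuasiBlaschke

/-! The reflection σ(z) = 1 / conj z in the unit circle acts on rational maps by f ↦ σ f σ; on
coefficient pairs this is the antilinear involution `refl`. A Blaschke product commutes with σ, so
its coefficients are fixed by `refl` up to a scalar (`exists_refl_eq_smul`). Fixed vectors of an
antilinear involution form a real form of the complex space, and this is the source of the
decomposition. What needs proof is that the picture descends to the moduli space.

Put the first three marked points at 0, ∞, 1. The complex space N of coefficient pairs fixing these
points (`normalSpace`) is a slice: the three fixed points F has there are simple, so infinitesimal
Möbius maps displace them independently. Hence N and the orbit tangent span everything, and they
meet only in ℂF (`SimpleNormal.exists_sub_mem_normalSpace`, `SimpleNormal.eq_smul_of_mem`). Since σ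
exchanges 0 and ∞ and fixes 1, `refl` preserves N, and its fixed space W (`symmNormalSpace`)
satisfies N = W + iW. Rescaling is itself tangent to the orbit. So the image T of W in the quotient
satisfies T ⊕ iT = everything.

It remains to see that T is the set of velocities. For w in W the line F + tw consists of symmetric
maps fixing 0, ∞, 1. Having no pole in the closed disk and an attracting fixed point at 0 are open
conditions; with the symmetry they make the map a hyperbolic Blaschke product with Julia set the
unit circle (`Good`), and the cyclic order of the remaining fixed points persists
(`Normalized.mem_coeffVelocities`).

Conversely, a curve in the locus can be renormalised by a differentiable curve of Möbius maps,
because simple fixed points depend differentiably on the map. The renormalised maps are symmetric up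
to scalars (`exists_good_smul`): σ exchanges the two attracting fixed points of a Blaschke product,
as Schwarz–Pick forbids two of them on the circle, so in coordinates where they are 0 and ∞ the
invariant circle is centred at 0, and it has radius one since it contains the fixed point 1.
Differentiating puts the velocity in W modulo the orbit tangent
(`Normalized.exists_sub_mem_orbitTangent`). -/

/-! ### Homogeneous coordinates -/

/-- The binary form `∑ aⱼ uʲ vᵈ⁻ʲ`. -/
def hom {d : ℕ} (a : Fin (d + 1) → ℂ) (u v : ℂ) : ℂ :=
  ∑ j : Fin (d + 1), a j * u ^ (j : ℕ) * v ^ (d - (j : ℕ))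

/-- The point of the sphere with homogeneous coordinates `[u : v]`. -/
def pt (u v : ℂ) : OnePoint ℂ := if v = 0 then ∞ else ((u / v : ℂ) : OnePoint ℂ)

section Hom

variable {d : ℕ}

lemma hom_one (a : Fin (d + 1) → ℂ) (z : ℂ) : hom a z 1 = (toPoly a).eval z := by
  simp [hom, toPoly, eval_finsetSum]

lemma hom_zero_right (a : Fin (d + 1) → ℂ) (u : ℂ) : hom a u 0 = a (Fin.last d) * u ^ d := by
  rw [hom, Finset.sum_eq_single (Fin.last d)]
  · rw [Fin.val_last, Nat.sub_self, pow_zero, mul_one]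
  · intro j _ hj
    have : (j : ℕ) < d := Fin.val_lt_last hj
    rw [zero_pow (by omega), mul_zero]
  · exact fun h => absurd (Finset.mem_univ _) h

lemma hom_zero_left (a : Fin (d + 1) → ℂ) (v : ℂ) : hom a 0 v = a 0 * v ^ d := by
  rw [hom, Finset.sum_eq_single 0]
  · simp
  · intro j _ hj
    have : (j : ℕ) ≠ 0 := fun h => hj (Fin.ext h)
    rw [zero_pow this, mul_zero, zero_mul]
  · simp

lemma hom_mul_mul (a : Fin (d + 1) → ℂ) (c u v : ℂ) :
    hom a (c * u) (c * v) = c ^ d * hom a u v := by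
  rw [hom, hom, Finset.mul_sum]
  refine Finset.sum_congr rfl fun j _ => ?_
  have : c ^ d = c ^ (j : ℕ) * c ^ (d - (j : ℕ)) := by
    rw [← pow_add]; congr 1; have := j.2; omega
  rw [this]; ring

lemma hom_eq_pow_mul (a : Fin (d + 1) → ℂ) {v : ℂ} (hv : v ≠ 0) (u : ℂ) :
    hom a u v = v ^ d * (toPoly a).eval (u / v) := by
  rw [← hom_one, ← hom_mul_mul, mul_div_cancel₀ _ hv, mul_one]

lemma hom_add (a b : Fin (d + 1) → ℂ) (u v : ℂ) : hom (a + b) u v = hom a u v + hom b u v := by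
  simp [hom, add_mul, Finset.sum_add_distrib]

lemma hom_smul (c : ℂ) (a : Fin (d + 1) → ℂ) (u v : ℂ) : hom (c • a) u v = c * hom a u v := by
  simp [hom, Finset.mul_sum, mul_assoc]

lemma continuous_hom (a : Fin (d + 1) → ℂ) : Continuous fun x : ℂ × ℂ => hom a x.1 x.2 := by
  unfold hom; fun_prop

lemma toPoly_coeff (a : Fin (d + 1) → ℂ) (k : ℕ) :
    (toPoly a).coeff k = if h : k < d + 1 then a ⟨k, h⟩ else 0 := by
  simp only [toPoly, finsetSum_coeff, coeff_C_mul, coeff_X_pow]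
  split_ifs with h
  · rw [Finset.sum_eq_single ⟨k, h⟩]
    · simp
    · intro j _ hj
      have : k ≠ (j : ℕ) := fun h' => hj (by ext; exact h'.symm)
      simp [this]
    · simp
  · refine Finset.sum_eq_zero fun j _ => ?_
    have : k ≠ (j : ℕ) := by have := j.2; omega
    simp [this]

lemma toPoly_coeff_fin (a : Fin (d + 1) → ℂ) (k : Fin (d + 1)) : (toPoly a).coeff k = a k := by
  rw [toPoly_coeff, dif_pos k.2]

lemma natDegree_toPoly_le (a : Fin (d + 1) → ℂ) : (toPoly a).natDegree ≤ d := by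
  rw [natDegree_le_iff_coeff_eq_zero]
  intro k hk
  rw [toPoly_coeff, dif_neg (by omega)]

lemma toPoly_coeff_of_natDegree_le {P : ℂ[X]} (hP : P.natDegree ≤ d) :
    toPoly (fun k : Fin (d + 1) => P.coeff k) = P := by
  ext k
  rw [toPoly_coeff]
  split_ifs with h
  · rfl
  · exact (coeff_eq_zero_of_natDegree_lt (by omega)).symm

lemma hom_ext {a b : Fin (d + 1) → ℂ} (h : ∀ u, hom a u 1 = hom b u 1) : a = b := by
  have : toPoly a = toPoly b := Polynomial.funext fun z => by rw [← hom_one, ← hom_one, h]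
  ext k
  rw [← toPoly_coeff_fin a, this, toPoly_coeff_fin]

/-- Two forms agreeing for `v ≠ 0` agree everywhere. -/
lemma eq_of_eq_of_ne_zero {f g : ℂ → ℂ} (hf : Continuous f) (hg : Continuous g)
    (h : ∀ v, v ≠ 0 → f v = g v) (v : ℂ) : f v = g v :=
  congrFun (Continuous.ext_on (dense_compl_singleton (0 : ℂ)) hf hg fun v hv => h v hv) v

/-- By this bound, `conjCoeff` loses nothing when it keeps only the coefficients up to degree d. -/
lemma natDegree_substAdj_le (g : Matrix (Fin 2) (Fin 2) ℂ) (a : Fin (d + 1) → ℂ) :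
    (substAdj g a).natDegree ≤ d := by
  refine natDegree_sum_le_of_forall_le _ _ fun j _ => ?_
  have h1 : (C (g 1 1) * X - C (g 0 1)).natDegree ≤ 1 := by compute_degree
  have h2 : (C (g 0 0) - C (g 1 0) * X).natDegree ≤ 1 := by compute_degree
  have hj := j.2
  calc _ ≤ (C (a j) * (C (g 1 1) * X - C (g 0 1)) ^ (j : ℕ)).natDegree
        + ((C (g 0 0) - C (g 1 0) * X) ^ (d - (j : ℕ))).natDegree := natDegree_mul_le
    _ ≤ (j : ℕ) * 1 + (d - (j : ℕ)) * 1 := by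
        gcongr
        · exact (natDegree_C_mul_le _ _).trans (natDegree_pow_le_of_le _ h1)
        · exact natDegree_pow_le_of_le _ h2
    _ ≤ d := by omega

/-- For v ≠ 0 this is the dehomogenised definition; continuity in v extends it to v = 0. It lets all
later computations with `conjCoeff` be done on binary forms. -/
lemma hom_substAdj (g : Matrix (Fin 2) (Fin 2) ℂ) (a : Fin (d + 1) → ℂ) (u v : ℂ) :
    hom (fun k : Fin (d + 1) => (substAdj g a).coeff k) u v =
      hom a (g 1 1 * u - g 0 1 * v) (g 0 0 * v - g 1 0 * u) := by
  have hdeg := toPoly_coeff_of_natDegree_le (natDegree_substAdj_le g a)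
  set b : Fin (d + 1) → ℂ := fun k : Fin (d + 1) => (substAdj g a).coeff k
  have c1 : Continuous fun v : ℂ => hom b u v :=
    (continuous_hom b).comp (f := fun v : ℂ => (u, v)) (by fun_prop)
  have c2 : Continuous fun v : ℂ => hom a (g 1 1 * u - g 0 1 * v) (g 0 0 * v - g 1 0 * u) :=
    (continuous_hom a).comp
      (f := fun v : ℂ => (g 1 1 * u - g 0 1 * v, g 0 0 * v - g 1 0 * u)) (by fun_prop)
  refine eq_of_eq_of_ne_zero c1 c2 ?_ v
  · intro v hv
    rw [hom_eq_pow_mul _ hv, hdeg]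
    have h1 : g 1 1 * u - g 0 1 * v = v * (g 1 1 * (u / v) - g 0 1) := by field_simp
    have h2 : g 0 0 * v - g 1 0 * u = v * (g 0 0 - g 1 0 * (u / v)) := by field_simp
    rw [h1, h2, hom_mul_mul]
    congr 1
    rw [substAdj, hom, eval_finsetSum]
    refine Finset.sum_congr rfl fun j _ => ?_
    simp only [eval_mul, eval_pow, eval_sub, eval_C, eval_X]

lemma hom_conjCoeff_fst (g : Matrix (Fin 2) (Fin 2) ℂ) (F : Coeff d) (u v : ℂ) :
    hom (conjCoeff g F).1 u v =
      g 0 0 * hom F.1 (g 1 1 * u - g 0 1 * v) (g 0 0 * v - g 1 0 * u) +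
      g 0 1 * hom F.2 (g 1 1 * u - g 0 1 * v) (g 0 0 * v - g 1 0 * u) := by
  rw [← hom_substAdj, ← hom_substAdj, ← hom_smul, ← hom_smul, ← hom_add]
  rfl

lemma hom_conjCoeff_snd (g : Matrix (Fin 2) (Fin 2) ℂ) (F : Coeff d) (u v : ℂ) :
    hom (conjCoeff g F).2 u v =
      g 1 0 * hom F.1 (g 1 1 * u - g 0 1 * v) (g 0 0 * v - g 1 0 * u) +
      g 1 1 * hom F.2 (g 1 1 * u - g 0 1 * v) (g 0 0 * v - g 1 0 * u) := by
  rw [← hom_substAdj, ← hom_substAdj, ← hom_smul, ← hom_smul, ← hom_add]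
  rfl

lemma coeff_ext {F G : Coeff d} (h1 : ∀ u, hom F.1 u 1 = hom G.1 u 1)
    (h2 : ∀ u, hom F.2 u 1 = hom G.2 u 1) : F = G :=
  Prod.ext (hom_ext h1) (hom_ext h2)

lemma conjCoeff_one (F : Coeff d) : conjCoeff 1 F = F := by
  refine coeff_ext (fun u => ?_) fun u => ?_
  · simp [hom_conjCoeff_fst]
  · simp [hom_conjCoeff_snd]

/-- Valid for singular matrices as well: the adjugate takes the place of the inverse and reverses
products. -/
lemma conjCoeff_mul (g h : Matrix (Fin 2) (Fin 2) ℂ) (F : Coeff d) :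
    conjCoeff (g * h) F = conjCoeff g (conjCoeff h F) := by
  refine coeff_ext (fun u => ?_) fun u => ?_
  · rw [hom_conjCoeff_fst, hom_conjCoeff_fst, hom_conjCoeff_fst, hom_conjCoeff_snd]
    simp only [Matrix.mul_apply, Fin.sum_univ_two]
    ring_nf
  · rw [hom_conjCoeff_snd, hom_conjCoeff_snd, hom_conjCoeff_fst, hom_conjCoeff_snd]
    simp only [Matrix.mul_apply, Fin.sum_univ_two]
    ring_nf

/-- Conjugation by a matrix, as a linear map of coefficients. -/
def conjLin (g : Matrix (Fin 2) (Fin 2) ℂ) : Coeff d →ₗ[ℂ] Coeff d where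
  toFun := conjCoeff g
  map_add' F G := by
    refine coeff_ext (fun u => ?_) fun u => ?_
    · simp only [hom_conjCoeff_fst, Prod.fst_add, Prod.snd_add, hom_add]; ring
    · simp only [hom_conjCoeff_snd, Prod.fst_add, Prod.snd_add, hom_add]; ring
  map_smul' c F := by
    refine coeff_ext (fun u => ?_) fun u => ?_
    · simp only [hom_conjCoeff_fst, Prod.smul_fst, Prod.smul_snd, hom_smul, RingHom.id_apply]; ring
    · simp only [hom_conjCoeff_snd, Prod.smul_fst, Prod.smul_snd, hom_smul, RingHom.id_apply]; ring

end Hom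

/-! ### Points of the sphere -/

@[simp] lemma pt_one (z : ℂ) : pt z 1 = (z : OnePoint ℂ) := by simp [pt]

@[simp] lemma pt_zero (u : ℂ) : pt u 0 = ∞ := by simp [pt]

lemma pt_one_left (w : ℂ) : pt 1 w = coordInfty w := by
  simp [pt, coordInfty]

lemma pt_smul {c : ℂ} (hc : c ≠ 0) (u v : ℂ) : pt (c * u) (c * v) = pt u v := by
  unfold pt
  by_cases hv : v = 0
  · simp [hv]
  · rw [if_neg hv, if_neg (mul_ne_zero hc hv), mul_div_mul_left _ _ hc]

lemma pt_eq_pt_iff {u v u' v' : ℂ} (h : u ≠ 0 ∨ v ≠ 0) (h' : u' ≠ 0 ∨ v' ≠ 0) :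
    pt u v = pt u' v' ↔ u * v' = u' * v := by
  unfold pt
  by_cases hv : v = 0 <;> by_cases hv' : v' = 0
  · simp [hv, hv']
  · have : u ≠ 0 := by tauto
    simp [hv, hv', this]
  · have : u' ≠ 0 := by tauto
    simp [hv, hv', this]
  · rw [if_neg hv, if_neg hv', OnePoint.coe_eq_coe, div_eq_div_iff hv hv']

lemma exists_pt (p : OnePoint ℂ) : ∃ u v, (u ≠ 0 ∨ v ≠ 0) ∧ pt u v = p := by
  induction p using OnePoint.rec with
  | infty => exact ⟨1, 0, by simp, by simp⟩
  | coe z => exact ⟨z, 1, by simp, by simp⟩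

lemma gl_det_ne_zero (g : GL (Fin 2) ℂ) : g 0 0 * g 1 1 - g 0 1 * g 1 0 ≠ 0 := by
  have := g.det_ne_zero
  rwa [Matrix.det_fin_two] at this

lemma gl_apply_ne_zero (g : GL (Fin 2) ℂ) {u v : ℂ} (h : u ≠ 0 ∨ v ≠ 0) :
    g 0 0 * u + g 0 1 * v ≠ 0 ∨ g 1 0 * u + g 1 1 * v ≠ 0 := by
  by_contra! hc
  have hd := gl_det_ne_zero g
  have hu : (g 0 0 * g 1 1 - g 0 1 * g 1 0) * u = 0 := by
    linear_combination g 1 1 * hc.1 - g 0 1 * hc.2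
  have hv : (g 0 0 * g 1 1 - g 0 1 * g 1 0) * v = 0 := by
    linear_combination g 0 0 * hc.2 - g 1 0 * hc.1
  simp only [mul_eq_zero, hd, false_or] at hu hv
  tauto

lemma smul_pt (g : GL (Fin 2) ℂ) (u v : ℂ) (h : u ≠ 0 ∨ v ≠ 0) :
    g • pt u v = pt (g 0 0 * u + g 0 1 * v) (g 1 0 * u + g 1 1 * v) := by
  by_cases hv : v = 0
  · have hu : u ≠ 0 := by tauto
    subst hv
    simp only [pt_zero, OnePoint.smul_infty_eq_ite, mul_zero, add_zero]
    unfold pt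
    simp only [mul_eq_zero, hu, or_false]
    rw [mul_div_mul_right _ _ hu]
  · rw [show pt u v = ((u / v : ℂ) : OnePoint ℂ) by simp [pt, hv], OnePoint.smul_some_eq_ite]
    have e1 : g 1 0 * u + g 1 1 * v = v * (g 1 0 * (u / v) + g 1 1) := by field_simp
    have e0 : g 0 0 * u + g 0 1 * v = v * (g 0 0 * (u / v) + g 0 1) := by field_simp
    rw [e0, e1, pt_smul hv, pt]

/-! ### The maps of the sphere -/

section Maps

variable {d : ℕ}

/-- The two forms have no common zero: the pair defines a map of degree `d`. -/
def NonDeg (F : Coeff d) : Prop :=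
  ∀ u v, hom F.1 u v = 0 → hom F.2 u v = 0 → u = 0 ∧ v = 0

lemma NonDeg.ne {F : Coeff d} (h : NonDeg F) {u v : ℂ} (huv : u ≠ 0 ∨ v ≠ 0) :
    hom F.1 u v ≠ 0 ∨ hom F.2 u v ≠ 0 := by
  by_contra! hc
  have := h u v hc.1 hc.2
  tauto

lemma toMap_pt (F : Coeff d) {u v : ℂ} (h : u ≠ 0 ∨ v ≠ 0) :
    toMap F (pt u v) = pt (hom F.1 u v) (hom F.2 u v) := by
  by_cases hv : v = 0
  · have hu : u ≠ 0 := by tauto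
    subst hv
    rw [hom_zero_right, hom_zero_right, mul_comm, mul_comm (F.2 _), pt_smul (pow_ne_zero _ hu)]
    simp [toMap, pt]
  · rw [hom_eq_pow_mul _ hv, hom_eq_pow_mul _ hv, pt_smul (pow_ne_zero _ hv),
      show pt u v = ((u / v : ℂ) : OnePoint ℂ) by simp [pt, hv]]
    simp only [toMap, OnePoint.elim_some, pt]

lemma toMap_smul {c : ℂ} (hc : c ≠ 0) (F : Coeff d) : toMap (c • F) = toMap F := by
  ext1 p
  obtain ⟨u, v, h, rfl⟩ := exists_pt p
  rw [toMap_pt _ h, toMap_pt _ h, Prod.smul_fst, Prod.smul_snd, hom_smul, hom_smul, pt_smul hc]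

/-- Since adj(g) g = det g, the forms only acquire the factor (det g)ᵈ, which is invisible
projectively. -/
lemma toMap_conjCoeff (g : GL (Fin 2) ℂ) (F : Coeff d) (hF : NonDeg F) (p : OnePoint ℂ) :
    toMap (conjCoeff g F) (g • p) = g • toMap F p := by
  obtain ⟨u, v, h, rfl⟩ := exists_pt p
  rw [smul_pt g u v h, toMap_pt _ (gl_apply_ne_zero g h), toMap_pt _ h, smul_pt g _ _ (hF.ne h),
    hom_conjCoeff_fst, hom_conjCoeff_snd]
  have e1 : (g : Matrix (Fin 2) (Fin 2) ℂ) 1 1 * (g 0 0 * u + g 0 1 * v) -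
      g 0 1 * (g 1 0 * u + g 1 1 * v) = (g 0 0 * g 1 1 - g 0 1 * g 1 0) * u := by ring
  have e2 : (g : Matrix (Fin 2) (Fin 2) ℂ) 0 0 * (g 1 0 * u + g 1 1 * v) -
      g 1 0 * (g 0 0 * u + g 0 1 * v) = (g 0 0 * g 1 1 - g 0 1 * g 1 0) * v := by ring
  rw [e1, e2, hom_mul_mul, hom_mul_mul, ← pt_smul (pow_ne_zero d (gl_det_ne_zero g))
    (g 0 0 * hom F.1 u v + g 0 1 * hom F.2 u v)]
  congr 1 <;> ring

lemma NonDeg.conjCoeff {F : Coeff d} (hF : NonDeg F) (g : GL (Fin 2) ℂ) :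
    NonDeg (conjCoeff g F) := by
  intro u v h1 h2
  rw [hom_conjCoeff_fst] at h1
  rw [hom_conjCoeff_snd] at h2
  by_contra hc
  have huv : u ≠ 0 ∨ v ≠ 0 := by tauto
  have hd := gl_det_ne_zero g
  have hne : (g 1 1 * u - g 0 1 * v) ≠ 0 ∨ (g 0 0 * v - g 1 0 * u) ≠ 0 := by
    by_contra! hc'
    have hu : (g 0 0 * g 1 1 - g 0 1 * g 1 0) * u = 0 := by
      linear_combination g 0 0 * hc'.1 + g 0 1 * hc'.2
    have hv : (g 0 0 * g 1 1 - g 0 1 * g 1 0) * v = 0 := by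
      linear_combination g 1 0 * hc'.1 + g 1 1 * hc'.2
    simp only [mul_eq_zero, hd, false_or] at hu hv
    tauto
  rcases gl_apply_ne_zero g (hF.ne hne) with h | h
  · exact h h1
  · exact h h2

lemma NonDeg.smul {F : Coeff d} (hF : NonDeg F) {c : ℂ} (hc : c ≠ 0) : NonDeg (c • F) := by
  intro u v h1 h2
  rw [Prod.smul_fst, hom_smul] at h1
  rw [Prod.smul_snd, hom_smul] at h2
  exact hF u v (by simpa [hc] using h1) (by simpa [hc] using h2)

lemma NonDeg.isCoprime {F : Coeff d} (hF : NonDeg F) : IsCoprime (toPoly F.1) (toPoly F.2) := by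
  rw [Polynomial.isCoprime_iff_aeval_ne_zero_of_isAlgClosed ℂ ℂ]
  intro z
  have := hF.ne (u := z) (v := 1) (by simp)
  rw [hom_one, hom_one] at this
  simpa [coe_aeval_eq_eval] using this

lemma NonDeg.last_ne {F : Coeff d} (hF : NonDeg F) :
    F.1 (Fin.last d) ≠ 0 ∨ F.2 (Fin.last d) ≠ 0 := by
  have := hF.ne (u := 1) (v := 0) (by simp)
  simpa [hom_zero_right] using this

lemma NonDeg.degree_eq {F : Coeff d} (hF : NonDeg F) :
    max (toPoly F.1).natDegree (toPoly F.2).natDegree = d := by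
  refine le_antisymm (max_le (natDegree_toPoly_le _) (natDegree_toPoly_le _)) ?_
  rcases hF.last_ne with h | h
  · refine le_trans ?_ (le_max_left _ _)
    refine le_natDegree_of_ne_zero ?_
    simpa using (toPoly_coeff_fin F.1 (Fin.last d)).trans_ne h
  · refine le_trans ?_ (le_max_right _ _)
    refine le_natDegree_of_ne_zero ?_
    simpa using (toPoly_coeff_fin F.2 (Fin.last d)).trans_ne h

/-- Coprimality excludes a common zero at a finite point, the degree condition one at ∞. -/
lemma MarkedRat.nonDeg (m : MarkedRat d) : NonDeg m.coeff := by
  have hc := m.coprime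
  rw [Polynomial.isCoprime_iff_aeval_ne_zero_of_isAlgClosed ℂ ℂ] at hc
  intro u v h1 h2
  by_cases hv : v = 0
  · subst hv
    rw [hom_zero_right] at h1 h2
    by_contra hu
    have hu : u ≠ 0 := by simpa using hu
    simp only [mul_eq_zero, pow_eq_zero_iff', hu, false_and, or_false] at h1 h2
    have key : ∀ a : Fin (d + 1) → ℂ, a (Fin.last d) = 0 → (toPoly a).natDegree = d →
        toPoly a = 0 ∨ d = 0 := by
      intro a ha hd
      left
      rw [← leadingCoeff_eq_zero, leadingCoeff, hd]
      simpa using (toPoly_coeff_fin a (Fin.last d)).trans ha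
    have hd := m.degree_eq
    -- In degree zero `natDegree` cannot tell a nonzero constant from 0, so coprimality at the point
    -- 0 has to exclude two vanishing constants.
    have hzero : d = 0 → False := by
      intro hd0
      subst hd0
      have := hc 0
      simp [toPoly] at this
      rcases this with h | h
      · exact h h1
      · exact h h2
    have h0 : ∀ a : Fin (d + 1) → ℂ, a (Fin.last d) = 0 → (toPoly a).natDegree = d → False := by
      intro a ha hda
      rcases key a ha hda with h | h
      · rw [h] at hda; simp at hda; exact hzero hda.symm
      · exact hzero h
    rcases max_choice (toPoly m.coeff.1).natDegree (toPoly m.coeff.2).natDegree with h | h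
    · exact h0 _ h1 (h ▸ hd)
    · exact h0 _ h2 (h ▸ hd)
  · exfalso
    rw [hom_eq_pow_mul _ hv] at h1 h2
    have := hc (u / v)
    simp only [mul_eq_zero, pow_eq_zero_iff', hv, false_and, false_or] at h1 h2
    simp [coe_aeval_eq_eval, h1, h2] at this

/-- The polynomial whose zeros are the finite fixed points. -/
def fixPoly (F : Coeff d) : ℂ[X] := X * toPoly F.2 - toPoly F.1

lemma fixPoly_eval (F : Coeff d) (z : ℂ) : (fixPoly F).eval z = z * hom F.2 z 1 - hom F.1 z 1 := by
  simp [fixPoly, hom_one]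

lemma natDegree_fixPoly_le (F : Coeff d) : (fixPoly F).natDegree ≤ d + 1 := by
  refine (natDegree_sub_le _ _).trans (max_le ?_ ?_)
  · refine natDegree_mul_le.trans ?_
    have := natDegree_toPoly_le F.2
    have h1 : (X : ℂ[X]).natDegree ≤ 1 := natDegree_X_le
    omega
  · exact (natDegree_toPoly_le _).trans (Nat.le_succ d)

lemma fixPoly_coeff_succ (F : Coeff d) : (fixPoly F).coeff (d + 1) = F.2 (Fin.last d) := by
  rw [fixPoly, coeff_sub, coeff_X_mul, toPoly_coeff F.1, dif_neg (by omega), sub_zero]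
  exact toPoly_coeff_fin F.2 (Fin.last d)

lemma toMap_pt_eq_self_iff {F : Coeff d} (hF : NonDeg F) {u v : ℂ} (h : u ≠ 0 ∨ v ≠ 0) :
    toMap F (pt u v) = pt u v ↔ u * hom F.2 u v - v * hom F.1 u v = 0 := by
  rw [toMap_pt _ h, pt_eq_pt_iff (hF.ne h) h, sub_eq_zero, mul_comm v, eq_comm]

lemma toMap_coe_eq_self_iff {F : Coeff d} (hF : NonDeg F) (z : ℂ) :
    toMap F (z : OnePoint ℂ) = z ↔ (fixPoly F).IsRoot z := by
  rw [← pt_one, toMap_pt_eq_self_iff hF (by simp), IsRoot, fixPoly_eval, one_mul]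

lemma toMap_infty_eq_self_iff {F : Coeff d} :
    toMap F ∞ = ∞ ↔ F.2 (Fin.last d) = 0 := by
  simp [toMap]

/-- Otherwise the map is the identity: the numerator is z times the denominator, coprimality makes
the denominator constant, and the degree is at most one. -/
lemma fixPoly_ne_zero (hd : 2 ≤ d) {F : Coeff d} (hF : NonDeg F) : fixPoly F ≠ 0 := by
  intro h0
  have hab : toPoly F.1 = X * toPoly F.2 := (sub_eq_zero.1 h0).symm
  have hc := hF.isCoprime
  rw [hab] at hc
  have hu : IsUnit (toPoly F.2) := hc.isUnit_of_dvd' (Dvd.intro_left _ rfl) dvd_rfl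
  have h2 := natDegree_eq_zero_of_isUnit hu
  have h1 : (toPoly F.1).natDegree ≤ 1 := by
    rw [hab]
    refine natDegree_mul_le.trans ?_
    rw [h2]; exact natDegree_X_le
  have := hF.degree_eq
  omega

lemma mem_fixedPoints_iff (hd : 2 ≤ d) {F : Coeff d} (hF : NonDeg F) (p : OnePoint ℂ) :
    p ∈ fixedPoints F ↔ toMap F p = p := by
  have h0 := fixPoly_ne_zero hd hF
  have hroots : fixedPoints F = (fixPoly F).roots.map (fun z : ℂ => (z : OnePoint ℂ)) +
    Multiset.replicate (d + 1 - (fixPoly F).natDegree) ∞ := rfl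
  rw [hroots, Multiset.mem_add, Multiset.mem_map, Multiset.mem_replicate]
  induction p using OnePoint.rec with
  | infty =>
    rw [toMap_infty_eq_self_iff, ← fixPoly_coeff_succ]
    have hle := natDegree_fixPoly_le F
    simp only [OnePoint.coe_ne_infty, and_false, exists_false, false_or, and_true]
    constructor
    · intro h
      exact coeff_eq_zero_of_natDegree_lt (by omega)
    · intro h h'
      have : (fixPoly F).natDegree = d + 1 := by omega
      rw [← this] at h
      exact h0 (leadingCoeff_eq_zero.1 h)
  | coe z =>
    rw [toMap_coe_eq_self_iff hF]
    simp [h0]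

lemma card_fixedPoints (F : Coeff d) : Multiset.card (fixedPoints F) = d + 1 := by
  have hroots : fixedPoints F = (fixPoly F).roots.map (fun z : ℂ => (z : OnePoint ℂ)) +
    Multiset.replicate (d + 1 - (fixPoly F).natDegree) ∞ := rfl
  have hle := natDegree_fixPoly_le F
  have hs := splits_iff_card_roots.1 (IsAlgClosed.splits (fixPoly F))
  rw [hroots, Multiset.card_add, Multiset.card_map, Multiset.card_replicate, hs]
  omega

/-- A marked rational map from a list of `d + 1` distinct fixed points. -/
def MarkedRat.ofInjective (hd : 2 ≤ d) (F : Coeff d) (x : Fin (d + 1) → OnePoint ℂ)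
    (hF : NonDeg F) (hx : Function.Injective x) (hfix : ∀ i, toMap F (x i) = x i) :
    MarkedRat d where
  coeff := F
  mark := x
  coprime := hF.isCoprime
  degree_eq := hF.degree_eq
  mark_eq := by
    -- Being distinct, the marks form a submultiset of the fixed points, and both multisets have d +
    -- 1 elements.
    refine Multiset.eq_of_le_of_card_le ?_ ?_
    · rw [Multiset.le_iff_subset (Finset.univ.nodup.map hx)]
      intro p hp
      obtain ⟨i, -, rfl⟩ := Multiset.mem_map.1 hp
      exact (mem_fixedPoints_iff hd hF _).2 (hfix i)
    · simp [card_fixedPoints]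

lemma MarkedRat.map_eq_iff (hd : 2 ≤ d) (m : MarkedRat d) (p : OnePoint ℂ) :
    m.map p = p ↔ ∃ i, m.mark i = p := by
  rw [MarkedRat.map, ← mem_fixedPoints_iff hd m.nonDeg, ← m.mark_eq, Multiset.mem_map]
  simp only [Finset.mem_val, Finset.mem_univ, true_and]

lemma MarkedRat.map_mark (hd : 2 ≤ d) (m : MarkedRat d) (i : Fin (d + 1)) :
    m.map (m.mark i) = m.mark i := (m.map_eq_iff hd _).2 ⟨i, rfl⟩

lemma toModuli_eq_iff (m n : MarkedRat d) : m.toModuli = n.toModuli ↔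
    ∃ g : GL (Fin 2) ℂ, (∀ p, n.map (g • p) = g • m.map p) ∧ ∀ i, n.mark i = g • m.mark i :=
  Quotient.eq

open Classical in
/-- The conjugate of a marked map with distinct fixed points. -/
def MarkedRat.conj (hd : 2 ≤ d) (g : GL (Fin 2) ℂ) (m : MarkedRat d) : MarkedRat d :=
  if h : Function.Injective m.mark then
    MarkedRat.ofInjective hd (conjCoeff g m.coeff) (fun i => g • m.mark i) (m.nonDeg.conjCoeff g)
      ((MulAction.injective g).comp h)
      fun i => by rw [toMap_conjCoeff g _ m.nonDeg]; exact congrArg _ (m.map_mark hd i)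
  -- Default value for repeated marks. It allows a whole curve to be conjugated, including the times
  -- at which nothing is known about it.
  else m

section conj

variable (hd : 2 ≤ d) (g : GL (Fin 2) ℂ) {m : MarkedRat d} (h : Function.Injective m.mark)
include h

lemma MarkedRat.conj_coeff : (m.conj hd g).coeff = conjCoeff g m.coeff := by
  rw [MarkedRat.conj, dif_pos h]; rfl

lemma MarkedRat.conj_mark (i : Fin (d + 1)) : (m.conj hd g).mark i = g • m.mark i := by
  rw [MarkedRat.conj, dif_pos h]; rfl

lemma MarkedRat.conj_map (p : OnePoint ℂ) : (m.conj hd g).map (g • p) = g • m.map p := by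
  rw [MarkedRat.map, m.conj_coeff hd g h, toMap_conjCoeff g _ m.nonDeg]; rfl

lemma MarkedRat.toModuli_conj : (m.conj hd g).toModuli = m.toModuli :=
  ((toModuli_eq_iff _ _).2 ⟨g, m.conj_map hd g h, m.conj_mark hd g h⟩).symm

end conj

lemma injective_mark_of_toModuli_eq {m n : MarkedRat d} (h : m.toModuli = n.toModuli)
    (hm : Function.Injective m.mark) : Function.Injective n.mark := by
  obtain ⟨g, -, hg⟩ := (toModuli_eq_iff _ _).1 h
  rw [show n.mark = (g • ·) ∘ m.mark from funext hg]
  exact (MulAction.injective g).comp hm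

end Maps


/-! ### Charts of the sphere and the chordal metric -/

lemma coordInfty_zero : coordInfty 0 = ∞ := by simp [coordInfty]

/-- `coordInfty` is a chart at ∞: inversion turns punctured neighbourhoods of 0 into neighbourhoods
of infinity in ℂ. -/
lemma nhds_infty_eq_map : 𝓝 (∞ : OnePoint ℂ) = map coordInfty (𝓝 0) := by
  rw [OnePoint.nhds_infty_eq, ← nhdsNE_sup_pure (0 : ℂ), map_sup, map_pure, coordInfty_zero,
    coclosedCompact_eq_cocompact, ← Metric.cobounded_eq_cocompact, ← inv_nhdsNE_zero]
  congr 1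
  change Filter.map _ (Filter.map Inv.inv _) = _
  rw [Filter.map_map]
  refine Filter.map_congr ?_
  filter_upwards [self_mem_nhdsWithin] with w hw
  have : w ≠ 0 := hw
  simp [coordInfty, this]

/-- Around every point there is a chart given by a pair of homogeneous coordinates. -/
lemma exists_chart (p : OnePoint ℂ) : ∃ (α β : ℂ → ℂ) (x₀ : ℂ), Continuous α ∧ Continuous β ∧
    (∀ x, α x ≠ 0 ∨ β x ≠ 0) ∧ pt (α x₀) (β x₀) = p ∧
      𝓝 p = map (fun x => pt (α x) (β x)) (𝓝 x₀) := by
  induction p using OnePoint.rec with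
  | infty =>
    refine ⟨fun _ => 1, fun w => w, 0, continuous_const, continuous_id, by simp, by simp, ?_⟩
    rw [nhds_infty_eq_map]
    simp only [pt_one_left]
  | coe z =>
    refine ⟨fun z => z, fun _ => 1, z, continuous_id, continuous_const, by simp, by simp, ?_⟩
    rw [OnePoint.nhds_coe_eq]
    simp only [pt_one]

lemma continuous_coordInfty : Continuous coordInfty := by
  rw [continuous_iff_continuousAt]
  intro w
  by_cases hw : w = 0
  · subst hw
    rw [ContinuousAt, coordInfty_zero, nhds_infty_eq_map]
    exact tendsto_map
  · have : coordInfty =ᶠ[𝓝 w] fun w => ((w⁻¹ : ℂ) : OnePoint ℂ) := by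
      filter_upwards [isOpen_ne.mem_nhds hw] with x hx
      have : x ≠ 0 := hx
      simp [coordInfty, this]
    refine ContinuousAt.congr ?_ this.symm
    exact OnePoint.continuous_coe.continuousAt.comp (continuousAt_inv₀ hw)

lemma continuousAt_pt {u v : ℂ} (h : u ≠ 0 ∨ v ≠ 0) :
    ContinuousAt (fun x : ℂ × ℂ => pt x.1 x.2) (u, v) := by
  by_cases hv : v = 0
  · have hu : u ≠ 0 := by tauto
    have : (fun x : ℂ × ℂ => pt x.1 x.2) =ᶠ[𝓝 (u, v)] fun x => coordInfty (x.2 / x.1) := by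
      filter_upwards [continuous_fst.continuousAt.eventually_ne (x := ((u, v) : ℂ × ℂ)) hu]
        with x hx
      have hx : x.1 ≠ 0 := hx
      rw [← pt_one_left, ← pt_smul hx 1, mul_one, mul_div_cancel₀ _ hx]
    refine ContinuousAt.congr ?_ this.symm
    exact continuous_coordInfty.continuousAt.comp
      (continuousAt_snd.div continuousAt_fst hu)
  · have : (fun x : ℂ × ℂ => pt x.1 x.2) =ᶠ[𝓝 (u, v)]
        fun x => ((x.1 / x.2 : ℂ) : OnePoint ℂ) := by
      filter_upwards [continuous_snd.continuousAt.eventually_ne (x := ((u, v) : ℂ × ℂ)) hv]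
        with x hx
      have hx : x.2 ≠ 0 := hx
      simp [pt, hx]
    refine ContinuousAt.congr ?_ this.symm
    exact OnePoint.continuous_coe.continuousAt.comp
      (continuousAt_fst.div continuousAt_snd hv)

/-- A self-map of the sphere given by continuous homogeneous expressions is continuous. -/
lemma continuous_of_pt {T : OnePoint ℂ → OnePoint ℂ} {A B : ℂ × ℂ → ℂ} (hA : Continuous A)
    (hB : Continuous B) (hne : ∀ u v, u ≠ 0 ∨ v ≠ 0 → A (u, v) ≠ 0 ∨ B (u, v) ≠ 0)
    (hT : ∀ u v, u ≠ 0 ∨ v ≠ 0 → T (pt u v) = pt (A (u, v)) (B (u, v))) : Continuous T := by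
  rw [continuous_iff_continuousAt]
  intro p
  obtain ⟨α, β, x₀, hα, hβ, h, rfl, hn⟩ := exists_chart p
  rw [ContinuousAt, hn, tendsto_map'_iff, hT _ _ (h x₀)]
  have : T ∘ (fun x => pt (α x) (β x)) = fun x => pt (A (α x, β x)) (B (α x, β x)) :=
    funext fun x => hT _ _ (h x)
  rw [this]
  exact (continuousAt_pt (hne _ _ (h x₀))).comp
    (f := fun x => (A (α x, β x), B (α x, β x))) (by fun_prop)

lemma continuous_toMap {d : ℕ} {F : Coeff d} (hF : NonDeg F) : Continuous (toMap F) :=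
  continuous_of_pt (A := fun x => hom F.1 x.1 x.2) (B := fun x => hom F.2 x.1 x.2)
    (continuous_hom _) (continuous_hom _) (fun _ _ h => hF.ne h) fun _ _ h => toMap_pt F h

lemma continuous_gl_smul (g : GL (Fin 2) ℂ) : Continuous fun p : OnePoint ℂ => g • p :=
  continuous_of_pt (A := fun x => g 0 0 * x.1 + g 0 1 * x.2)
    (B := fun x => g 1 0 * x.1 + g 1 1 * x.2) (by fun_prop) (by fun_prop)
    (fun _ _ h => gl_apply_ne_zero g h) fun _ _ h => smul_pt g _ _ h

/-- A Möbius transformation as a homeomorphism of the sphere. -/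
def glHomeo (g : GL (Fin 2) ℂ) : OnePoint ℂ ≃ₜ OnePoint ℂ where
  toEquiv := MulAction.toPerm g
  continuous_toFun := continuous_gl_smul g
  continuous_invFun := continuous_gl_smul g⁻¹

@[simp] lemma glHomeo_apply (g : GL (Fin 2) ℂ) (p : OnePoint ℂ) : glHomeo g p = g • p := rfl

/-- The reflection `z ↦ 1 / conj z` in the unit circle. -/
def sig (p : OnePoint ℂ) : OnePoint ℂ :=
  p.elim ((0 : ℂ) : OnePoint ℂ) fun z => coordInfty (starRingEnd ℂ z)

lemma sig_pt {u v : ℂ} (h : u ≠ 0 ∨ v ≠ 0) :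
    sig (pt u v) = pt (starRingEnd ℂ v) (starRingEnd ℂ u) := by
  by_cases hv : v = 0
  · subst hv
    have hu : u ≠ 0 := by tauto
    simp [sig, pt, hu]
  · rw [show pt u v = ((u / v : ℂ) : OnePoint ℂ) by simp [pt, hv]]
    have hv' : starRingEnd ℂ v ≠ 0 := by simpa using hv
    simp only [sig, OnePoint.elim_some]
    rw [← pt_one_left, ← pt_smul hv' 1, map_div₀, mul_one, mul_div_cancel₀ _ hv']

lemma sig_sig (p : OnePoint ℂ) : sig (sig p) = p := by
  obtain ⟨u, v, h, rfl⟩ := exists_pt p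
  rw [sig_pt h, sig_pt (by simpa [or_comm] using h)]
  simp

lemma continuous_sig : Continuous sig :=
  continuous_of_pt (A := fun x => starRingEnd ℂ x.2) (B := fun x => starRingEnd ℂ x.1)
    (Complex.continuous_conj.comp continuous_snd) (Complex.continuous_conj.comp continuous_fst)
    (fun _ _ h => by simpa [or_comm] using h) fun _ _ h => sig_pt h

/-- The reflection in the unit circle as a homeomorphism. -/
def sigHomeo : OnePoint ℂ ≃ₜ OnePoint ℂ where
  toFun := sig
  invFun := sig
  left_inv := sig_sig
  right_inv := sig_sig
  continuous_toFun := continuous_sig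
  continuous_invFun := continuous_sig

/-! ### The chordal metric in homogeneous coordinates -/

lemma sqrt_one_add_norm_div {u v : ℂ} (hv : v ≠ 0) :
    √(1 + ‖u / v‖ ^ 2) = √(‖u‖ ^ 2 + ‖v‖ ^ 2) / ‖v‖ := by
  have h : 0 < ‖v‖ := norm_pos_iff.2 hv
  rw [Real.sqrt_eq_iff_mul_self_eq (by positivity) (by positivity), div_mul_div_comm,
    Real.mul_self_sqrt (by positivity), norm_div]
  field_simp
  ring

lemma sqrt_norm_pos {u v : ℂ} (h : u ≠ 0 ∨ v ≠ 0) : 0 < √(‖u‖ ^ 2 + ‖v‖ ^ 2) := by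
  refine Real.sqrt_pos.2 ?_
  rcases h with h | h
  · have : 0 < ‖u‖ := norm_pos_iff.2 h
    positivity
  · have : 0 < ‖v‖ := norm_pos_iff.2 h
    positivity

/-- A single formula for the four cases of the definition; definiteness, continuity and invariance
under the reflection are read off from it. -/
lemma chordal_pt {u v u' v' : ℂ} (h : u ≠ 0 ∨ v ≠ 0) (h' : u' ≠ 0 ∨ v' ≠ 0) :
    chordal (pt u v) (pt u' v') =
      2 * ‖u * v' - u' * v‖ / (√(‖u‖ ^ 2 + ‖v‖ ^ 2) * √(‖u'‖ ^ 2 + ‖v'‖ ^ 2)) := by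
  have hs := sqrt_norm_pos h
  have hs' := sqrt_norm_pos h'
  by_cases hv : v = 0 <;> by_cases hv' : v' = 0
  · simp [hv, hv', chordal]
  · have hu : u ≠ 0 := by tauto
    have hu0 : 0 < ‖u‖ := norm_pos_iff.2 hu
    have hv0 : 0 < ‖v'‖ := norm_pos_iff.2 hv'
    subst hv
    have e1 : √(‖u‖ ^ 2 + ‖(0 : ℂ)‖ ^ 2) = ‖u‖ := by simp
    rw [e1, pt_zero, show pt u' v' = ((u' / v' : ℂ) : OnePoint ℂ) by simp [pt, hv']]
    simp only [chordal, OnePoint.elim_infty, OnePoint.elim_some]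
    rw [sqrt_one_add_norm_div hv', mul_zero, sub_zero, norm_mul]
    field_simp
  · have hu : u' ≠ 0 := by tauto
    have hu0 : 0 < ‖u'‖ := norm_pos_iff.2 hu
    have hv0 : 0 < ‖v‖ := norm_pos_iff.2 hv
    subst hv'
    have e1 : √(‖u'‖ ^ 2 + ‖(0 : ℂ)‖ ^ 2) = ‖u'‖ := by simp
    rw [e1, pt_zero, show pt u v = ((u / v : ℂ) : OnePoint ℂ) by simp [pt, hv]]
    simp only [chordal, OnePoint.elim_infty, OnePoint.elim_some]
    rw [sqrt_one_add_norm_div hv, mul_zero, zero_sub, norm_neg, norm_mul]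
    field_simp
  · have hv0 : 0 < ‖v‖ := norm_pos_iff.2 hv
    have hv0' : 0 < ‖v'‖ := norm_pos_iff.2 hv'
    rw [show pt u v = ((u / v : ℂ) : OnePoint ℂ) by simp [pt, hv],
      show pt u' v' = ((u' / v' : ℂ) : OnePoint ℂ) by simp [pt, hv']]
    simp only [chordal, OnePoint.elim_some]
    rw [sqrt_one_add_norm_div hv, sqrt_one_add_norm_div hv', div_sub_div _ _ hv hv', norm_div,
      norm_mul, mul_comm v u']
    field_simp

lemma chordal_nonneg (p q : OnePoint ℂ) : 0 ≤ chordal p q := by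
  obtain ⟨u, v, h, rfl⟩ := exists_pt p
  obtain ⟨u', v', h', rfl⟩ := exists_pt q
  rw [chordal_pt h h']
  positivity

lemma chordal_eq_zero_iff {p q : OnePoint ℂ} : chordal p q = 0 ↔ p = q := by
  obtain ⟨u, v, h, rfl⟩ := exists_pt p
  obtain ⟨u', v', h', rfl⟩ := exists_pt q
  have hs := (sqrt_norm_pos h).ne'
  have hs' := (sqrt_norm_pos h').ne'
  rw [chordal_pt h h', pt_eq_pt_iff h h', div_eq_zero_iff]
  simp [hs, hs', sub_eq_zero]

lemma chordal_self (p : OnePoint ℂ) : chordal p p = 0 := chordal_eq_zero_iff.2 rfl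

lemma chordal_pos {p q : OnePoint ℂ} (h : p ≠ q) : 0 < chordal p q :=
  (chordal_nonneg p q).lt_of_ne fun h' => h (chordal_eq_zero_iff.1 h'.symm)

lemma continuous_chordal : Continuous fun x : OnePoint ℂ × OnePoint ℂ => chordal x.1 x.2 := by
  rw [continuous_iff_continuousAt]
  rintro ⟨p, q⟩
  obtain ⟨α, β, x₀, hα, hβ, h, rfl, hn⟩ := exists_chart p
  obtain ⟨α', β', x₀', hα', hβ', h', rfl, hn'⟩ := exists_chart q
  rw [ContinuousAt, nhds_prod_eq, hn, hn', prod_map_map_eq, tendsto_map'_iff, ← nhds_prod_eq]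
  have e : (fun x : OnePoint ℂ × OnePoint ℂ => chordal x.1 x.2) ∘
      (fun x : ℂ × ℂ => (pt (α x.1) (β x.1), pt (α' x.2) (β' x.2))) = fun x : ℂ × ℂ =>
      2 * ‖α x.1 * β' x.2 - α' x.2 * β x.1‖ /
        (√(‖α x.1‖ ^ 2 + ‖β x.1‖ ^ 2) * √(‖α' x.2‖ ^ 2 + ‖β' x.2‖ ^ 2)) :=
    funext fun x => chordal_pt (h x.1) (h' x.2)
  rw [e]
  dsimp only
  rw [chordal_pt (h x₀) (h' x₀')]
  have : Continuous fun x : ℂ × ℂ => 2 * ‖α x.1 * β' x.2 - α' x.2 * β x.1‖ /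
        (√(‖α x.1‖ ^ 2 + ‖β x.1‖ ^ 2) * √(‖α' x.2‖ ^ 2 + ‖β' x.2‖ ^ 2)) := by
    refine Continuous.div (by fun_prop) (by fun_prop) fun x => ?_
    exact (mul_pos (sqrt_norm_pos (h x.1)) (sqrt_norm_pos (h' x.2))).ne'
  exact this.tendsto (x₀, x₀')

lemma chordal_lt_mem_nhds (p : OnePoint ℂ) {ε : ℝ} (hε : 0 < ε) : {q | chordal q p < ε} ∈ 𝓝 p := by
  have : Continuous fun q => chordal q p :=
    continuous_chordal.comp (f := fun q => (q, p)) (by fun_prop)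
  exact (isOpen_lt this continuous_const).mem_nhds (by simpa [chordal_self] using hε)

/-- A uniform lower bound of the chordal distance on a compact set of pairs off the diagonal. -/
lemma exists_chordal_le {K : Set (OnePoint ℂ × OnePoint ℂ)} (hK : IsClosed K)
    (h : ∀ x ∈ K, x.1 ≠ x.2) : ∃ δ > 0, ∀ x ∈ K, δ ≤ chordal x.1 x.2 := by
  rcases K.eq_empty_or_nonempty with rfl | hne
  · exact ⟨1, one_pos, by simp⟩
  · obtain ⟨x, hx, hmin⟩ := hK.isCompact.exists_isMinOn hne continuous_chordal.continuousOn
    exact ⟨chordal x.1 x.2, chordal_pos (h x hx), fun y hy => hmin hy⟩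

/-- By compactness the chordal distance to p is bounded below off an open neighbourhood of p. Thus
the chordal metric induces the topology, and no triangle inequality is needed. -/
lemma exists_chordal_lt_imp_mem {p : OnePoint ℂ} {V : Set (OnePoint ℂ)} (hV : V ∈ 𝓝 p) :
    ∃ ε > 0, ∀ q, chordal q p < ε → q ∈ V := by
  obtain ⟨W, hWV, hW, hp⟩ := mem_nhds_iff.1 hV
  obtain ⟨δ, hδ, h⟩ := exists_chordal_le (K := Wᶜ ×ˢ {p}) (hW.isClosed_compl.prod isClosed_singleton)
    (by
      rintro ⟨q, r⟩ ⟨hq, hr⟩ h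
      have hr : r = p := hr
      have h : q = r := h
      exact hq (show q ∈ W by rw [h, hr]; exact hp))
  refine ⟨δ, hδ, fun q hq => hWV ?_⟩
  by_contra hqW
  exact absurd (h (q, p) ⟨hqW, rfl⟩) (not_le.2 hq)

/-- Uniform continuity, by the same compactness argument on pairs whose images are ε apart. -/
lemma exists_chordal_image_lt {φ : OnePoint ℂ → OnePoint ℂ} (hφ : Continuous φ) {ε : ℝ}
    (hε : 0 < ε) : ∃ δ > 0, ∀ p q, chordal p q < δ → chordal (φ p) (φ q) < ε := by
  obtain ⟨δ, hδ, h⟩ := exists_chordal_le (K := {x | ε ≤ chordal (φ x.1) (φ x.2)})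
    (isClosed_le continuous_const (continuous_chordal.comp
      (f := fun x : OnePoint ℂ × OnePoint ℂ => (φ x.1, φ x.2)) (by fun_prop)))
    (by
      rintro ⟨q, r⟩ h (rfl : q = r)
      have h : ε ≤ chordal (φ q) (φ q) := h
      rw [chordal_self] at h
      exact absurd h (not_le.2 hε))
  refine ⟨δ, hδ, fun p q hpq => ?_⟩
  by_contra hc
  exact absurd (h (p, q) (not_lt.1 hc)) (not_le.2 hpq)

/-! ### Invariance of the Fatou set, attracting points -/

section Conjugacy

variable {f f' : OnePoint ℂ → OnePoint ℂ} (φ : OnePoint ℂ ≃ₜ OnePoint ℂ)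
  (h : ∀ p, f' (φ p) = φ (f p))
include h

lemma iterate_conj (k : ℕ) (p : OnePoint ℂ) : f'^[k] (φ p) = φ (f^[k] p) :=
  ((Function.Semiconj.iterate_right (f := φ) (ga := f) (gb := f') (fun p => (h p).symm) k) p).symm

lemma symm_conj (p : OnePoint ℂ) : f (φ.symm p) = φ.symm (f' p) := by
  obtain ⟨q, rfl⟩ := φ.surjective p
  rw [h]; simp

lemma isNormalOn_image {U : Set (OnePoint ℂ)} (hU : IsNormalOn f U) : IsNormalOn f' (φ '' U) := by
  intro a ha
  obtain ⟨b, hb, g, hg⟩ := hU a ha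
  refine ⟨b, hb, fun p => φ (g (φ.symm p)), ?_⟩
  rintro _ ⟨p, hp, rfl⟩ ε hε
  obtain ⟨δ, hδ, hφ⟩ := exists_chordal_image_lt φ.continuous hε
  obtain ⟨V, hV, hk⟩ := hg p hp δ hδ
  refine ⟨φ '' V, φ.isOpenMap.image_mem_nhds hV, hk.mono ?_⟩
  rintro k hk _ ⟨q, hq, rfl⟩
  dsimp only
  rw [iterate_conj φ h, φ.symm_apply_apply]
  exact hφ _ _ (hk q hq)

lemma image_mem_fatouSet {p : OnePoint ℂ} (hp : p ∈ fatouSet f) : φ p ∈ fatouSet f' := by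
  obtain ⟨U, hU, hpU, hn⟩ := hp
  exact ⟨φ '' U, φ.isOpenMap _ hU, mem_image_of_mem _ hpU, isNormalOn_image φ h hn⟩

/-- Only a topological conjugacy is required, so this covers both Möbius maps and the
orientation-reversing reflection. -/
lemma mem_fatouSet_iff {p : OnePoint ℂ} : φ p ∈ fatouSet f' ↔ p ∈ fatouSet f := by
  refine ⟨fun hp => ?_, image_mem_fatouSet φ h⟩
  simpa using image_mem_fatouSet φ.symm (symm_conj φ h) hp

end Conjugacy

/-- All points near `p` converge to `p`, uniformly. -/
def AttractsNear (f : OnePoint ℂ → OnePoint ℂ) (p : OnePoint ℂ) : Prop :=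
  ∃ U ∈ 𝓝 p, ∀ V ∈ 𝓝 p, ∀ᶠ k in atTop, ∀ q ∈ U, f^[k] q ∈ V

lemma AttractsNear.image {f f' : OnePoint ℂ → OnePoint ℂ} (φ : OnePoint ℂ ≃ₜ OnePoint ℂ)
    (h : ∀ p, f' (φ p) = φ (f p)) {p : OnePoint ℂ} (hp : AttractsNear f p) :
    AttractsNear f' (φ p) := by
  obtain ⟨U, hU, hV⟩ := hp
  refine ⟨φ '' U, φ.isOpenMap.image_mem_nhds hU, fun V hVn => ?_⟩
  filter_upwards [hV _ (φ.continuous.continuousAt hVn)] with k hk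
  rintro _ ⟨q, hq, rfl⟩
  rw [iterate_conj φ h]
  exact hk q hq

lemma isNormalOn_of_tendsto {f : OnePoint ℂ → OnePoint ℂ} {p : OnePoint ℂ} {U : Set (OnePoint ℂ)}
    (h : ∀ q ∈ U, ∃ W ∈ 𝓝 q, ∀ V ∈ 𝓝 p, ∀ᶠ k in atTop, ∀ x ∈ W, f^[k] x ∈ V) :
    IsNormalOn f U := by
  intro a ha
  refine ⟨id, strictMono_id, fun _ => p, fun q hq ε hε => ?_⟩
  obtain ⟨W, hW, hk⟩ := h q hq
  exact ⟨W, hW, ha.tendsto_atTop.eventually (hk _ (chordal_lt_mem_nhds p hε))⟩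

lemma AttractsNear.mem_fatouSet {f : OnePoint ℂ → OnePoint ℂ} {p : OnePoint ℂ}
    (hp : AttractsNear f p) : p ∈ fatouSet f := by
  obtain ⟨U, hU, hV⟩ := hp
  obtain ⟨W, hWU, hW, hpW⟩ := mem_nhds_iff.1 hU
  refine ⟨W, hW, hpW, isNormalOn_of_tendsto (p := p) fun q hq => ⟨W, hW.mem_nhds hq, ?_⟩⟩
  exact fun V hVn => (hV V hVn).mono fun k hk x hx => hk x (hWU hx)

/-- A multiplier below one gives a geometric contraction of chordal distances to p. The conclusion
is purely topological, so it passes through conjugacies without a chain rule. -/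
lemma IsAttractingFixedPoint.attractsNear {f : OnePoint ℂ → OnePoint ℂ} {p : OnePoint ℂ}
    (hp : IsAttractingFixedPoint f p) : AttractsNear f p := by
  obtain ⟨hfp, s, hs, hlim⟩ := hp
  -- The maximum with 0 makes the contraction factor t nonnegative, since s carries no sign.
  obtain ⟨t, hst, ht⟩ := exists_between (max_lt hs one_pos)
  have ht0 : 0 ≤ t := (le_max_right _ _).trans hst.le
  have hev := hlim.eventually_lt_const ((le_max_left _ _).trans_lt hst)
  obtain ⟨ε, hε, hball⟩ := exists_chordal_lt_imp_mem (mem_nhdsWithin_iff_eventually.1 hev)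
  have hstep : ∀ q, chordal q p < ε → chordal (f q) p ≤ t * chordal q p := by
    intro q hq
    by_cases hqp : q = p
    · subst hqp; simp [hfp, chordal_self]
    · have := hball q hq hqp
      have h : chordal (f q) (f p) / chordal q p < t := this
      rw [hfp, div_lt_iff₀ (chordal_pos hqp)] at h
      exact h.le
  have hiter : ∀ k q, chordal q p < ε → chordal (f^[k] q) p ≤ t ^ k * chordal q p := by
    intro k q hq
    induction k with
    | zero => simp
    | succ k ih =>
      rw [Function.iterate_succ_apply']
      have hle : t ^ k * chordal q p ≤ chordal q p :=
        mul_le_of_le_one_left (chordal_nonneg _ _) (pow_le_one₀ ht0 ht.le)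
      refine (hstep _ ((ih.trans hle).trans_lt hq)).trans ?_
      rw [pow_succ', mul_assoc]
      exact mul_le_mul_of_nonneg_left ih ht0
  refine ⟨{q | chordal q p < ε}, chordal_lt_mem_nhds p hε, fun V hV => ?_⟩
  obtain ⟨η, hη, hηV⟩ := exists_chordal_lt_imp_mem hV
  have hlim0 : Tendsto (fun k : ℕ => t ^ k * ε) atTop (𝓝 0) := by
    simpa using (tendsto_pow_atTop_nhds_zero_of_lt_one ht0 ht).mul_const ε
  filter_upwards [hlim0.eventually_lt_const hη] with k hk q hq
  refine hηV _ ((hiter k q hq).trans_lt (lt_of_le_of_lt ?_ hk))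
  exact mul_le_mul_of_nonneg_left (le_of_lt hq) (pow_nonneg ht0 k)


/-! ### The Schwarz–Pick inequality -/

/-- The involution of the unit disk that exchanges `0` and `a`. -/
def diskInv (a w : ℂ) : ℂ := (a - w) / (1 - starRingEnd ℂ a * w)

lemma norm_one_sub_sq (a w : ℂ) : ‖1 - starRingEnd ℂ a * w‖ ^ 2 =
    ‖a - w‖ ^ 2 + (1 - ‖a‖ ^ 2) * (1 - ‖w‖ ^ 2) := by
  simp only [← Complex.normSq_eq_norm_sq, Complex.normSq_apply, Complex.sub_re, Complex.sub_im,
    Complex.mul_re, Complex.mul_im, Complex.conj_re, Complex.conj_im, Complex.one_re,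
    Complex.one_im]
  ring

lemma one_sub_conj_mul_ne_zero {a w : ℂ} (ha : ‖a‖ < 1) (hw : ‖w‖ < 1) :
    1 - starRingEnd ℂ a * w ≠ 0 := by
  intro h
  have := norm_one_sub_sq a w
  rw [h] at this
  have h1 : 0 < 1 - ‖a‖ ^ 2 := by nlinarith [norm_nonneg a]
  have h2 : 0 < 1 - ‖w‖ ^ 2 := by nlinarith [norm_nonneg w]
  have := mul_pos h1 h2
  simp at *
  nlinarith [sq_nonneg ‖a - w‖]

lemma norm_diskInv_lt {a w : ℂ} (ha : ‖a‖ < 1) (hw : ‖w‖ < 1) : ‖diskInv a w‖ < 1 := by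
  have hne := one_sub_conj_mul_ne_zero ha hw
  rw [diskInv, norm_div, div_lt_one (norm_pos_iff.2 hne)]
  refine lt_of_pow_lt_pow_left₀ 2 (norm_nonneg _) ?_
  rw [norm_one_sub_sq]
  have h1 : 0 < 1 - ‖a‖ ^ 2 := by nlinarith [norm_nonneg a]
  have h2 : 0 < 1 - ‖w‖ ^ 2 := by nlinarith [norm_nonneg w]
  have := mul_pos h1 h2
  linarith

lemma diskInv_diskInv {a w : ℂ} (ha : ‖a‖ < 1) (hw : ‖w‖ < 1) : diskInv a (diskInv a w) = w := by
  have hne := one_sub_conj_mul_ne_zero ha hw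
  have hne2 := one_sub_conj_mul_ne_zero ha ha
  have e1 : a - (a - w) / (1 - starRingEnd ℂ a * w) =
      w * (1 - starRingEnd ℂ a * a) / (1 - starRingEnd ℂ a * w) := by
    rw [eq_div_iff hne, sub_mul, div_mul_cancel₀ _ hne]; ring
  have e2 : 1 - starRingEnd ℂ a * ((a - w) / (1 - starRingEnd ℂ a * w)) =
      (1 - starRingEnd ℂ a * a) / (1 - starRingEnd ℂ a * w) := by
    rw [eq_div_iff hne, sub_mul, mul_assoc, div_mul_cancel₀ _ hne]; ring
  rw [diskInv, diskInv, e1, e2, div_div_div_cancel_right₀ hne, mul_div_cancel_right₀ _ hne2]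

lemma differentiableOn_diskInv {a : ℂ} (ha : ‖a‖ < 1) :
    DifferentiableOn ℂ (diskInv a) (Metric.ball 0 1) := by
  intro w hw
  have hw : ‖w‖ < 1 := by simpa using hw
  unfold diskInv
  exact ((by fun_prop : DifferentiableAt ℂ (fun w => a - w) w).div
    (by fun_prop) (one_sub_conj_mul_ne_zero ha hw)).differentiableWithinAt

/-- The Schwarz lemma for f between two disk involutions, squared and cleared of denominators by
`norm_one_sub_sq`. The division-free form survives limits in which the image points reach the
circle. -/
lemma schwarz_pick {f : ℂ → ℂ} (hd : DifferentiableOn ℂ f (Metric.ball 0 1))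
    (hm : MapsTo f (Metric.ball 0 1) (Metric.ball 0 1)) {z w : ℂ} (hz : ‖z‖ < 1) (hw : ‖w‖ < 1) :
    (1 - ‖z‖ ^ 2) * (1 - ‖w‖ ^ 2) * ‖1 - starRingEnd ℂ (f z) * f w‖ ^ 2 ≤
      (1 - ‖f z‖ ^ 2) * (1 - ‖f w‖ ^ 2) * ‖1 - starRingEnd ℂ z * w‖ ^ 2 := by
  have hmem : ∀ {x : ℂ}, ‖x‖ < 1 ↔ x ∈ Metric.ball (0 : ℂ) 1 := by simp
  have hfz : ‖f z‖ < 1 := hmem.2 (hm (hmem.1 hz))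
  have hfw : ‖f w‖ < 1 := hmem.2 (hm (hmem.1 hw))
  have hm1 : MapsTo (diskInv z) (Metric.ball 0 1) (Metric.ball 0 1) :=
    fun x hx => hmem.1 (norm_diskInv_lt hz (hmem.2 hx))
  have hm2 : MapsTo (diskInv (f z)) (Metric.ball 0 1) (Metric.ball 0 1) :=
    fun x hx => hmem.1 (norm_diskInv_lt hfz (hmem.2 hx))
  have hg : DifferentiableOn ℂ (diskInv (f z) ∘ f ∘ diskInv z) (Metric.ball 0 1) :=
    (differentiableOn_diskInv hfz).comp (hd.comp (differentiableOn_diskInv hz) hm1) (hm.comp hm1)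
  have h0 : (diskInv (f z) ∘ f ∘ diskInv z) 0 = 0 := by simp [diskInv]
  have key := Complex.norm_le_norm_of_mapsTo_ball hg
    ((hm2.comp (hm.comp hm1)).mono_right Metric.ball_subset_closedBall) h0 (norm_diskInv_lt hz hw)
  simp only [Function.comp_apply, diskInv_diskInv hz hw] at key
  have p1 := norm_pos_iff.2 (one_sub_conj_mul_ne_zero hz hw)
  have p2 := norm_pos_iff.2 (one_sub_conj_mul_ne_zero hfz hfw)
  rw [diskInv, diskInv, norm_div, norm_div, div_le_div_iff₀ p2 p1] at key
  have key2 := pow_le_pow_left₀ (by positivity) key 2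
  rw [mul_pow, mul_pow] at key2
  have i1 := norm_one_sub_sq z w
  have i2 := norm_one_sub_sq (f z) (f w)
  nlinarith

/-- Quantitative strict Schwarz lemma: a self-map of the disk stays away from the circle
linearly in the distance from the circle. -/
lemma norm_le_one_sub_of_mapsTo {h : ℂ → ℂ} (hd : DifferentiableOn ℂ h (Metric.ball 0 1))
    (hm : MapsTo h (Metric.ball 0 1) (Metric.ball 0 1)) {z : ℂ} (hz : ‖z‖ < 1) :
    ‖h z‖ ≤ 1 - (1 - ‖h 0‖) / (2 * (1 + ‖h 0‖)) * (1 - ‖z‖) := by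
  have hmem : ∀ {x : ℂ}, ‖x‖ < 1 ↔ x ∈ Metric.ball (0 : ℂ) 1 := by simp
  have h0 : ‖h 0‖ < 1 := hmem.2 (hm (hmem.1 (by simp)))
  have hz1 : ‖h z‖ < 1 := hmem.2 (hm (hmem.1 hz))
  have key := schwarz_pick hd hm (z := 0) (w := z) (by simp) hz
  simp only [norm_zero, map_zero, zero_mul, sub_zero, norm_one, one_pow, mul_one] at key
  have hlow : 1 - ‖h 0‖ ≤ ‖1 - starRingEnd ℂ (h 0) * h z‖ := by
    have h1 : ‖(1 : ℂ)‖ - ‖starRingEnd ℂ (h 0) * h z‖ ≤ ‖1 - starRingEnd ℂ (h 0) * h z‖ :=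
      norm_sub_norm_le _ _
    rw [norm_mul, RCLike.norm_conj, norm_one] at h1
    nlinarith [norm_nonneg (h 0), norm_nonneg (h z)]
  set c := ‖h 0‖ with hc
  have hc0 : 0 ≤ c := norm_nonneg _
  have hsq : (1 - c) ^ 2 ≤ ‖1 - starRingEnd ℂ (h 0) * h z‖ ^ 2 :=
    pow_le_pow_left₀ (by linarith) hlow 2
  have hz0 := norm_nonneg z
  -- Schwarz–Pick at the points 0 and z, with the denominator bounded below by 1 - c.
  have h3 : (1 - ‖z‖ ^ 2) * (1 - c) ^ 2 ≤ (1 - c ^ 2) * (1 - ‖h z‖ ^ 2) := by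
    nlinarith [mul_le_mul_of_nonneg_left hsq (by nlinarith : (0 : ℝ) ≤ 1 - ‖z‖ ^ 2)]
  have h4 : (1 - ‖z‖ ^ 2) * (1 - c) ≤ (1 + c) * (1 - ‖h z‖ ^ 2) := by
    have : 0 < 1 - c := by linarith
    refine le_of_mul_le_mul_left ?_ this
    nlinarith
  -- Here 1 + ‖z‖ ≥ 1 and 1 + ‖h z‖ ≤ 2; the second bound is the 2 in the constant.
  have h5 : (1 - ‖z‖) * (1 - c) ≤ (1 + c) * (2 * (1 - ‖h z‖)) := by
    have e1 : (1 - ‖z‖) * (1 - c) ≤ (1 - ‖z‖ ^ 2) * (1 - c) := by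
      refine mul_le_mul_of_nonneg_right ?_ (by linarith)
      nlinarith
    have e2 : (1 + c) * (1 - ‖h z‖ ^ 2) ≤ (1 + c) * (2 * (1 - ‖h z‖)) := by
      refine mul_le_mul_of_nonneg_left ?_ (by linarith)
      nlinarith [sq_nonneg (1 - ‖h z‖)]
    linarith
  have h6 : (1 - c) / (2 * (1 + c)) * (1 - ‖z‖) ≤ 1 - ‖h z‖ := by
    rw [div_mul_eq_mul_div, div_le_iff₀ (by linarith)]
    linarith
  linarith

/-! ### The antiholomorphic symmetry -/

section Reflection

variable {d : ℕ}

/-- The reversed and conjugated form. -/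
def starForm (a : Fin (d + 1) → ℂ) : Fin (d + 1) → ℂ := fun j => starRingEnd ℂ (a (Fin.rev j))

lemma hom_starForm (a : Fin (d + 1) → ℂ) (u v : ℂ) :
    hom (starForm a) u v = starRingEnd ℂ (hom a (starRingEnd ℂ v) (starRingEnd ℂ u)) := by
  rw [hom, hom, map_sum, ← Equiv.sum_comp Fin.revPerm]
  refine Finset.sum_congr rfl fun j _ => ?_
  have hj := j.2
  have e1 : ((Fin.revPerm j : Fin (d + 1)) : ℕ) = d - j := by simp [Fin.val_rev]
  have e2 : d - (d - (j : ℕ)) = j := by omega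
  rw [e1, e2]
  simp [starForm, mul_right_comm]

/-- Conjugation of a map by the reflection `sig`, on coefficients. -/
def refl : Coeff d →ₗ[ℝ] Coeff d where
  toFun F := (starForm F.2, starForm F.1)
  map_add' F G := by
    ext j <;> simp [starForm]
  map_smul' c F := by
    ext j <;> simp [starForm]

lemma refl_fst (F : Coeff d) : (refl F).1 = starForm F.2 := rfl

lemma refl_snd (F : Coeff d) : (refl F).2 = starForm F.1 := rfl

lemma refl_refl (F : Coeff d) : refl (refl F) = F := by
  ext j <;> simp [refl, starForm]

lemma refl_smul (c : ℂ) (F : Coeff d) : refl (c • F) = starRingEnd ℂ c • refl F := by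
  ext j <;> simp [refl, starForm]

lemma NonDeg.toMap_refl {F : Coeff d} (hF : NonDeg F) (p : OnePoint ℂ) :
    toMap (refl F) (sig p) = sig (toMap F p) := by
  obtain ⟨u, v, h, rfl⟩ := exists_pt p
  rw [sig_pt h, toMap_pt _ h, sig_pt (hF.ne h), toMap_pt _ (by simpa [or_comm] using h), refl_fst,
    refl_snd, hom_starForm, hom_starForm]
  simp

lemma NonDeg.toMap_sig {F : Coeff d} (hF : NonDeg F) {c : ℂ} (hc : c ≠ 0) (h : refl F = c • F)
    (p : OnePoint ℂ) : toMap F (sig p) = sig (toMap F p) := by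
  rw [← hF.toMap_refl, h, toMap_smul hc]

lemma pt_mem_unitDisk_iff {u v : ℂ} : pt u v ∈ unitDisk ↔ ‖u‖ < ‖v‖ := by
  by_cases hv : v = 0
  · simp [hv, unitDisk, not_lt.2 (norm_nonneg u)]
  · rw [show pt u v = ((u / v : ℂ) : OnePoint ℂ) by simp [pt, hv]]
    simp [unitDisk, div_lt_one (norm_pos_iff.2 hv)]

lemma coe_mem_unitCircle_iff {z : ℂ} : (z : OnePoint ℂ) ∈ unitCircle ↔ ‖z‖ = 1 := by
  simp [unitCircle]

lemma pt_mem_unitCircle_iff {u v : ℂ} (h : u ≠ 0 ∨ v ≠ 0) :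
    pt u v ∈ unitCircle ↔ ‖u‖ = ‖v‖ := by
  by_cases hv : v = 0
  · have hu : u ≠ 0 := by tauto
    simp [hv, unitCircle, hu]
  · rw [show pt u v = ((u / v : ℂ) : OnePoint ℂ) by simp [pt, hv], coe_mem_unitCircle_iff,
      norm_div, div_eq_one_iff_eq (norm_ne_zero_iff.2 hv)]

lemma isBlaschke_toMap_iff (F : Coeff d) : IsBlaschke (toMap F) ↔
    ∀ u v, u ≠ 0 ∨ v ≠ 0 → (‖hom F.1 u v‖ < ‖hom F.2 u v‖ ↔ ‖u‖ < ‖v‖) := by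
  rw [IsBlaschke, Set.ext_iff]
  constructor
  · intro h u v huv
    have := h (pt u v)
    rwa [mem_preimage, toMap_pt _ huv, pt_mem_unitDisk_iff,
      pt_mem_unitDisk_iff] at this
  · intro h p
    obtain ⟨u, v, huv, rfl⟩ := exists_pt p
    rw [mem_preimage, toMap_pt _ huv, pt_mem_unitDisk_iff, pt_mem_unitDisk_iff]
    exact h u v huv

lemma infinite_norm_eq_one : {z : ℂ | ‖z‖ = 1}.Infinite := by
  have h : IsPreconnected (Metric.sphere (0 : ℂ) 1) :=
    isPreconnected_sphere (by rw [Complex.rank_real_complex]; norm_num) 0 1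
  have hs : {z : ℂ | ‖z‖ = 1} = Metric.sphere (0 : ℂ) 1 := by ext; simp
  rw [hs]
  refine h.infinite_of_nontrivial ⟨1, by simp, -1, by simp, ?_⟩
  intro h
  have := congrArg Complex.re h
  norm_num at this

lemma toPoly_starForm_eval (a : Fin (d + 1) → ℂ) {z : ℂ} (hz : ‖z‖ = 1) :
    (toPoly (starForm a)).eval z = z ^ d * starRingEnd ℂ ((toPoly a).eval z) := by
  have hzz : starRingEnd ℂ z * z = 1 := by
    rw [Complex.conj_mul', hz]; simp
  rw [← hom_one, hom_starForm, map_one]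
  have : hom a 1 (starRingEnd ℂ z) = starRingEnd ℂ z ^ d * hom a z 1 := by
    rw [← hom_mul_mul, hzz, mul_one]
  rw [this, hom_one]
  simp

lemma toPoly_injective : Function.Injective (toPoly : (Fin (d + 1) → ℂ) → ℂ[X]) := by
  intro a b h
  ext k
  rw [← toPoly_coeff_fin a, h, toPoly_coeff_fin]

lemma toPoly_smul (c : ℂ) (a : Fin (d + 1) → ℂ) : toPoly (c • a) = C c * toPoly a := by
  simp [toPoly, Finset.mul_sum, mul_assoc]

lemma toPoly_zero : toPoly (0 : Fin (d + 1) → ℂ) = 0 := by simp [toPoly]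

lemma starForm_starForm (a : Fin (d + 1) → ℂ) : starForm (starForm a) = a := by
  ext j; simp [starForm]

lemma starForm_zero : starForm (0 : Fin (d + 1) → ℂ) = 0 := by
  ext j; simp [starForm]

/-- Radial limits from inside the disk give ≤; strict inequality would put the circle point z into
the preimage of the disk. -/
lemma norm_hom_eq_of_isBlaschke {F : Coeff d} (hB : IsBlaschke (toMap F)) {z : ℂ}
    (hz : ‖z‖ = 1) : ‖hom F.1 z 1‖ = ‖hom F.2 z 1‖ := by
  rw [isBlaschke_toMap_iff] at hB
  refine le_antisymm ?_ ?_
  · have hc : ∀ a : Fin (d + 1) → ℂ,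
        Tendsto (fun r : ℝ => ‖hom a (r * z) 1‖) (𝓝[<] 1) (𝓝 ‖hom a z 1‖) := by
      intro a
      have : Continuous fun r : ℝ => ‖hom a (r * z) 1‖ :=
        ((continuous_hom a).comp (f := fun r : ℝ => ((r : ℂ) * z, (1 : ℂ))) (by fun_prop)).norm
      simpa using (this.tendsto 1).mono_left nhdsWithin_le_nhds
    refine le_of_tendsto_of_tendsto (hc F.1) (hc F.2) ?_
    filter_upwards [Ioo_mem_nhdsLT (zero_lt_one (α := ℝ))] with r hr
    refine ((hB _ _ (by simp)).2 ?_).le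
    rw [norm_mul, hz, Complex.norm_real, Real.norm_of_nonneg hr.1.le]
    simpa using hr.2
  · by_contra! h
    have := (hB z 1 (by simp)).1 h
    simp [hz] at this

/-- Coefficients of a Blaschke product are invariant under the reflection, up to a factor. -/
lemma exists_refl_eq_smul {F : Coeff d} (hF : NonDeg F) (hB : IsBlaschke (toMap F)) :
    ∃ c : ℂ, c ≠ 0 ∧ refl F = c • F := by
  have hF0 : F ≠ 0 := by
    rintro rfl
    have := hF 1 1 (by simp [hom]) (by simp [hom])
    simp at this
  suffices h : ∃ c : ℂ, refl F = c • F by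
    obtain ⟨c, hc⟩ := h
    refine ⟨c, ?_, hc⟩
    rintro rfl
    rw [zero_smul] at hc
    exact hF0 (by rw [← refl_refl F, hc, map_zero])
  set a := toPoly F.1 with ha
  set b := toPoly F.2 with hb
  have hcop : IsCoprime a b := hF.isCoprime
  -- On the circle |a| = |b| says a · a* = b · b* after multiplication by zᵈ; infinitely many points
  -- make it an identity of polynomials.
  have hid : a * toPoly (starForm F.1) = b * toPoly (starForm F.2) := by
    refine Polynomial.eq_of_infinite_eval_eq _ _ (infinite_norm_eq_one.mono fun z hz => ?_)
    have hz : ‖z‖ = 1 := hz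
    have h := norm_hom_eq_of_isBlaschke hB hz
    rw [hom_one, hom_one] at h
    change (a * _).eval z = (b * _).eval z
    rw [eval_mul, eval_mul, toPoly_starForm_eval _ hz, toPoly_starForm_eval _ hz, mul_left_comm,
      mul_left_comm (b.eval z), Complex.mul_conj', Complex.mul_conj', h]
  have ha0 : a ≠ 0 := by
    intro h0
    rw [h0, zero_mul] at hid
    have h1 : F.1 = 0 := toPoly_injective (h0.trans toPoly_zero.symm)
    rcases mul_eq_zero.1 hid.symm with h | h
    · exact hF0 (Prod.ext h1 (toPoly_injective (h.trans toPoly_zero.symm)))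
    · have h2 : starForm F.2 = 0 := toPoly_injective (h.trans toPoly_zero.symm)
      refine hF0 (Prod.ext h1 ?_)
      rw [← starForm_starForm F.2, h2, starForm_zero]; rfl
  obtain ⟨q, hq⟩ : a ∣ toPoly (starForm F.2) := by
    refine hcop.dvd_of_dvd_mul_left ?_
    rw [← hid]; exact dvd_mul_right _ _
  have hq' : toPoly (starForm F.1) = b * q := by
    refine mul_left_cancel₀ ha0 ?_
    rw [hid, hq]; ring
  -- One of a, b has degree d, and its product with q is a reversed form, again of degree at most d.
  have hqdeg : q.natDegree = 0 := by
    by_contra hne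
    have hq0 : q ≠ 0 := by rintro rfl; simp at hne
    have key : ∀ p : ℂ[X], p.natDegree = d → ∀ x : Fin (d + 1) → ℂ, toPoly x = p * q → False := by
      intro p hp x hx
      have := natDegree_toPoly_le x
      have hp0 : p ≠ 0 ∨ d = 0 := by
        by_cases h : p = 0
        · right; rw [← hp, h]; simp
        · exact Or.inl h
      rcases hp0 with hp0 | hd0
      · rw [hx, natDegree_mul hp0 hq0] at this
        omega
      · by_cases hp0 : p = 0
        · have hx0 : x = 0 := toPoly_injective (by rw [hx, hp0, zero_mul, toPoly_zero])
          subst hd0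
          subst hp0
          have hb0 : b.natDegree = 0 := Nat.le_zero.1 (natDegree_toPoly_le F.2)
          have h1 := natDegree_toPoly_le (starForm F.2)
          rw [hq, natDegree_mul ha0 hq0] at h1
          omega
        · rw [hx, natDegree_mul hp0 hq0] at this
          omega
    have hd := hF.degree_eq
    rcases max_choice a.natDegree b.natDegree with h | h
    · exact key a (h ▸ hd) _ hq
    · exact key b (h ▸ hd) _ hq'
  obtain ⟨c, rfl⟩ : ∃ c, q = C c := ⟨_, eq_C_of_natDegree_eq_zero hqdeg⟩
  refine ⟨c, Prod.ext (toPoly_injective ?_) (toPoly_injective ?_)⟩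
  · rw [refl_fst, hq, Prod.smul_fst, toPoly_smul, mul_comm]
  · rw [refl_snd, hq', Prod.smul_snd, toPoly_smul, mul_comm]

end Reflection


/-! ### Blaschke products fixing the origin -/

/-- A symmetric map that fixes the origin and has no poles in the closed unit disk. -/
structure DiskMap {d : ℕ} (F : Coeff d) : Prop where
  symm : refl F = F
  zero : F.1 0 = 0
  denom : ∀ z, ‖z‖ ≤ 1 → hom F.2 z 1 ≠ 0

/-- A symmetric map that fixes the origin, has no poles in the closed unit disk, and has a
multiplier of modulus less than one at the origin. -/
structure Good {d : ℕ} (F : Coeff d) : Prop extends DiskMap F where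
  mult : ‖(toPoly F.1).coeff 1‖ < ‖F.2 0‖

/-- The spherical derivative in the affine coordinate. -/
lemma hasSphericalDeriv_coe {T : OnePoint ℂ → OnePoint ℂ} {f : ℂ → ℂ} {z f' : ℂ}
    (hT : ∀ᶠ w : ℂ in 𝓝 z, T (w : OnePoint ℂ) = ((f w : ℂ) : OnePoint ℂ)) (hf : HasDerivAt f f' z) :
    HasSphericalDeriv T (z : OnePoint ℂ) (‖f'‖ * ((1 + ‖z‖ ^ 2) / (1 + ‖f z‖ ^ 2))) := by
  have hTz := hT.self_of_nhds
  have hpre : ((↑) : ℂ → OnePoint ℂ) ⁻¹' {(z : OnePoint ℂ)}ᶜ = {z}ᶜ := by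
    ext w; simp
  rw [HasSphericalDeriv, OnePoint.nhdsWithin_coe, hpre, tendsto_map'_iff, hTz]
  have h1 : Tendsto (fun w => ‖slope f z w‖) (𝓝[≠] z) (𝓝 ‖f'‖) :=
    (hasDerivAt_iff_tendsto_slope.1 hf).norm
  have hs : Continuous fun w : ℂ => √(1 + ‖w‖ ^ 2) := by fun_prop
  have hpos : ∀ w : ℂ, 0 < √(1 + ‖w‖ ^ 2) := fun w => Real.sqrt_pos.2 (by positivity)
  have h2 : Tendsto (fun w => (√(1 + ‖w‖ ^ 2) * √(1 + ‖z‖ ^ 2)) /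
      (√(1 + ‖f w‖ ^ 2) * √(1 + ‖f z‖ ^ 2))) (𝓝[≠] z) (𝓝 ((1 + ‖z‖ ^ 2) / (1 + ‖f z‖ ^ 2))) := by
    have : ContinuousAt (fun w => (√(1 + ‖w‖ ^ 2) * √(1 + ‖z‖ ^ 2)) /
      (√(1 + ‖f w‖ ^ 2) * √(1 + ‖f z‖ ^ 2))) z := by
      refine ContinuousAt.div ?_ ?_ (mul_pos (hpos _) (hpos _)).ne'
      · exact hs.continuousAt.mul continuousAt_const
      · exact (ContinuousAt.comp (g := fun w : ℂ => √(1 + ‖w‖ ^ 2)) hs.continuousAt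
          hf.continuousAt).mul continuousAt_const
    have h3 := this.tendsto.mono_left (nhdsWithin_le_nhds (s := {z}ᶜ))
    rwa [Real.mul_self_sqrt (by positivity), Real.mul_self_sqrt (by positivity)] at h3
  refine (h1.mul h2).congr' ?_
  filter_upwards [nhdsWithin_le_nhds hT, self_mem_nhdsWithin] with w hw hwz
  have hwz : 0 < ‖w - z‖ := norm_pos_iff.2 (sub_ne_zero.2 hwz)
  have p1 := hpos w
  have p2 := hpos z
  have p3 := hpos (f w)
  have p4 := hpos (f z)
  simp only [Function.comp_apply, hw, chordal, OnePoint.elim_some, slope_def_field, norm_div]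
  field_simp

lemma chordal_sig (p q : OnePoint ℂ) : chordal (sig p) (sig q) = chordal p q := by
  obtain ⟨u, v, h, rfl⟩ := exists_pt p
  obtain ⟨u', v', h', rfl⟩ := exists_pt q
  rw [sig_pt h, sig_pt h', chordal_pt (by simpa [or_comm] using h) (by simpa [or_comm] using h'),
    chordal_pt h h']
  have e : ‖starRingEnd ℂ v * starRingEnd ℂ u' - starRingEnd ℂ v' * starRingEnd ℂ u‖ =
      ‖u * v' - u' * v‖ := by
    rw [← RCLike.norm_conj (u * v' - u' * v), map_sub, map_mul, map_mul, norm_sub_rev]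
    congr 1; ring
  rw [e]
  simp only [RCLike.norm_conj]
  rw [add_comm (‖v‖ ^ 2), add_comm (‖v'‖ ^ 2)]

lemma HasSphericalDeriv.sig {T : OnePoint ℂ → OnePoint ℂ} (hT : ∀ p, T (sig p) = sig (T p))
    {p : OnePoint ℂ} {s : ℝ} (h : HasSphericalDeriv T p s) : HasSphericalDeriv T (sig p) s := by
  have hs : Tendsto QuasiBlaschke.sig (𝓝[≠] (QuasiBlaschke.sig p)) (𝓝[≠] p) := by
    refine tendsto_nhdsWithin_iff.2 ⟨?_, ?_⟩
    · have := (continuous_sig.tendsto (QuasiBlaschke.sig p)).mono_left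
        (nhdsWithin_le_nhds (s := {QuasiBlaschke.sig p}ᶜ))
      rwa [sig_sig] at this
    · filter_upwards [self_mem_nhdsWithin] with q hq hqp
      have hqp : QuasiBlaschke.sig q = p := hqp
      exact hq (by rw [← hqp, sig_sig]; rfl)
  refine (Tendsto.comp h hs).congr fun q => ?_
  rw [Function.comp_apply, hT, hT, ← chordal_sig (QuasiBlaschke.sig (T q)), sig_sig,
    ← chordal_sig (QuasiBlaschke.sig q), sig_sig]

/-! ### Symmetric maps without poles in the closed unit disk -/

namespace DiskMap

variable {d : ℕ} {F : Coeff d} (hG : DiskMap F)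
include hG

lemma hom_fst (u v : ℂ) : hom F.1 u v =
    starRingEnd ℂ (hom F.2 (starRingEnd ℂ v) (starRingEnd ℂ u)) := by
  rw [← hom_starForm, ← refl_fst, hG.symm]

lemma hom_snd (u v : ℂ) : hom F.2 u v =
    starRingEnd ℂ (hom F.1 (starRingEnd ℂ v) (starRingEnd ℂ u)) := by
  rw [← hom_starForm, ← refl_snd, hG.symm]

lemma hom_snd_ne_zero {u v : ℂ} (hv : v ≠ 0) (huv : ‖u‖ ≤ ‖v‖) : hom F.2 u v ≠ 0 := by
  rw [hom_eq_pow_mul _ hv, ← hom_one]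
  refine mul_ne_zero (pow_ne_zero _ hv) (hG.denom _ ?_)
  rw [norm_div]
  exact div_le_one_of_le₀ huv (norm_nonneg _)

/-- The denominator has no zero with |u| ≤ |v|; by symmetry the numerator has none with |u| ≥ |v|.
-/
lemma nonDeg : NonDeg F := by
  intro u v h1 h2
  by_contra hc
  rcases le_total ‖u‖ ‖v‖ with h | h
  · by_cases hv : v = 0
    · rw [hv, norm_zero, norm_le_zero_iff] at h
      exact hc ⟨h, hv⟩
    · exact hG.hom_snd_ne_zero hv h h2
  · by_cases hu : u = 0
    · rw [hu, norm_zero, norm_le_zero_iff] at h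
      exact hc ⟨hu, h⟩
    · rw [hG.hom_fst, map_eq_zero] at h1
      exact hG.hom_snd_ne_zero (by simpa using hu) (by simpa using h) h1

/-- The map divided by the coordinate, on the closed unit disk. -/
def quot (_ : DiskMap F) (z : ℂ) : ℂ := (toPoly F.1).divX.eval z / (toPoly F.2).eval z

omit hG in
lemma eval_fst (hG : DiskMap F) (z : ℂ) :
    (toPoly F.1).eval z = z * (toPoly F.1).divX.eval z := by
  have h := divX_mul_X_add (toPoly F.1)
  have h0 : (toPoly F.1).coeff 0 = 0 := (toPoly_coeff_fin F.1 0).trans hG.zero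
  rw [h0, C_0, add_zero] at h
  conv_lhs => rw [← h]
  rw [eval_mul, eval_X, mul_comm]

lemma denom_eval {z : ℂ} (hz : ‖z‖ ≤ 1) : (toPoly F.2).eval z ≠ 0 := by
  rw [← hom_one]; exact hG.denom z hz

lemma toMap_coe {z : ℂ} (hz : ‖z‖ ≤ 1) :
    toMap F (z : OnePoint ℂ) = ((z * hG.quot z : ℂ) : OnePoint ℂ) := by
  simp only [toMap, OnePoint.elim_some, if_neg (hG.denom_eval hz), hG.eval_fst z, quot, mul_div_assoc]

lemma differentiableAt_quot {z : ℂ} (hz : ‖z‖ ≤ 1) : DifferentiableAt ℂ hG.quot z :=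
  (Polynomial.differentiableAt _).div (Polynomial.differentiableAt _) (hG.denom_eval hz)

lemma norm_hom_eq {z : ℂ} (hz : ‖z‖ = 1) : ‖hom F.1 z 1‖ = ‖hom F.2 z 1‖ := by
  have h : hom F.2 1 (starRingEnd ℂ z) = starRingEnd ℂ z ^ d * hom F.2 z 1 := by
    rw [← hom_mul_mul, mul_one, Complex.conj_mul', hz]; simp
  rw [hG.hom_fst, RCLike.norm_conj, map_one, h, norm_mul, norm_pow, RCLike.norm_conj, hz, one_pow,
    one_mul]

lemma norm_quot_of_norm_eq_one {z : ℂ} (hz : ‖z‖ = 1) : ‖hG.quot z‖ = 1 := by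
  have h := hG.norm_hom_eq hz
  rw [hom_one, hom_one, hG.eval_fst, norm_mul, hz, one_mul] at h
  rw [quot, norm_div, h, div_self (norm_ne_zero_iff.2 (hG.denom_eval hz.le))]

lemma norm_quot_le_one {z : ℂ} (hz : ‖z‖ ≤ 1) : ‖hG.quot z‖ ≤ 1 := by
  have hcl : closure (Metric.ball (0 : ℂ) 1) = Metric.closedBall 0 1 :=
    closure_ball 0 one_ne_zero
  refine Complex.norm_le_of_forall_mem_frontier_norm_le (U := Metric.ball 0 1)
    Metric.isBounded_ball ⟨fun z hz => ?_, fun z hz => ?_⟩ (fun z hz => ?_)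
    (by rw [hcl]; simpa using hz)
  · have hz : ‖z‖ < 1 := by simpa using hz
    exact (hG.differentiableAt_quot hz.le).differentiableWithinAt
  · rw [hcl] at hz
    have hz : ‖z‖ ≤ 1 := by simpa using hz
    exact (hG.differentiableAt_quot hz).continuousAt.continuousWithinAt
  · rw [frontier_ball 0 one_ne_zero] at hz
    exact (hG.norm_quot_of_norm_eq_one (by simpa using hz)).le

lemma differentiableOn_quot : DifferentiableOn ℂ hG.quot (Metric.ball 0 1) := fun z hz =>
  (hG.differentiableAt_quot (by simpa using (Metric.mem_ball.1 hz).le)).differentiableWithinAt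

end DiskMap

/-! ### Dynamics of a good map: the disk, the circle, the Julia set -/

namespace Good

variable {d : ℕ} {F : Coeff d} (hG : Good F)
include hG

lemma norm_quot_zero_lt : ‖hG.quot 0‖ < 1 := by
  have h0 : (toPoly F.2).eval 0 = F.2 0 := by
    rw [← hom_one, hom_zero_left]; simp
  have h1 : (toPoly F.1).divX.eval 0 = (toPoly F.1).coeff 1 := by
    rw [← coeff_zero_eq_eval_zero, coeff_divX]
  have hne : F.2 0 ≠ 0 := by
    rw [← h0]; exact hG.denom_eval (by simp)
  rw [DiskMap.quot, h0, h1, norm_div, div_lt_one (norm_pos_iff.2 hne)]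
  exact hG.mult

/-- If the quotient reached modulus 1 inside the disk, its modulus would be 1 throughout, but at 0
it equals that of the multiplier. -/
lemma mapsTo_quot : MapsTo hG.quot (Metric.ball 0 1) (Metric.ball 0 1) := by
  intro z hz
  have hz' : ‖z‖ ≤ 1 := by simpa using (Metric.mem_ball.1 hz).le
  rw [mem_ball_zero_iff]
  refine (hG.norm_quot_le_one hz').lt_of_ne fun h => ?_
  have hmax : IsMaxOn (norm ∘ hG.quot) (Metric.ball 0 1) z := by
    intro w hw
    have hw' : ‖w‖ ≤ 1 := by simpa using (Metric.mem_ball.1 hw).le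
    change ‖hG.quot w‖ ≤ ‖hG.quot z‖
    rw [h]; exact hG.norm_quot_le_one hw'
  have := Complex.norm_eqOn_of_isPreconnected_of_isMaxOn
    (convex_ball (0 : ℂ) 1).isPreconnected Metric.isOpen_ball hG.differentiableOn_quot hz hmax
    (Metric.mem_ball_self one_pos)
  have h0 := hG.norm_quot_zero_lt
  simp only [Function.comp_apply, Function.const_apply] at this
  rw [this, h] at h0
  exact lt_irrefl _ h0

/-- A contraction constant of the Schwarz lemma for the map. -/
def gap (hG : Good F) : ℝ := (1 - ‖hG.quot 0‖) / (2 * (1 + ‖hG.quot 0‖))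

lemma gap_pos : 0 < hG.gap := by
  have := hG.norm_quot_zero_lt
  have := norm_nonneg (hG.quot 0)
  exact div_pos (by linarith) (by linarith)

lemma gap_le_one : hG.gap ≤ 1 := by
  have := norm_nonneg (hG.quot 0)
  rw [gap, div_le_one (by linarith)]
  linarith

lemma norm_quot_le {z : ℂ} (hz : ‖z‖ < 1) : ‖hG.quot z‖ ≤ 1 - hG.gap * (1 - ‖z‖) :=
  norm_le_one_sub_of_mapsTo hG.differentiableOn_quot hG.mapsTo_quot hz

lemma norm_quot_lt_one {z : ℂ} (hz : ‖z‖ < 1) : ‖hG.quot z‖ < 1 := by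
  simpa using hG.mapsTo_quot (by simpa using hz : z ∈ Metric.ball (0 : ℂ) 1)

lemma norm_hom_lt {u v : ℂ} (h : ‖u‖ < ‖v‖) : ‖hom F.1 u v‖ < ‖hom F.2 u v‖ := by
  have hv : v ≠ 0 := by
    rintro rfl
    exact absurd h (by simp)
  have hz : ‖u / v‖ < 1 := by
    rw [norm_div, div_lt_one (norm_pos_iff.2 hv)]; exact h
  rw [hom_eq_pow_mul _ hv, hom_eq_pow_mul _ hv, norm_mul, norm_mul]
  refine mul_lt_mul_of_pos_left ?_ (norm_pos_iff.2 (pow_ne_zero _ hv))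
  have hb := norm_pos_iff.2 (hG.denom_eval hz.le)
  have hlt : ‖u / v * hG.quot (u / v)‖ < 1 := by
    rw [norm_mul]
    exact mul_lt_one_of_nonneg_of_lt_one_left (norm_nonneg _) hz (hG.norm_quot_lt_one hz).le
  rw [DiskMap.quot, ← mul_div_assoc, ← hG.eval_fst, norm_div, div_lt_one hb] at hlt
  exact hlt

lemma norm_hom_eq_of_norm_eq {u v : ℂ} (h : ‖u‖ = ‖v‖) : ‖hom F.1 u v‖ = ‖hom F.2 u v‖ := by
  by_cases hv : v = 0
  · have hu : u = 0 := by simpa [hv] using h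
    rw [hG.hom_fst, hu, hv]; simp
  · have hz : ‖u / v‖ = 1 := by
      rw [norm_div, h, div_self (norm_ne_zero_iff.2 hv)]
    have := hG.norm_hom_eq hz
    rw [hom_one, hom_one] at this
    rw [hom_eq_pow_mul _ hv, hom_eq_pow_mul _ hv, norm_mul, norm_mul, this]

/-- Inside and on the circle this is the maximum principle; the exterior follows by reflection,
which swaps numerator and denominator. -/
lemma norm_hom_lt_iff (u v : ℂ) : ‖hom F.1 u v‖ < ‖hom F.2 u v‖ ↔ ‖u‖ < ‖v‖ := by
  refine ⟨fun h => ?_, hG.norm_hom_lt⟩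
  by_contra! hc
  rcases hc.eq_or_lt with hc | hc
  · exact absurd (hG.norm_hom_eq_of_norm_eq hc.symm) h.ne
  · have := hG.norm_hom_lt (u := starRingEnd ℂ v) (v := starRingEnd ℂ u) (by simpa using hc)
    rw [hG.hom_fst (starRingEnd ℂ v), hG.hom_snd (starRingEnd ℂ v)] at this
    simp only [Complex.conj_conj, RCLike.norm_conj] at this
    exact absurd h this.not_gt

lemma isBlaschke : IsBlaschke (toMap F) :=
  (isBlaschke_toMap_iff F).2 fun u v _ => hG.norm_hom_lt_iff u v

lemma toMap_sig (p : OnePoint ℂ) : toMap F (sig p) = sig (toMap F p) :=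
  hG.nonDeg.toMap_sig one_ne_zero (by rw [hG.symm, one_smul]) p

lemma mapsTo_unitCircle {p : OnePoint ℂ} (hp : p ∈ unitCircle) : toMap F p ∈ unitCircle := by
  obtain ⟨u, v, h, rfl⟩ := exists_pt p
  rw [toMap_pt _ h, pt_mem_unitCircle_iff (hG.nonDeg.ne h)]
  exact hG.norm_hom_eq_of_norm_eq ((pt_mem_unitCircle_iff h).1 hp)

lemma iterate_mem_unitCircle {p : OnePoint ℂ} (hp : p ∈ unitCircle) (k : ℕ) :
    (toMap F)^[k] p ∈ unitCircle := by
  induction k with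
  | zero => exact hp
  | succ k ih => rw [Function.iterate_succ_apply']; exact hG.mapsTo_unitCircle ih

/-- On |z| ≤ r, `gap` bounds the quotient by 1 - gap (1 - r), so each step shrinks the modulus at
least by this factor. -/
lemma exists_iterate_coe {r : ℝ} (hr : r < 1) {z : ℂ} (hz : ‖z‖ ≤ r) (k : ℕ) :
    ∃ w : ℂ, (toMap F)^[k] (z : OnePoint ℂ) = (w : OnePoint ℂ) ∧
      ‖w‖ ≤ (1 - hG.gap * (1 - r)) ^ k * r := by
  have hg := hG.gap_pos
  have hg1 := hG.gap_le_one
  have hr0 : 0 ≤ r := (norm_nonneg z).trans hz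
  have hq0 : 0 ≤ 1 - hG.gap * (1 - r) := by nlinarith
  have hq1 : 1 - hG.gap * (1 - r) ≤ 1 := by nlinarith
  induction k with
  | zero => exact ⟨z, rfl, by simpa using hz⟩
  | succ k ih =>
    obtain ⟨w, hw, hwn⟩ := ih
    have hwr : ‖w‖ ≤ r := hwn.trans (mul_le_of_le_one_left hr0 (pow_le_one₀ hq0 hq1))
    have hw1 : ‖w‖ < 1 := hwr.trans_lt hr
    refine ⟨w * hG.quot w, ?_, ?_⟩
    · rw [Function.iterate_succ_apply', hw, hG.toMap_coe hw1.le]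
    · have h1 := hG.norm_quot_le hw1
      have h2 : ‖hG.quot w‖ ≤ 1 - hG.gap * (1 - r) := by nlinarith
      rw [norm_mul, pow_succ, mul_right_comm]
      exact mul_le_mul hwn h2 (norm_nonneg _) (by positivity)

/-- Uniform convergence to the origin on smaller disks. -/
lemma eventually_iterate_mem {r : ℝ} (hr : r < 1) {V : Set (OnePoint ℂ)}
    (hV : V ∈ 𝓝 ((0 : ℂ) : OnePoint ℂ)) :
    ∀ᶠ k in atTop, ∀ z : ℂ, ‖z‖ ≤ r → (toMap F)^[k] (z : OnePoint ℂ) ∈ V := by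
  rw [OnePoint.nhds_coe_eq, mem_map, Metric.mem_nhds_iff] at hV
  obtain ⟨ε, hε, hεV⟩ := hV
  have hg := hG.gap_pos
  have hg1 := hG.gap_le_one
  rcases lt_or_ge r 0 with hr0 | hr0
  · exact Eventually.of_forall fun k z hz => absurd (hz.trans_lt hr0) (not_lt.2 (norm_nonneg z))
  have hq0 : 0 ≤ 1 - hG.gap * (1 - r) := by nlinarith
  have hq1 : 1 - hG.gap * (1 - r) < 1 := by nlinarith
  have hlim : Tendsto (fun k : ℕ => (1 - hG.gap * (1 - r)) ^ k * r) atTop (𝓝 0) := by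
    simpa using (tendsto_pow_atTop_nhds_zero_of_lt_one hq0 hq1).mul_const r
  filter_upwards [hlim.eventually_lt_const hε] with k hk z hz
  obtain ⟨w, hw, hwn⟩ := hG.exists_iterate_coe hr hz k
  rw [hw]
  exact hεV (by simpa using hwn.trans_lt hk)

omit hG in
lemma isOpen_unitDisk : IsOpen unitDisk := OnePoint.isOpen_image_coe.2 Metric.isOpen_ball

lemma unitDisk_subset_fatouSet : unitDisk ⊆ fatouSet (toMap F) := by
  intro p hp
  refine ⟨unitDisk, isOpen_unitDisk, hp, isNormalOn_of_tendsto (p := ((0 : ℂ) : OnePoint ℂ)) ?_⟩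
  rintro _ ⟨z, hz, rfl⟩
  have hz : ‖z‖ < 1 := by simpa using hz
  obtain ⟨r, hzr, hr⟩ := exists_between hz
  refine ⟨(fun w : ℂ => (w : OnePoint ℂ)) '' Metric.ball 0 r, ?_, fun V hV => ?_⟩
  · exact (OnePoint.isOpen_image_coe.2 Metric.isOpen_ball).mem_nhds
      (mem_image_of_mem _ (by simpa using hzr))
  · filter_upwards [hG.eventually_iterate_mem hr hV] with k hk
    rintro _ ⟨w, hw, rfl⟩
    exact hk w (by simpa using (mem_ball_zero_iff.1 hw).le)

omit hG in
lemma mem_unitDisk_or (p : OnePoint ℂ) : p ∈ unitDisk ∨ p ∈ unitCircle ∨ sig p ∈ unitDisk := by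
  obtain ⟨u, v, h, rfl⟩ := exists_pt p
  rw [pt_mem_unitDisk_iff, pt_mem_unitCircle_iff h, sig_pt h, pt_mem_unitDisk_iff,
    RCLike.norm_conj, RCLike.norm_conj]
  exact lt_trichotomy _ _

omit hG in
lemma disjoint_unitDisk_unitCircle {p : OnePoint ℂ} (h : p ∈ unitDisk) : p ∉ unitCircle := by
  obtain ⟨u, v, huv, rfl⟩ := exists_pt p
  rw [pt_mem_unitCircle_iff huv]
  exact (pt_mem_unitDisk_iff.1 h).ne

omit hG in
lemma sig_mem_unitCircle {p : OnePoint ℂ} : sig p ∈ unitCircle ↔ p ∈ unitCircle := by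
  obtain ⟨u, v, h, rfl⟩ := exists_pt p
  rw [sig_pt h, pt_mem_unitCircle_iff h, pt_mem_unitCircle_iff (by simpa [or_comm] using h),
    RCLike.norm_conj, RCLike.norm_conj, eq_comm]

lemma sig_mem_fatouSet_iff {p : OnePoint ℂ} :
    sig p ∈ fatouSet (toMap F) ↔ p ∈ fatouSet (toMap F) :=
  mem_fatouSet_iff sigHomeo hG.toMap_sig

lemma tendsto_iterate_zero {p : OnePoint ℂ} (hp : p ∈ unitDisk) :
    Tendsto (fun k => (toMap F)^[k] p) atTop (𝓝 ((0 : ℂ) : OnePoint ℂ)) := by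
  obtain ⟨z, hz, rfl⟩ := hp
  have hz : ‖z‖ < 1 := by simpa using hz
  intro V hV
  exact (hG.eventually_iterate_mem hz hV).mono fun k hk => hk z le_rfl

omit hG in
lemma chordal_zero_of_mem_unitCircle {p : OnePoint ℂ} (hp : p ∈ unitCircle) :
    1 < chordal p ((0 : ℂ) : OnePoint ℂ) := by
  obtain ⟨z, hz, rfl⟩ := hp
  have hz : ‖z‖ = 1 := by simpa using hz
  simp only [chordal, OnePoint.elim_some, sub_zero, hz, norm_zero]
  rw [one_lt_div (by positivity)]
  norm_num

/-- Near a circle point p, a subsequential limit vanishes on the disk side, while the orbit of p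
stays on the circle at chordal distance more than 1 from 0. A single iterate in the uniform estimate
gives the contradiction; the limit need not be known to be continuous. -/
lemma unitCircle_disjoint_fatouSet {p : OnePoint ℂ} (hp : p ∈ unitCircle) :
    p ∉ fatouSet (toMap F) := by
  rintro ⟨U, hU, hpU, hn⟩
  obtain ⟨b, hb, g, hg⟩ := hn id strictMono_id
  obtain ⟨V, hV, hk⟩ := hg p hpU 1 one_pos
  have hg0 : ∀ q ∈ U, q ∈ unitDisk → g q = ((0 : ℂ) : OnePoint ℂ) := by
    intro q hqU hq
    rw [← chordal_eq_zero_iff]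
    refine le_antisymm (le_of_forall_gt_imp_ge_of_dense fun ε hε => ?_) (chordal_nonneg _ _)
    obtain ⟨W, hW, hkW⟩ := hg q hqU ε hε
    have h1 : Tendsto (fun k => chordal ((toMap F)^[id (b k)] q) (g q)) atTop
        (𝓝 (chordal ((0 : ℂ) : OnePoint ℂ) (g q))) := by
      have hc : Continuous fun x => chordal x (g q) :=
        continuous_chordal.comp (f := fun x => (x, g q)) (by fun_prop)
      exact (hc.tendsto _).comp ((hG.tendsto_iterate_zero hq).comp hb.tendsto_atTop)
    have h2 : chordal (g q) ((0 : ℂ) : OnePoint ℂ) = chordal ((0 : ℂ) : OnePoint ℂ) (g q) := by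
      obtain ⟨u, v, h, he⟩ := exists_pt (g q)
      rw [← he, ← pt_one, chordal_pt h (by simp), chordal_pt (by simp) h, norm_sub_rev,
        mul_comm √_]
    rw [h2]
    exact le_of_tendsto h1 (hkW.mono fun k hk => (hk q (mem_of_mem_nhds hW)).le)
  obtain ⟨k, hk⟩ := hk.exists
  have hcont : Continuous fun q => chordal ((toMap F)^[id (b k)] q) ((0 : ℂ) : OnePoint ℂ) :=
    continuous_chordal.comp (f := fun q => ((toMap F)^[id (b k)] q, ((0 : ℂ) : OnePoint ℂ)))
      (((continuous_toMap hG.nonDeg).iterate _).prodMk continuous_const)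
  have hgt := chordal_zero_of_mem_unitCircle (hG.iterate_mem_unitCircle hp (id (b k)))
  have hev : ∀ᶠ q in 𝓝 p, 1 < chordal ((toMap F)^[id (b k)] q) ((0 : ℂ) : OnePoint ℂ) :=
    hcont.continuousAt.eventually_const_lt hgt
  obtain ⟨z, hz, rfl⟩ := hp
  have hz : ‖z‖ = 1 := by simpa using hz
  have hall : ∀ᶠ q in 𝓝 (z : OnePoint ℂ), q ∉ unitDisk := by
    filter_upwards [hev, hV, hU.mem_nhds hpU] with q h1 h2 h3 h4
    have := hk q h2
    rw [hg0 q h3 h4] at this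
    exact absurd this h1.not_gt
  rw [OnePoint.nhds_coe_eq, eventually_map] at hall
  have hcl : z ∈ closure (Metric.ball (0 : ℂ) 1) := by
    rw [closure_ball 0 one_ne_zero]; simp [hz]
  rw [mem_closure_iff_frequently] at hcl
  obtain ⟨w, hw1, hw2⟩ := (hcl.and_eventually hall).exists
  exact hw2 (mem_image_of_mem _ hw1)

lemma mem_fatouSet_iff_notMem {p : OnePoint ℂ} : p ∈ fatouSet (toMap F) ↔ p ∉ unitCircle := by
  refine ⟨fun h h' => hG.unitCircle_disjoint_fatouSet h' h, fun h => ?_⟩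
  rcases mem_unitDisk_or p with h' | h' | h'
  · exact hG.unitDisk_subset_fatouSet h'
  · exact absurd h' h
  · exact hG.sig_mem_fatouSet_iff.1 (hG.unitDisk_subset_fatouSet h')

lemma juliaSet_eq : juliaSet (toMap F) = unitCircle := by
  ext p
  rw [juliaSet, mem_compl_iff, hG.mem_fatouSet_iff_notMem, not_not]

lemma fatouSet_eq : fatouSet (toMap F) = unitCircleᶜ := by
  ext p
  exact hG.mem_fatouSet_iff_notMem

end Good


/-! ### Blaschke products are quasi-Blaschke products -/

/-- Solve t · num = s · den. A nonconstant polynomial has a root; a constant one has vanishing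
coefficient of degree d > 0, so that ∞ is a preimage. -/
lemma NonDeg.surjective_toMap {d : ℕ} (hd : d ≠ 0) {F : Coeff d} (hF : NonDeg F) :
    Function.Surjective (toMap F) := by
  intro q
  obtain ⟨s, t, hst, rfl⟩ := exists_pt q
  suffices h : ∃ u v, (u ≠ 0 ∨ v ≠ 0) ∧ hom F.1 u v * t = s * hom F.2 u v by
    obtain ⟨u, v, huv, he⟩ := h
    refine ⟨pt u v, ?_⟩
    rw [toMap_pt _ huv, pt_eq_pt_iff (hF.ne huv) hst, he]
  set P : ℂ[X] := toPoly (t • F.1 - s • F.2) with hP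
  have hPe : ∀ u v, hom (t • F.1 - s • F.2) u v = t * hom F.1 u v - s * hom F.2 u v := by
    intro u v
    rw [sub_eq_add_neg, ← neg_smul, hom_add, hom_smul, hom_smul]; ring
  by_cases h : P.natDegree = 0
  · refine ⟨1, 0, by simp, ?_⟩
    have h0 : (t • F.1 - s • F.2) (Fin.last d) = 0 := by
      rw [← toPoly_coeff_fin (t • F.1 - s • F.2)]
      refine coeff_eq_zero_of_natDegree_lt ?_
      rw [← hP, h]; simpa using Nat.pos_of_ne_zero hd
    have := hPe 1 0
    rw [hom_zero_right, h0] at this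
    linear_combination -this
  · obtain ⟨z, hz⟩ := IsAlgClosed.exists_root P fun hdeg => h (natDegree_eq_of_degree_eq_some hdeg)
    refine ⟨z, 1, by simp, ?_⟩
    have := hPe z 1
    rw [hom_one, ← hP, hz.eq_zero] at this
    linear_combination -this

namespace Good

variable {d : ℕ} {F : Coeff d} (hG : Good F)
include hG

lemma hasDerivAt_mul_quot {z : ℂ} (hz : ‖z‖ ≤ 1) :
    HasDerivAt (fun w => w * hG.quot w) (hG.quot z + z * deriv hG.quot z) z := by
  have h := (hasDerivAt_id z).mul (hG.differentiableAt_quot hz).hasDerivAt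
  rw [one_mul] at h
  exact h

lemma eventually_toMap_coe {z : ℂ} (hz : ‖z‖ ≤ 1) :
    ∀ᶠ w : ℂ in 𝓝 z, toMap F (w : OnePoint ℂ) = ((w * hG.quot w : ℂ) : OnePoint ℂ) := by
  filter_upwards [(toPoly F.2).continuous.continuousAt.eventually_ne (hG.denom_eval hz)] with w hw
  simp only [toMap, OnePoint.elim_some, if_neg hw, hG.eval_fst w, DiskMap.quot, mul_div_assoc]

/-- Along the radius the value at rz has modulus at most r (1 - gap (1 - r)) and the value at z has
modulus 1. The difference quotient is therefore at least 1 + gap · r. -/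
lemma one_add_gap_le_norm_deriv {z : ℂ} (hz : ‖z‖ = 1) :
    1 + hG.gap ≤ ‖hG.quot z + z * deriv hG.quot z‖ := by
  have hz0 : z ≠ 0 := by rintro rfl; simp at hz
  have hslope := (hasDerivAt_iff_tendsto_slope.1 (hG.hasDerivAt_mul_quot hz.le)).norm
  have hpath : Tendsto (fun r : ℝ => (r : ℂ) * z) (𝓝[<] 1) (𝓝[≠] z) := by
    refine tendsto_nhdsWithin_iff.2 ⟨?_, ?_⟩
    · have : Continuous fun r : ℝ => (r : ℂ) * z := by fun_prop
      simpa using (this.tendsto 1).mono_left (nhdsWithin_le_nhds (s := Iio 1))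
    · filter_upwards [self_mem_nhdsWithin] with r hr h
      have hr : r < 1 := hr
      have h : (r : ℂ) * z = z := h
      have h1 : (r : ℂ) = 1 := mul_right_cancel₀ hz0 (by rw [h, one_mul])
      exact hr.ne (by exact_mod_cast h1)
  have hlim : Tendsto (fun r : ℝ => 1 + hG.gap * r) (𝓝[<] 1) (𝓝 (1 + hG.gap)) := by
    have : Continuous fun r : ℝ => 1 + hG.gap * r := by fun_prop
    simpa using (this.tendsto 1).mono_left (nhdsWithin_le_nhds (s := Iio 1))
  refine le_of_tendsto_of_tendsto hlim (hslope.comp hpath) ?_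
  filter_upwards [Ioo_mem_nhdsLT (zero_lt_one (α := ℝ))] with r hr
  have hnr : ‖(r : ℂ) * z‖ = r := by
    rw [norm_mul, hz, mul_one, Complex.norm_real, Real.norm_of_nonneg hr.1.le]
  have h1 : 0 < 1 - r := by linarith [hr.2]
  have hq := hG.norm_quot_le (z := (r : ℂ) * z) (by rw [hnr]; exact hr.2)
  rw [hnr] at hq
  have hfz : ‖z * hG.quot z‖ = 1 := by rw [norm_mul, hz, hG.norm_quot_of_norm_eq_one hz, one_mul]
  have hfr : ‖(r : ℂ) * z * hG.quot (r * z)‖ ≤ r * (1 - hG.gap * (1 - r)) := by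
    rw [norm_mul, hnr]
    exact mul_le_mul_of_nonneg_left hq hr.1.le
  have hdiff : 1 - r * (1 - hG.gap * (1 - r)) ≤
      ‖(r : ℂ) * z * hG.quot (r * z) - z * hG.quot z‖ := by
    have := norm_sub_norm_le (z * hG.quot z) ((r : ℂ) * z * hG.quot (r * z))
    rw [norm_sub_rev] at this
    linarith
  have hden : ‖(r : ℂ) * z - z‖ = 1 - r := by
    have : (r : ℂ) * z - z = ((r - 1 : ℝ) : ℂ) * z := by push_cast; ring
    rw [this, norm_mul, hz, mul_one, Complex.norm_real, Real.norm_eq_abs, abs_sub_comm,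
      abs_of_pos h1]
  simp only [Function.comp_apply, slope_def_field, norm_div]
  rw [hden, le_div_iff₀ h1]
  linarith

/-- The density of the spherical metric is constant on the invariant circle, so spherical and
Euclidean derivatives agree there. -/
lemma hasSphericalDeriv_circle {z : ℂ} (hz : ‖z‖ = 1) :
    HasSphericalDeriv (toMap F) (z : OnePoint ℂ) ‖hG.quot z + z * deriv hG.quot z‖ := by
  have h := hasSphericalDeriv_coe (hG.eventually_toMap_coe hz.le) (hG.hasDerivAt_mul_quot hz.le)
  rw [norm_mul, hz, hG.norm_quot_of_norm_eq_one hz] at h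
  norm_num at h
  exact h

lemma isHyperbolic : IsHyperbolic (toMap F) := by
  -- The spherical metric itself is expanded by at least 1 + gap; half the gap leaves room for the
  -- strict inequality.
  refine ⟨univ, fun _ => 1, 1 + hG.gap / 2, isOpen_univ, subset_univ _, by simp,
    contDiffOn_const, contDiffOn_const, by linarith [hG.gap_pos], ?_⟩
  rw [hG.juliaSet_eq]
  rintro _ ⟨z, hz, rfl⟩
  have hz : ‖z‖ = 1 := by simpa using hz
  refine ⟨_, hG.hasSphericalDeriv_circle hz, ?_⟩
  have := hG.one_add_gap_le_norm_deriv hz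
  have := hG.gap_pos
  linarith

lemma isAttractingFixedPoint_zero :
    IsAttractingFixedPoint (toMap F) ((0 : ℂ) : OnePoint ℂ) := by
  refine ⟨?_, ‖hG.quot 0‖, hG.norm_quot_zero_lt, ?_⟩
  · rw [hG.toMap_coe (by simp), zero_mul]
  · simpa using hasSphericalDeriv_coe (hG.eventually_toMap_coe (z := 0) (by simp))
      (hG.hasDerivAt_mul_quot (z := 0) (by simp))

omit hG in
lemma sig_zero : sig ((0 : ℂ) : OnePoint ℂ) = ∞ := by
  rw [← pt_one, sig_pt (by simp)]; simp

omit hG in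
lemma sig_infty : sig ∞ = ((0 : ℂ) : OnePoint ℂ) := by
  rw [← sig_zero, sig_sig]

lemma isAttractingFixedPoint_infty : IsAttractingFixedPoint (toMap F) ∞ := by
  obtain ⟨h, s, hs, hd⟩ := hG.isAttractingFixedPoint_zero
  refine ⟨?_, s, hs, ?_⟩
  · rw [← sig_zero, hG.toMap_sig, h]
  · rw [← sig_zero]
    exact hd.sig hG.toMap_sig

omit hG in
lemma isQuasiCircle_unitCircle : IsQuasiCircle unitCircle := by
  refine ⟨Homeomorph.refl _, ⟨1, fun p => Eventually.of_forall fun r y y' h h' => ?_⟩, ?_⟩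
  · simpa using h.trans h'
  · simp

omit hG in
lemma isPreconnected_unitDisk : IsPreconnected unitDisk :=
  (convex_ball (0 : ℂ) 1).isPreconnected.image _ OnePoint.continuous_coe.continuousOn

omit hG in
lemma compl_unitCircle : unitCircleᶜ = unitDisk ∪ sig ⁻¹' unitDisk := by
  ext p
  simp only [mem_compl_iff, mem_union, mem_preimage]
  refine ⟨fun h => ?_, ?_⟩
  · rcases mem_unitDisk_or p with h' | h' | h'
    · exact Or.inl h'
    · exact absurd h' h
    · exact Or.inr h'
  · rintro (h | h)
    · exact disjoint_unitDisk_unitCircle h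
    · rw [← sig_mem_unitCircle]
      exact disjoint_unitDisk_unitCircle h

omit hG in
lemma disjoint_unitDisk_sig : Disjoint unitDisk (sig ⁻¹' unitDisk) := by
  rw [Set.disjoint_left]
  intro p hp hp'
  obtain ⟨u, v, h, rfl⟩ := exists_pt p
  rw [mem_preimage, sig_pt h, pt_mem_unitDisk_iff, RCLike.norm_conj, RCLike.norm_conj] at hp'
  exact absurd (pt_mem_unitDisk_iff.1 hp) hp'.not_gt

omit hG in
lemma connectedComponentIn_union {U V : Set (OnePoint ℂ)} (hU : IsOpen U) (hV : IsOpen V)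
    (hUc : IsPreconnected U) (hUV : Disjoint U V) {p : OnePoint ℂ} (hp : p ∈ U) :
    connectedComponentIn (U ∪ V) p = U := by
  refine Subset.antisymm ?_ (hUc.subset_connectedComponentIn hp subset_union_left)
  refine isPreconnected_connectedComponentIn.subset_left_of_subset_union hU hV hUV
    (connectedComponentIn_subset _ _) ⟨p, ?_, hp⟩
  exact mem_connectedComponentIn (Or.inl hp)

/-- The two Fatou components are the disk and its reflection. Each equals its own full preimage, so
surjectivity makes it equal to its image. -/
lemma image_connectedComponentIn (hd : d ≠ 0) {p : OnePoint ℂ} (hp : p ∈ fatouSet (toMap F)) :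
    toMap F '' connectedComponentIn (fatouSet (toMap F)) p =
      connectedComponentIn (fatouSet (toMap F)) p := by
  have hsurj := hG.nonDeg.surjective_toMap hd
  have hB : toMap F ⁻¹' unitDisk = unitDisk := hG.isBlaschke
  have hB' : toMap F ⁻¹' (sig ⁻¹' unitDisk) = sig ⁻¹' unitDisk := by
    ext q
    rw [mem_preimage, mem_preimage, ← hG.toMap_sig, mem_preimage]
    exact Set.ext_iff.1 hB (sig q)
  have hE : IsOpen (sig ⁻¹' unitDisk) := isOpen_unitDisk.preimage continuous_sig
  have hEc : IsPreconnected (sig ⁻¹' unitDisk) := by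
    have : sig ⁻¹' unitDisk = sig '' unitDisk :=
      (sigHomeo.toEquiv.image_symm_eq_preimage unitDisk).symm
    rw [this]
    exact isPreconnected_unitDisk.image _ continuous_sig.continuousOn
  rw [hG.fatouSet_eq, compl_unitCircle] at hp ⊢
  rcases hp with hp | hp
  · rw [connectedComponentIn_union isOpen_unitDisk hE isPreconnected_unitDisk
      disjoint_unitDisk_sig hp]
    conv_lhs => rw [← hB]
    exact image_preimage_eq _ hsurj
  · rw [union_comm, connectedComponentIn_union hE isOpen_unitDisk hEc
      disjoint_unitDisk_sig.symm hp]
    conv_lhs => rw [← hB']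
    exact image_preimage_eq _ hsurj

lemma isQuasiBlaschke (hd : d ≠ 0) : IsQuasiBlaschke (toMap F) := by
  refine ⟨hG.isHyperbolic, ?_, fun p hp => hG.image_connectedComponentIn hd hp⟩
  rw [hG.juliaSet_eq]
  exact isQuasiCircle_unitCircle

/-- Fixed points other than `0` and `∞` lie on the unit circle. -/
lemma mem_unitCircle_of_fixed {p : OnePoint ℂ} (hp : toMap F p = p)
    (h0 : p ≠ ((0 : ℂ) : OnePoint ℂ)) (h1 : p ≠ ∞) : p ∈ unitCircle := by
  have key : ∀ q : OnePoint ℂ, toMap F q = q → q ∈ unitDisk → q = ((0 : ℂ) : OnePoint ℂ) := by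
    intro q hq hqD
    have hlim := hG.tendsto_iterate_zero hqD
    have hconst : ∀ k, (toMap F)^[k] q = q := fun k => Function.iterate_fixed hq k
    simp only [hconst] at hlim
    exact tendsto_nhds_unique tendsto_const_nhds hlim
  rcases mem_unitDisk_or p with h | h | h
  · exact absurd (key p hp h) h0
  · exact h
  · have := key (sig p) (by rw [hG.toMap_sig, hp]) h
    rw [← sig_infty] at this
    exact absurd (sigHomeo.injective this) h1

omit hG in
lemma coe_exp_mem_unitCircle (t : ℝ) :
    ((Complex.exp (2 * Real.pi * Complex.I * t) : ℂ) : OnePoint ℂ) ∈ unitCircle := by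
  rw [coe_mem_unitCircle_iff, show (2 * Real.pi * Complex.I * t : ℂ) =
    ((2 * Real.pi * t : ℝ) : ℂ) * Complex.I by push_cast; ring, Complex.norm_exp_ofReal_mul_I]

omit hG in
lemma exists_exp_eq {z : ℂ} (hz : ‖z‖ = 1) :
    ∃ t : ℝ, Complex.exp (2 * Real.pi * Complex.I * t) = z := by
  refine ⟨Complex.arg z / (2 * Real.pi), ?_⟩
  have h := Complex.norm_mul_exp_arg_mul_I z
  rw [hz, Complex.ofReal_one, one_mul] at h
  rw [← h]
  congr 1
  have : (Real.pi : ℂ) ≠ 0 := by exact_mod_cast Real.pi_ne_zero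
  rw [h]
  push_cast
  field_simp

omit hG in
lemma exp_eq_exp_imp {s t : ℝ} (h : Complex.exp (2 * Real.pi * Complex.I * s) =
    Complex.exp (2 * Real.pi * Complex.I * t)) : ∃ n : ℤ, s = t + n := by
  rw [Complex.exp_eq_exp_iff_exists_int] at h
  obtain ⟨n, hn⟩ := h
  refine ⟨n, ?_⟩
  have hpi : (2 * Real.pi * Complex.I : ℂ) ≠ 0 := Complex.two_pi_I_ne_zero
  have : (s : ℂ) = t + n := mul_left_cancel₀ hpi (by rw [hn]; ring)
  exact_mod_cast this

omit hG in
lemma isStandardOrdered {n : MarkedRat d} (hG : Good n.coeff)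
    (h0 : n.mark 0 = ((0 : ℂ) : OnePoint ℂ)) (h1 : n.mark 1 = ∞) (s : Fin (d + 1) → ℝ)
    (hs : ∀ i : Fin (d + 1), 2 ≤ (i : ℕ) →
      n.mark i = ((Complex.exp (2 * Real.pi * Complex.I * s i) : ℂ) : OnePoint ℂ))
    (hord : ∀ i j : Fin (d + 1), 2 ≤ (i : ℕ) → i < j → s i < s j ∧ s j < s i + 1) :
    IsStandardOrdered n := by
  refine ⟨h0, h1, hG.isAttractingFixedPoint_zero, hG.isAttractingFixedPoint_infty,
    fun t => 2 * Real.pi * Complex.I * t, by fun_prop, fun t => by push_cast; ring, ?_, ?_,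
    s, hs, hord⟩
  · intro t ht t' ht' h
    obtain ⟨n, hn⟩ := exp_eq_exp_imp h
    have h1 : (n : ℝ) < 1 := by linarith [ht.2, ht'.1]
    have h2 : (-1 : ℝ) < n := by linarith [ht.1, ht'.2]
    have h3 : n = 0 := by
      have : n < 1 := by exact_mod_cast h1
      have : -1 < n := by exact_mod_cast h2
      omega
    rw [hn, h3]; simp
  · rw [MarkedRat.map, hG.juliaSet_eq]
    ext p
    constructor
    · rintro ⟨t, rfl⟩
      exact coe_exp_mem_unitCircle t
    · rintro ⟨z, hz, rfl⟩
      obtain ⟨t, ht⟩ := exists_exp_eq (z := z) (by simpa using hz)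
      exact ⟨t, congrArg _ ht⟩

omit hG in
lemma toModuli_mem_blaschkeLocus (hd : d ≠ 0) {n : MarkedRat d} (hG : Good n.coeff)
    (h : IsStandardOrdered n) : n.toModuli ∈ blaschkeLocus d :=
  ⟨⟨n, ⟨hG.isQuasiBlaschke hd, n, rfl, h⟩, rfl⟩, n, rfl, hG.isBlaschke⟩

/-- Non-vanishing of the denominator on the compact disk and the bound on the multiplier are open
conditions. What remains of `Good` is linear: symmetry and fixing 0. -/
lemma eventually_good (hd : d ≠ 0) : ∀ᶠ G in 𝓝 F, refl G = G → G.1 0 = 0 → Good G := by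
  have h1 : ∀ᶠ G in 𝓝 F, ∀ z ∈ Metric.closedBall (0 : ℂ) 1, hom G.2 z 1 ≠ 0 := by
    refine (isCompact_closedBall (0 : ℂ) 1).eventually_forall_of_forall_eventually fun z hz => ?_
    have hc : Continuous fun x : Coeff d × ℂ => hom x.1.2 x.2 1 := by unfold hom; fun_prop
    exact hc.continuousAt.eventually_ne (x := (F, z)) (hG.denom z (by simpa using hz))
  have h2 : ∀ᶠ G : Coeff d in 𝓝 F, ‖(toPoly G.1).coeff 1‖ < ‖G.2 0‖ := by
    have e : ∀ G : Coeff d, (toPoly G.1).coeff 1 = G.1 ⟨1, by omega⟩ := fun G => by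
      rw [toPoly_coeff, dif_pos]
    have hm := hG.mult
    simp only [e] at hm ⊢
    have c1 : Continuous fun G : Coeff d => ‖G.1 ⟨1, by omega⟩‖ := by fun_prop
    have c2 : Continuous fun G : Coeff d => ‖G.2 0‖ := by fun_prop
    exact c1.continuousAt.eventually_lt c2.continuousAt hm
  filter_upwards [h1, h2] with G h1 h2 hs h0
  exact ⟨⟨hs, h0, fun z hz => h1 z (by simpa using hz)⟩, h2⟩

end Good


/-! ### Normalised representatives -/

section Normal

variable {d : ℕ}

/-- Hilbert 90 for the conjugation: applying the involution twice gives |c| = 1, and 1 + c is a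
suitable factor unless it vanishes, in which case i is. -/
lemma exists_smul_refl_eq {F : Coeff d} (hF : F ≠ 0) {c : ℂ} (h : refl F = c • F) :
    ∃ μ : ℂ, μ ≠ 0 ∧ refl (μ • F) = μ • F := by
  by_cases hc : c = -1
  · refine ⟨Complex.I, Complex.I_ne_zero, ?_⟩
    rw [refl_smul, h, hc, smul_smul]; simp
  · refine ⟨1 + c, fun h0 => hc (by linear_combination h0), ?_⟩
    have h1 : starRingEnd ℂ c * c = 1 := by
      have : F = (starRingEnd ℂ c * c) • F := by
        conv_lhs => rw [← refl_refl F, h, refl_smul, h, smul_smul]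
      have h2 : (starRingEnd ℂ c * c - 1) • F = 0 := by
        rw [sub_smul, one_smul, ← this, sub_self]
      rcases smul_eq_zero.1 h2 with h3 | h3
      · linear_combination h3
      · exact absurd h3 hF
    rw [refl_smul, h, smul_smul, map_add, map_one, add_mul, h1, one_mul, add_comm c 1]

lemma NonDeg.ne_zero {F : Coeff d} (hF : NonDeg F) : F ≠ 0 := by
  rintro rfl
  have := hF 1 1 (by simp [hom]) (by simp [hom])
  simp at this

lemma fin_cases_two_le (i : Fin (d + 1)) : i = 0 ∨ i = 1 ∨ 2 ≤ (i : ℕ) := by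
  by_cases h0 : (i : ℕ) = 0
  · exact Or.inl (Fin.ext h0)
  · by_cases h1 : (i : ℕ) = 1
    · right; left
      have hi := i.2
      refine Fin.ext ?_
      rw [h1, Fin.val_one', Nat.mod_eq_of_lt (by omega)]
    · right; right; omega

/-- Dynamical properties of the marking, invariant under conjugation. -/
structure WellMarked (n : MarkedRat d) : Prop where
  inj : Function.Injective n.mark
  attr_zero : AttractsNear n.map (n.mark 0)
  attr_one : AttractsNear n.map (n.mark 1)
  julia : ∀ i : Fin (d + 1), 2 ≤ (i : ℕ) → n.mark i ∉ fatouSet n.map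

/-- The parameters of the marks on the Julia set differ by less than one period of a simple loop, so
these marks are distinct; 0 and ∞ are not values of the exponential. -/
lemma IsStandardOrdered.wellMarked {n : MarkedRat d} (hd : 2 ≤ d) (h : IsStandardOrdered n) :
    WellMarked n := by
  obtain ⟨h0, h1, ha0, ha1, L, -, hper, hinj, hrange, s, hs, hord⟩ := h
  have hJ : ∀ t, ((Complex.exp (L t) : ℂ) : OnePoint ℂ) ∈ juliaSet n.map := fun t => by
    rw [← hrange]; exact mem_range_self t
  have hshift : ∀ (k : ℤ) (t : ℝ), Complex.exp (L (t + k)) = Complex.exp (L t) := by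
    have hf : Function.Periodic (fun t => Complex.exp (L t)) 1 := fun t => by
      simp only [hper, Complex.exp_add, Complex.exp_two_pi_mul_I, mul_one]
    intro k t
    have := hf.int_mul k t
    simpa using this
  have hne : ∀ i j : Fin (d + 1), 2 ≤ (i : ℕ) → i < j → n.mark i ≠ n.mark j := by
    intro i j hi hij hmark
    have hj : 2 ≤ (j : ℕ) := hi.trans (le_of_lt hij)
    rw [hs i hi, hs j hj, OnePoint.coe_eq_coe] at hmark
    obtain ⟨h1, h2⟩ := hord i j hi hij
    have e : ∀ t, Complex.exp (L (Int.fract t)) = Complex.exp (L t) := by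
      intro t
      rw [← hshift ⌊t⌋ (Int.fract t), Int.fract_add_floor]
    rw [← e, ← e (s j)] at hmark
    have hfr := hinj ⟨Int.fract_nonneg _, Int.fract_lt_one _⟩
      ⟨Int.fract_nonneg _, Int.fract_lt_one _⟩ hmark
    obtain ⟨z, hz⟩ := Int.fract_eq_fract.1 hfr
    have h3 : (z : ℝ) < 0 := by linarith
    have h4 : (-1 : ℝ) < z := by linarith
    have : z < 0 := by exact_mod_cast h3
    have : -1 < z := by exact_mod_cast h4
    omega
  refine ⟨?_, h0 ▸ ha0.attractsNear, h1 ▸ ha1.attractsNear, fun i hi => ?_⟩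
  · have hlt : ∀ i j : Fin (d + 1), i < j → n.mark i ≠ n.mark j := by
      intro i j hij
      rcases fin_cases_two_le i with rfl | rfl | hi
      · rcases fin_cases_two_le j with rfl | rfl | hj
        · exact absurd hij (lt_irrefl _)
        · rw [h0, h1]; exact OnePoint.coe_ne_infty _
        · rw [h0, hs j hj, Ne, OnePoint.coe_eq_coe]
          exact (Complex.exp_ne_zero _).symm
      · have hj : 2 ≤ (j : ℕ) := by
          have h := Fin.lt_def.1 hij
          rw [Fin.val_one', Nat.mod_eq_of_lt (by omega)] at h
          omega
        rw [h1, hs j hj]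
        exact OnePoint.infty_ne_coe _
      · exact hne i j hi hij
    intro i j hij
    rcases lt_trichotomy i j with h | h | h
    · exact absurd hij (hlt i j h)
    · exact h
    · exact absurd hij.symm (hlt j i h)
  · rw [hs i hi]
    exact hJ _

lemma WellMarked.of_toModuli_eq {m n : MarkedRat d} (hm : WellMarked m)
    (h : m.toModuli = n.toModuli) : WellMarked n := by
  have hinj := injective_mark_of_toModuli_eq h hm.inj
  obtain ⟨g, hg, hmark⟩ := (toModuli_eq_iff _ _).1 h
  refine ⟨hinj, ?_, ?_, fun i hi => ?_⟩
  · rw [hmark]; exact hm.attr_zero.image (glHomeo g) hg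
  · rw [hmark]; exact hm.attr_one.image (glHomeo g) hg
  · rw [hmark]
    exact fun h => hm.julia i hi ((mem_fatouSet_iff (glHomeo g) hg).1 h)

lemma wellMarked_of_mem_quasiBlaschkeSpace (hd : 2 ≤ d) {n : MarkedRat d}
    (h : n.toModuli ∈ quasiBlaschkeSpace d) : WellMarked n := by
  obtain ⟨q, ⟨-, n', hn', hs⟩, hq⟩ := h
  exact (hs.wellMarked hd).of_toModuli_eq (hn'.trans hq)

/-- A Blaschke product has at most one attracting point on the unit circle. -/
lemma eq_of_attractsNear_of_mem_unitCircle {F : Coeff d} (hB : IsBlaschke (toMap F))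
    {P Q : OnePoint ℂ} (hP : AttractsNear (toMap F) P) (hQ : AttractsNear (toMap F) Q)
    (hPc : P ∈ unitCircle) (hQc : Q ∈ unitCircle) : P = Q := by
  set f : ℂ → ℂ := fun z => (toPoly F.1).eval z / (toPoly F.2).eval z
  have hlt : ∀ z : ℂ, ‖z‖ < 1 → ‖(toPoly F.1).eval z‖ < ‖(toPoly F.2).eval z‖ := by
    intro z hz
    rw [← hom_one, ← hom_one]
    exact ((isBlaschke_toMap_iff F).1 hB z 1 (by simp)).2 (by simpa using hz)
  have hden : ∀ z : ℂ, ‖z‖ < 1 → (toPoly F.2).eval z ≠ 0 := fun z hz =>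
    norm_pos_iff.1 ((norm_nonneg _).trans_lt (hlt z hz))
  have hdiff : DifferentiableOn ℂ f (Metric.ball 0 1) := fun z hz => by
    have h : DifferentiableAt ℂ f z := (Polynomial.differentiableAt _).div
      (Polynomial.differentiableAt _) (hden z (by simpa using hz))
    exact h.differentiableWithinAt
  have hmaps : MapsTo f (Metric.ball 0 1) (Metric.ball 0 1) := by
    intro z hz
    have hz : ‖z‖ < 1 := by simpa using hz
    rw [mem_ball_zero_iff, norm_div, div_lt_one (norm_pos_iff.2 (hden z hz))]
    exact hlt z hz
  have hmapsk : ∀ k, MapsTo f^[k] (Metric.ball 0 1) (Metric.ball 0 1) := fun k => hmaps.iterate k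
  have hdiffk : ∀ k, DifferentiableOn ℂ f^[k] (Metric.ball 0 1) := by
    intro k
    induction k with
    | zero => exact differentiableOn_id
    | succ k ih =>
      rw [Function.iterate_succ']
      exact hdiff.comp ih (hmapsk k)
  have hstep : ∀ w : ℂ, ‖w‖ < 1 → toMap F (w : OnePoint ℂ) = ((f w : ℂ) : OnePoint ℂ) := by
    intro w hw
    simp only [toMap, OnePoint.elim_some, if_neg (hden w hw)]
    rfl
  have hcoe : ∀ k (z : ℂ), ‖z‖ < 1 →
      (toMap F)^[k] (z : OnePoint ℂ) = ((f^[k] z : ℂ) : OnePoint ℂ) := by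
    intro k z hz
    induction k with
    | zero => rfl
    | succ k ih =>
      have hk : ‖f^[k] z‖ < 1 := by simpa using hmapsk k (by simpa using hz : z ∈ Metric.ball 0 1)
      rw [Function.iterate_succ_apply', ih, Function.iterate_succ_apply', hstep _ hk]
  -- An attracting point on the circle attracts some orbit starting inside the disk, because the
  -- disk accumulates at it.
  have hpt : ∀ P : OnePoint ℂ, AttractsNear (toMap F) P → P ∈ unitCircle →
      ∃ p z : ℂ, P = (p : OnePoint ℂ) ∧ ‖p‖ = 1 ∧ ‖z‖ < 1 ∧
        Tendsto (fun k => f^[k] z) atTop (𝓝 p) := by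
    rintro _ ⟨U, hU, hV⟩ ⟨p, hp, rfl⟩
    have hp : ‖p‖ = 1 := by simpa using hp
    have hcl : p ∈ closure (Metric.ball (0 : ℂ) 1) := by
      rw [closure_ball 0 one_ne_zero]; simp [hp]
    rw [OnePoint.nhds_coe_eq, mem_map] at hU
    obtain ⟨z, hzU, hz⟩ := mem_closure_iff_nhds.1 hcl _ hU
    have hz : ‖z‖ < 1 := by simpa using hz
    refine ⟨p, z, rfl, hp, hz, ?_⟩
    rw [OnePoint.isOpenEmbedding_coe.isEmbedding.tendsto_nhds_iff]
    intro V hVn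
    rw [mem_map]
    filter_upwards [hV V hVn] with k hk
    have := hk _ hzU
    rw [hcoe k z hz] at this
    exact this
  obtain ⟨p, z, rfl, hp, hz, hzlim⟩ := hpt P hP hPc
  obtain ⟨q, w, rfl, hq, hw, hwlim⟩ := hpt Q hQ hQc
  -- As k → ∞ the right side tends to 0, because |p| = |q| = 1, while the left side tends to a
  -- positive multiple of |1 - conj p · q|². Hence conj p · q = 1 and p = q.
  have hpick : ∀ k, (1 - ‖z‖ ^ 2) * (1 - ‖w‖ ^ 2) *
      ‖1 - starRingEnd ℂ (f^[k] z) * f^[k] w‖ ^ 2 ≤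
      (1 - ‖f^[k] z‖ ^ 2) * (1 - ‖f^[k] w‖ ^ 2) * ‖1 - starRingEnd ℂ z * w‖ ^ 2 :=
    fun k => schwarz_pick (hdiffk k) (hmapsk k) hz hw
  have hl : Tendsto (fun k => (1 - ‖z‖ ^ 2) * (1 - ‖w‖ ^ 2) *
      ‖1 - starRingEnd ℂ (f^[k] z) * f^[k] w‖ ^ 2) atTop
      (𝓝 ((1 - ‖z‖ ^ 2) * (1 - ‖w‖ ^ 2) * ‖1 - starRingEnd ℂ p * q‖ ^ 2)) := by
    have h1 := (Complex.continuous_conj.tendsto p).comp hzlim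
    exact ((((tendsto_const_nhds (x := (1 : ℂ))).sub (h1.mul hwlim)).norm.pow 2).const_mul _)
  have hr : Tendsto (fun k => (1 - ‖f^[k] z‖ ^ 2) * (1 - ‖f^[k] w‖ ^ 2) *
      ‖1 - starRingEnd ℂ z * w‖ ^ 2) atTop
      (𝓝 ((1 - ‖p‖ ^ 2) * (1 - ‖q‖ ^ 2) * ‖1 - starRingEnd ℂ z * w‖ ^ 2)) :=
    ((tendsto_const_nhds.sub (hzlim.norm.pow 2)).mul
      (tendsto_const_nhds.sub (hwlim.norm.pow 2))).mul_const _
  have hle := le_of_tendsto_of_tendsto' hl hr hpick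
  rw [hp, hq] at hle
  have hc : 0 < (1 - ‖z‖ ^ 2) * (1 - ‖w‖ ^ 2) :=
    mul_pos (by nlinarith [norm_nonneg z]) (by nlinarith [norm_nonneg w])
  have h0 : ‖1 - starRingEnd ℂ p * q‖ ^ 2 ≤ 0 := by
    by_contra! h
    have := mul_pos hc h
    norm_num at hle
    linarith
  have h1 : 1 - starRingEnd ℂ p * q = 0 := by
    rw [← norm_eq_zero]
    exact pow_eq_zero_iff two_ne_zero |>.1 (le_antisymm h0 (by positivity))
  have h2 : p * starRingEnd ℂ p = 1 := by rw [Complex.mul_conj', hp]; simp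
  congr 1
  calc p = p * (starRingEnd ℂ p * q) := by rw [← sub_eq_zero.1 h1, mul_one]
    _ = q := by rw [← mul_assoc, h2, one_mul]

lemma MarkedRat.isBlaschke_sig {m : MarkedRat d} (hB : IsBlaschke m.map) (p : OnePoint ℂ) :
    m.map (sig p) = sig (m.map p) := by
  obtain ⟨c, hc, h⟩ := exists_refl_eq_smul m.nonDeg hB
  exact m.nonDeg.toMap_sig hc h p

/-- The first two marked points of a Blaschke product are exchanged by the reflection. -/
lemma WellMarked.sig_mark_zero (hd : 2 ≤ d) {m : MarkedRat d} (hm : WellMarked m)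
    (hB : IsBlaschke m.map) : sig (m.mark 0) = m.mark 1 := by
  have hs := MarkedRat.isBlaschke_sig hB
  -- The reflection permutes the fixed points and preserves the Fatou set, in which only the first
  -- two marks lie.
  have hperm : ∀ i, m.mark i ∈ fatouSet m.map →
      sig (m.mark i) = m.mark 0 ∨ sig (m.mark i) = m.mark 1 := by
    intro i hi
    obtain ⟨j, hj⟩ := (m.map_eq_iff hd (sig (m.mark i))).1 (by rw [hs, m.map_mark hd])
    have hF : sig (m.mark i) ∈ fatouSet m.map := image_mem_fatouSet sigHomeo hs hi
    rcases fin_cases_two_le j with rfl | rfl | h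
    · exact Or.inl hj.symm
    · exact Or.inr hj.symm
    · exact absurd (hj ▸ hF) (hm.julia j h)
  have h01 : m.mark 0 ≠ m.mark 1 := fun h => by
    have := congrArg Fin.val (hm.inj h)
    rw [Fin.val_one', Nat.mod_eq_of_lt (by omega)] at this
    simp at this
  rcases hperm 0 hm.attr_zero.mem_fatouSet with h | h
  -- Otherwise the reflection fixes both attracting points, which places both on the circle.
  · exfalso
    have h' : sig (m.mark 1) = m.mark 1 := by
      rcases hperm 1 hm.attr_one.mem_fatouSet with h' | h'
      · exact absurd (sigHomeo.injective (h.trans h'.symm)) h01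
      · exact h'
    have hcirc : ∀ p : OnePoint ℂ, sig p = p → p ∈ unitCircle := by
      intro p hp
      obtain ⟨u, v, huv, rfl⟩ := exists_pt p
      rw [sig_pt huv, pt_eq_pt_iff (by simpa [or_comm] using huv) huv] at hp
      rw [pt_mem_unitCircle_iff huv]
      have := congrArg norm hp
      rw [norm_mul, norm_mul, RCLike.norm_conj, RCLike.norm_conj] at this
      nlinarith [norm_nonneg u, norm_nonneg v]
    exact h01 (eq_of_attractsNear_of_mem_unitCircle hB hm.attr_zero hm.attr_one
      (hcirc _ h) (hcirc _ h'))
  · exact h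

lemma MarkedRat.norm_hom_lt_of_isBlaschke {m : MarkedRat d} (hB : IsBlaschke m.map) (u v : ℂ)
    (huv : u ≠ 0 ∨ v ≠ 0) :
    ‖hom m.coeff.2 u v‖ < ‖hom m.coeff.1 u v‖ ↔ ‖v‖ < ‖u‖ := by
  have h := (isBlaschke_toMap_iff m.coeff).1 hB
  have hs := MarkedRat.isBlaschke_sig hB (pt u v)
  have huv' : starRingEnd ℂ v ≠ 0 ∨ starRingEnd ℂ u ≠ 0 := by simpa [or_comm] using huv
  have h1 := h (starRingEnd ℂ v) (starRingEnd ℂ u) huv'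
  rw [RCLike.norm_conj, RCLike.norm_conj, ← pt_mem_unitDisk_iff, ← toMap_pt _ huv', ← sig_pt huv,
    ← MarkedRat.map, hs, MarkedRat.map, toMap_pt _ huv, sig_pt (m.nonDeg.ne huv),
    pt_mem_unitDisk_iff, RCLike.norm_conj, RCLike.norm_conj] at h1
  exact h1

/-- In a normalisation with first marked points `0` and `∞`, the invariant circle is round about
the origin. -/
lemma exists_norm_hom_lt_iff (hd : 2 ≤ d) {m n : MarkedRat d} (hm : WellMarked m)
    (hB : IsBlaschke m.map) (hmn : m.toModuli = n.toModuli)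
    (h0 : n.mark 0 = ((0 : ℂ) : OnePoint ℂ)) (h1 : n.mark 1 = ∞) :
    ∃ k : ℝ, 0 < k ∧ ∀ u v, u ≠ 0 ∨ v ≠ 0 →
      (k * ‖hom n.coeff.1 u v‖ < ‖hom n.coeff.2 u v‖ ↔ k * ‖u‖ < ‖v‖) := by
  have hsig := hm.sig_mark_zero hd hB
  obtain ⟨g, hg, hmark⟩ := (toModuli_eq_iff _ _).1 hmn.symm
  rw [hmark, hmark, h0, h1, ← pt_one, ← pt_zero 1, smul_pt g _ _ (by simp), smul_pt g _ _ (by simp),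
    sig_pt (gl_apply_ne_zero g (by simp)),
    pt_eq_pt_iff (by simpa [or_comm] using gl_apply_ne_zero g (u := 0) (v := 1) (by simp))
      (gl_apply_ne_zero g (by simp))] at hsig
  simp only [mul_zero, mul_one, zero_add, add_zero] at hsig
  set α := g 0 0
  set β := g 0 1
  set γ := g 1 0
  set δ := g 1 1
  have hdet : α * δ - β * γ ≠ 0 := gl_det_ne_zero g
  -- That the reflection sends g(0) = [β : δ] to g(∞) = [α : γ] means that (α, γ) is proportional to
  -- (conj δ, conj β).
  obtain ⟨c, hα, hγ⟩ : ∃ c : ℂ, α = c * starRingEnd ℂ δ ∧ γ = c * starRingEnd ℂ β := by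
    by_cases hδ : δ = 0
    · have hβ : β ≠ 0 := by rintro h; rw [h, hδ] at hdet; simp at hdet
      have hβ' : starRingEnd ℂ β ≠ 0 := by simpa using hβ
      refine ⟨γ / starRingEnd ℂ β, ?_, by rw [div_mul_cancel₀ _ hβ']⟩
      rw [hδ] at hsig ⊢
      simp only [map_zero, zero_mul, mul_zero] at hsig ⊢
      exact (mul_eq_zero.1 hsig.symm).resolve_right hβ'
    · have hδ' : starRingEnd ℂ δ ≠ 0 := by simpa using hδ
      refine ⟨α / starRingEnd ℂ δ, by rw [div_mul_cancel₀ _ hδ'], ?_⟩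
      rw [div_mul_eq_mul_div, ← hsig, mul_div_cancel_left₀ _ hδ']
  have hc : c ≠ 0 := by
    rintro rfl
    rw [hα, hγ] at hdet; simp at hdet
  set B := ‖δ‖ ^ 2 - ‖β‖ ^ 2 with hBdef
  have hB0 : B ≠ 0 := by
    intro hB0
    apply hdet
    have e : α * δ - β * γ = c * ((‖δ‖ ^ 2 - ‖β‖ ^ 2 : ℝ) : ℂ) := by
      rw [hα, hγ]
      push_cast
      rw [← Complex.mul_conj', ← Complex.mul_conj']; ring
    rw [e, ← hBdef, hB0]; simp
  -- So g carries the circle |c| |u| = |v| to the unit circle, and the sign of B tells whether it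
  -- preserves or exchanges inside and outside.
  have hnorm : ∀ u v : ℂ, ‖α * u + β * v‖ ^ 2 - ‖γ * u + δ * v‖ ^ 2 =
      B * ((‖c‖ * ‖u‖) ^ 2 - ‖v‖ ^ 2) := by
    intro u v
    rw [hα, hγ, hBdef, mul_pow]
    simp only [← Complex.normSq_eq_norm_sq, Complex.normSq_apply, Complex.add_re, Complex.add_im,
      Complex.mul_re, Complex.mul_im, Complex.conj_re, Complex.conj_im]
    ring
  have hsq : ∀ x y : ℝ, 0 ≤ x → 0 ≤ y → (x < y ↔ x ^ 2 - y ^ 2 < 0) := fun x y hx hy => by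
    rw [sub_neg, pow_lt_pow_iff_left₀ hx hy two_ne_zero]
  refine ⟨‖c‖, norm_pos_iff.2 hc, fun u v huv => ?_⟩
  -- The conjugacy only holds projectively; r is the factor between the two homogeneous lifts at (u,
  -- v).
  obtain ⟨r, hr, e1, e2⟩ : ∃ r : ℂ, r ≠ 0 ∧
      α * hom n.coeff.1 u v + β * hom n.coeff.2 u v =
        r * hom m.coeff.1 (α * u + β * v) (γ * u + δ * v) ∧
      γ * hom n.coeff.1 u v + δ * hom n.coeff.2 u v =
        r * hom m.coeff.2 (α * u + β * v) (γ * u + δ * v) := by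
    have hne := gl_apply_ne_zero g huv
    have h := hg (pt u v)
    rw [smul_pt g _ _ huv, MarkedRat.map, MarkedRat.map, toMap_pt _ hne, toMap_pt _ huv,
      smul_pt g _ _ (n.nonDeg.ne huv), pt_eq_pt_iff (m.nonDeg.ne hne)
      (gl_apply_ne_zero g (n.nonDeg.ne huv))] at h
    have hU := gl_apply_ne_zero g (n.nonDeg.ne huv)
    rcases m.nonDeg.ne hne with hx | hx
    · refine ⟨(α * hom n.coeff.1 u v + β * hom n.coeff.2 u v) /
        hom m.coeff.1 (α * u + β * v) (γ * u + δ * v), ?_, ?_, ?_⟩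
      · refine div_ne_zero (fun h0 => ?_) hx
        rw [h0, zero_mul] at h
        have := (mul_eq_zero.1 h).resolve_left hx
        exact hU.elim (fun h' => h' h0) fun h' => h' this
      · rw [div_mul_cancel₀ _ hx]
      · rw [div_mul_eq_mul_div, eq_div_iff hx, mul_comm]; exact h
    · refine ⟨(γ * hom n.coeff.1 u v + δ * hom n.coeff.2 u v) /
        hom m.coeff.2 (α * u + β * v) (γ * u + δ * v), ?_, ?_, ?_⟩
      · refine div_ne_zero (fun h0 => ?_) hx
        rw [h0, mul_zero] at h
        have := (mul_eq_zero.1 h.symm).resolve_right hx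
        exact hU.elim (fun h' => h' this) fun h' => h' h0
      · rw [div_mul_eq_mul_div, eq_div_iff hx, ← h, mul_comm]
      · rw [div_mul_cancel₀ _ hx]
  have hr' := norm_pos_iff.2 hr
  rw [hsq _ _ (by positivity) (norm_nonneg _), hsq _ _ (by positivity) (norm_nonneg _)]
  have i1 := hnorm (hom n.coeff.1 u v) (hom n.coeff.2 u v)
  have i2 := hnorm u v
  have hneg : ∀ x y : ℝ, x - y < 0 ↔ 0 < y - x := fun x y => by rw [sub_neg, sub_pos]
  rcases lt_or_gt_of_ne hB0 with hBs | hBs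
  -- For B < 0 the sides are exchanged, so the statement for the exterior of the disk is the
  -- relevant one.
  · have hmul : ∀ x : ℝ, 0 < B * x ↔ x < 0 := fun x =>
      ⟨fun h => neg_of_mul_pos_right h hBs.le, mul_pos_of_neg_of_neg hBs⟩
    have key : _ ↔ ‖γ * u + δ * v‖ < ‖α * u + β * v‖ :=
      MarkedRat.norm_hom_lt_of_isBlaschke hB _ _ (gl_apply_ne_zero g huv)
    rw [← mul_lt_mul_iff_right₀ hr', ← norm_mul, ← norm_mul, ← e1, ← e2,
      hsq _ _ (norm_nonneg _) (norm_nonneg _), hsq _ _ (norm_nonneg _) (norm_nonneg _),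
      hneg, i1, hneg, i2, hmul, hmul] at key
    exact key
  · have key : _ ↔ ‖α * u + β * v‖ < ‖γ * u + δ * v‖ :=
      (isBlaschke_toMap_iff m.coeff).1 hB _ _ (gl_apply_ne_zero g huv)
    rw [← mul_lt_mul_iff_right₀ hr', ← norm_mul, ← norm_mul, ← e1, ← e2,
      hsq _ _ (norm_nonneg _) (norm_nonneg _), hsq _ _ (norm_nonneg _) (norm_nonneg _), i1, i2,
      ← neg_pos, ← neg_pos (a := B * _), ← mul_neg, ← mul_neg, mul_pos_iff_of_pos_left hBs,
      mul_pos_iff_of_pos_left hBs, neg_pos, neg_pos] at key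
    exact key

/-- An attracting fixed point at the origin has multiplier of modulus less than one. -/
lemma DiskMap.good {F : Coeff d} (hF : DiskMap F)
    (ha : AttractsNear (toMap F) ((0 : ℂ) : OnePoint ℂ)) : Good F := by
  have h0 : (toPoly F.2).eval 0 = F.2 0 := by
    rw [← hom_one, hom_zero_left]; simp
  have h1 : (toPoly F.1).divX.eval 0 = (toPoly F.1).coeff 1 := by
    rw [← coeff_zero_eq_eval_zero, coeff_divX]
  have hne : F.2 0 ≠ 0 := by
    rw [← h0]; exact hF.denom_eval (by simp)
  refine ⟨hF, ?_⟩
  by_contra! hc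
  -- If the multiplier had modulus at least one, the maximum principle would give the quotient
  -- modulus one on the disk. The map would then preserve every circle about 0, contrary to
  -- attraction.
  have hq : 1 ≤ ‖hF.quot 0‖ := by
    rw [DiskMap.quot, h0, h1, norm_div, one_le_div (norm_pos_iff.2 hne)]
    exact hc
  have hle : ∀ z ∈ Metric.ball (0 : ℂ) 1, ‖hF.quot z‖ ≤ 1 := fun z hz =>
    hF.norm_quot_le_one (by simpa using (mem_ball_zero_iff.1 hz).le)
  have hmem : (0 : ℂ) ∈ Metric.ball (0 : ℂ) 1 := Metric.mem_ball_self one_pos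
  have hmax : IsMaxOn (norm ∘ hF.quot) (Metric.ball 0 1) 0 := fun w hw => (hle w hw).trans hq
  have hconst := Complex.norm_eqOn_of_isPreconnected_of_isMaxOn
    (convex_ball (0 : ℂ) 1).isPreconnected Metric.isOpen_ball hF.differentiableOn_quot hmem hmax
  have hone : ∀ z : ℂ, ‖z‖ < 1 → ‖hF.quot z‖ = 1 := by
    intro z hz
    have := hconst (by simpa using hz : z ∈ Metric.ball (0 : ℂ) 1)
    simp only [Function.comp_apply, Function.const_apply] at this
    rw [this]
    exact le_antisymm (hle 0 hmem) hq
  have hiter : ∀ (z : ℂ), ‖z‖ < 1 → ∀ k, ∃ w : ℂ,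
      (toMap F)^[k] (z : OnePoint ℂ) = (w : OnePoint ℂ) ∧ ‖w‖ = ‖z‖ := by
    intro z hz k
    induction k with
    | zero => exact ⟨z, rfl, rfl⟩
    | succ k ih =>
      obtain ⟨w, hw, hwn⟩ := ih
      have hw1 : ‖w‖ < 1 := hwn ▸ hz
      refine ⟨w * hF.quot w, ?_, ?_⟩
      · rw [Function.iterate_succ_apply', hw, hF.toMap_coe hw1.le]
      · rw [norm_mul, hone w hw1, mul_one, hwn]
  obtain ⟨U, hU, hV⟩ := ha
  rw [OnePoint.nhds_coe_eq, mem_map, Metric.mem_nhds_iff] at hU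
  obtain ⟨ε, hε, hεU⟩ := hU
  set r : ℝ := min ε 1 / 2 with hr
  have hr0 : 0 < r := by positivity
  have hr1 : r < 1 := by have := min_le_right ε 1; linarith
  have hrε : r < ε := by have := min_le_left ε 1; linarith
  have hrn : ‖(r : ℂ)‖ = r := by rw [Complex.norm_real, Real.norm_of_nonneg hr0.le]
  obtain ⟨k, hk⟩ := (hV ((fun w : ℂ => (w : OnePoint ℂ)) '' Metric.ball 0 r)
    ((OnePoint.isOpen_image_coe.2 Metric.isOpen_ball).mem_nhds
      (mem_image_of_mem _ (Metric.mem_ball_self hr0)))).exists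
  obtain ⟨w, hw, hwn⟩ := hiter r (by rw [hrn]; exact hr1) k
  have := hk (r : ℂ) (hεU (by rw [mem_ball_zero_iff, hrn]; exact hrε))
  rw [hw] at this
  obtain ⟨w', hw', he⟩ := this
  rw [OnePoint.coe_eq_coe] at he
  rw [he, mem_ball_zero_iff, hwn, hrn] at hw'
  exact lt_irrefl _ hw'

end Normal


/-! ### Symmetry and cyclic order of a normalised representative -/

section Normal

variable {d : ℕ}

/-- The dilation `z ↦ k z`. -/
def diagGL (k : ℂ) (hk : k ≠ 0) : GL (Fin 2) ℂ :=
  Matrix.GeneralLinearGroup.mkOfDetNeZero !![k, 0; 0, 1] (by simpa [Matrix.det_fin_two])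

lemma coe_diagGL (k : ℂ) (hk : k ≠ 0) :
    (diagGL k hk : Matrix (Fin 2) (Fin 2) ℂ) = !![k, 0; 0, 1] := rfl

lemma diagGL_smul_coe {k : ℂ} (hk : k ≠ 0) (z : ℂ) :
    diagGL k hk • (z : OnePoint ℂ) = ((k * z : ℂ) : OnePoint ℂ) := by
  rw [OnePoint.smul_some_eq_ite]
  simp [coe_diagGL]

/-- In the open disk |num| < |den|; on the circle the moduli agree, so a pole there would be a
common zero. -/
lemma diskMap_of_isBlaschke {F : Coeff d} (hF : NonDeg F) (hB : IsBlaschke (toMap F))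
    (hs : refl F = F) (h0 : F.1 0 = 0) : DiskMap F := by
  refine ⟨hs, h0, fun z hz h => ?_⟩
  rcases hz.lt_or_eq with hz | hz
  · have := ((isBlaschke_toMap_iff F).1 hB z 1 (by simp)).2 (by simpa using hz)
    rw [h, norm_zero] at this
    exact absurd this (not_lt.2 (norm_nonneg _))
  · have := norm_hom_eq_of_isBlaschke hB hz
    rw [h, norm_zero, norm_eq_zero] at this
    simpa using hF z 1 this h

/-- A normalised representative of a class in `blaschkeLocus` is, for suitable homogeneous
coordinates, a symmetric Blaschke product. -/
theorem exists_good_smul (hd : 2 ≤ d) {n : MarkedRat d} (hn : n.toModuli ∈ blaschkeLocus d)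
    (h0 : n.mark 0 = ((0 : ℂ) : OnePoint ℂ)) (h1 : n.mark 1 = ∞)
    (h2 : n.mark ⟨2, by omega⟩ = ((1 : ℂ) : OnePoint ℂ)) :
    ∃ μ : ℂ, μ ≠ 0 ∧ Good (μ • n.coeff) := by
  obtain ⟨hq, m, hmn, hB⟩ := hn
  have hwn := wellMarked_of_mem_quasiBlaschkeSpace hd hq
  have hwm := hwn.of_toModuli_eq hmn.symm
  obtain ⟨k, hk, hiff⟩ := exists_norm_hom_lt_iff hd hwm hB hmn h0 h1
  have hk0 : (k : ℂ) ≠ 0 := by exact_mod_cast hk.ne'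
  have hkn : ‖(k : ℂ)‖ = k := by rw [Complex.norm_real, Real.norm_of_nonneg hk.le]
  -- The invariant circle has radius 1 / k; this dilation makes it the unit circle.
  set g := diagGL k hk0 with hg
  set F := conjCoeff (g : Matrix (Fin 2) (Fin 2) ℂ) n.coeff with hFdef
  have hF : NonDeg F := n.nonDeg.conjCoeff g
  have e1 : ∀ u v, hom F.1 u v = k * hom n.coeff.1 u (k * v) := fun u v => by
    rw [hFdef, hom_conjCoeff_fst, hg, coe_diagGL]; simp
  have e2 : ∀ u v, hom F.2 u v = hom n.coeff.2 u (k * v) := fun u v => by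
    rw [hFdef, hom_conjCoeff_snd, hg, coe_diagGL]; simp
  have hBF : IsBlaschke (toMap F) := by
    rw [isBlaschke_toMap_iff]
    intro u v huv
    rw [e1, e2, norm_mul, hkn, hiff u (k * v) (by simpa [hk0] using huv), norm_mul, hkn,
      mul_lt_mul_iff_right₀ hk]
  have hconj : ∀ p, toMap F (g • p) = g • n.map p := toMap_conjCoeff g _ n.nonDeg
  obtain ⟨c, hc, hrefl⟩ := exists_refl_eq_smul hF hBF
  obtain ⟨μ, hμ, hμr⟩ := exists_smul_refl_eq hF.ne_zero hrefl
  have hF0 : F.1 0 = 0 := by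
    have h := n.map_mark hd 0
    rw [h0, ← pt_one, MarkedRat.map, toMap_pt_eq_self_iff n.nonDeg (by simp), zero_mul, zero_sub,
      one_mul, neg_eq_zero] at h
    have h' := e1 0 1
    rw [hom_zero_left, hom_zero_left, one_pow, mul_one] at h'
    rw [hom_zero_left, one_pow, mul_one] at h
    rw [h', h]; simp
  have hmap : toMap (μ • F) = toMap F := toMap_smul hμ F
  have hdisk : DiskMap (μ • F) :=
    diskMap_of_isBlaschke (hF.smul hμ) (by rw [hmap]; exact hBF) hμr (by simp [hF0])
  have hattr : AttractsNear (toMap (μ • F)) ((0 : ℂ) : OnePoint ℂ) := by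
    have := hwn.attr_zero.image (glHomeo g) hconj
    rw [h0, glHomeo_apply, hg, diagGL_smul_coe, mul_zero] at this
    rwa [hmap]
  have hgood := hdisk.good hattr
  -- The dilation moves the marked point 1 to k, a fixed point other than 0 and ∞ and hence on the
  -- unit circle. So k = 1, and there was nothing to rescale.
  have hfix : toMap (μ • F) ((k : ℂ) : OnePoint ℂ) = ((k : ℂ) : OnePoint ℂ) := by
    have h := n.map_mark hd ⟨2, by omega⟩
    rw [h2] at h
    have h' := hconj ((1 : ℂ) : OnePoint ℂ)
    rw [h, hg, diagGL_smul_coe, mul_one] at h'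
    rw [hmap, h']
  have hk1 := hgood.mem_unitCircle_of_fixed hfix (by simpa using hk0) (OnePoint.coe_ne_infty _)
  rw [coe_mem_unitCircle_iff, hkn] at hk1
  refine ⟨μ, hμ, ?_⟩
  have : F = n.coeff := by
    refine coeff_ext (fun u => ?_) fun u => ?_
    · rw [e1, hk1]; simp
    · rw [e2, hk1]; simp
  rwa [this] at hgood

/-- A continuous lift of a simple loop of winding number one on the circle is increasing. -/
lemma strictMono_of_injOn_exp {θ : ℝ → ℝ} (hθ : Continuous θ)
    (hper : ∀ t, θ (t + 1) = θ t + 2 * Real.pi)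
    (hinj : InjOn (fun t => Complex.exp (θ t * Complex.I)) (Ico 0 1)) : StrictMono θ := by
  have hshift : ∀ (t : ℝ) (k : ℤ), θ (t + k) = θ t + 2 * Real.pi * k := by
    have hP : Function.Periodic (fun t => θ t - 2 * Real.pi * t) 1 := fun t => by
      simp only [hper]; ring
    intro t k
    have := hP.int_mul k t
    simp only [mul_one] at this
    linarith
  have hexp : ∀ t, Complex.exp (θ (Int.fract t) * Complex.I) = Complex.exp (θ t * Complex.I) := by
    intro t
    conv_rhs => rw [← Int.fract_add_floor t, hshift]
    push_cast
    rw [add_mul, Complex.exp_add]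
    have : Complex.exp (2 * Real.pi * (⌊t⌋ : ℂ) * Complex.I) = 1 := by
      rw [show (2 * Real.pi * (⌊t⌋ : ℂ) * Complex.I : ℂ) = ⌊t⌋ * (2 * Real.pi * Complex.I) by ring]
      exact Complex.exp_int_mul_two_pi_mul_I _
    rw [this, mul_one]
  have hinjθ : Function.Injective θ := by
    intro s t hst
    have hfr : Int.fract s = Int.fract t := by
      refine hinj ⟨Int.fract_nonneg _, Int.fract_lt_one _⟩
        ⟨Int.fract_nonneg _, Int.fract_lt_one _⟩ ?_
      simp only [hexp, hst]
    have h1 := hshift (Int.fract s) ⌊s⌋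
    have h2 := hshift (Int.fract t) ⌊t⌋
    rw [Int.fract_add_floor] at h1 h2
    rw [hst, h2, hfr] at h1
    have h3 : (⌊t⌋ : ℝ) = ⌊s⌋ := mul_left_cancel₀ Real.two_pi_pos.ne' (by linarith)
    rw [← Int.fract_add_floor s, ← Int.fract_add_floor t, hfr, h3]
  rcases hθ.strictMono_of_inj hinjθ with h | h
  · exact h
  · have h1 := hper 0
    have h2 := h (zero_lt_one (α := ℝ))
    rw [zero_add] at h1
    have := Real.pi_pos
    linarith

/-- The remaining marked points of a normalised representative are in counter-clockwise order on
the unit circle. -/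
lemma exists_ordered_angles {n : MarkedRat d} (hn : n.toModuli ∈ quasiBlaschkeSpace d) {μ : ℂ}
    (hμ : μ ≠ 0) (hG : Good (μ • n.coeff))
    (h0 : n.mark 0 = ((0 : ℂ) : OnePoint ℂ)) (h1 : n.mark 1 = ∞) :
    ∃ s : Fin (d + 1) → ℝ, (∀ i : Fin (d + 1), 2 ≤ (i : ℕ) →
      n.mark i = ((Complex.exp (2 * Real.pi * Complex.I * s i) : ℂ) : OnePoint ℂ)) ∧
      ∀ i j : Fin (d + 1), 2 ≤ (i : ℕ) → i < j → s i < s j ∧ s j < s i + 1 := by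
  obtain ⟨q, ⟨-, n', hn', h0', h1', -, -, L, hL, hper, hinj, hrange, s, hs, hord⟩, hq⟩ := hn
  obtain ⟨g, hg, hmark⟩ := (toModuli_eq_iff _ _).1 (hn'.trans hq)
  have hJ : juliaSet n.map = unitCircle := by
    rw [← hG.juliaSet_eq, toMap_smul hμ]; rfl
  -- The conjugating map g fixes 0 and ∞, so it is multiplication by a constant; it translates the
  -- lift L by the logarithm of that constant.
  have hg10 : g 1 0 = 0 := by
    rw [← OnePoint.smul_infty_eq_self_iff, ← h1', ← hmark, h1, h1']
  have hdet := gl_det_ne_zero g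
  rw [hg10, mul_zero, sub_zero] at hdet
  have hg00 : g 0 0 ≠ 0 := left_ne_zero_of_mul hdet
  have hg11 : g 1 1 ≠ 0 := right_ne_zero_of_mul hdet
  have hg01 : g 0 1 = 0 := by
    have h := hmark 0
    rw [h0, h0', OnePoint.smul_some_eq_ite, hg10] at h
    simpa [hg11] using h.symm
  have hsmul : ∀ z : ℂ, g • (z : OnePoint ℂ) = ((g 0 0 / g 1 1 * z : ℂ) : OnePoint ℂ) := by
    intro z
    rw [OnePoint.smul_some_eq_ite, hg10, hg01, zero_mul, zero_add, if_neg hg11, add_zero,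
      div_mul_eq_mul_div]
  set l := Complex.log (g 0 0 / g 1 1) with hl
  have hexpl : Complex.exp l = g 0 0 / g 1 1 := Complex.exp_log (div_ne_zero hg00 hg11)
  have hsmulexp : ∀ t, g • ((Complex.exp (L t) : ℂ) : OnePoint ℂ) =
      ((Complex.exp (L t + l) : ℂ) : OnePoint ℂ) := fun t => by
    rw [hsmul, Complex.exp_add, hexpl, mul_comm]
  -- The translated lift parametrises the unit circle, so it is purely imaginary and gives a real
  -- angle θ.
  have hre : ∀ t, (L t + l).re = 0 := by
    intro t
    have hmem : ((Complex.exp (L t) : ℂ) : OnePoint ℂ) ∈ juliaSet n'.map := by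
      rw [← hrange]; exact mem_range_self t
    have : g • ((Complex.exp (L t) : ℂ) : OnePoint ℂ) ∈ juliaSet n.map :=
      fun h => hmem ((mem_fatouSet_iff (glHomeo g) hg).1 h)
    rw [hJ, hsmulexp, coe_mem_unitCircle_iff, Complex.norm_exp, Real.exp_eq_one_iff] at this
    exact this
  set θ : ℝ → ℝ := fun t => (L t + l).im with hθ
  have hLθ : ∀ t, L t + l = θ t * Complex.I := fun t => by
    apply Complex.ext <;> simp [hθ, hre t, -Complex.add_re, -Complex.add_im]
  have hmono : StrictMono θ := by
    refine strictMono_of_injOn_exp (Complex.continuous_im.comp (hL.add continuous_const))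
      (fun t => ?_) fun t ht t' ht' h => ?_
    · simp only [hθ, hper, Complex.add_im, Complex.mul_im, Complex.mul_re]
      simp
      ring
    · refine hinj ht ht' ?_
      simp only [← hLθ, Complex.exp_add] at h
      exact mul_right_cancel₀ (Complex.exp_ne_zero _) h
  have hperθ : ∀ t, θ (t + 1) = θ t + 2 * Real.pi := fun t => by
    simp only [hθ, hper, Complex.add_im, Complex.mul_im, Complex.mul_re]
    simp
    ring
  refine ⟨fun i => θ (s i) / (2 * Real.pi), fun i hi => ?_, fun i j hi hij => ?_⟩
  · rw [hmark, hs i hi, hsmulexp, hLθ]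
    have : (Real.pi : ℂ) ≠ 0 := by exact_mod_cast Real.pi_ne_zero
    congr 2
    push_cast
    field_simp
  · obtain ⟨h3, h4⟩ := hord i j hi hij
    have hpi := Real.two_pi_pos
    refine ⟨div_lt_div_of_pos_right (hmono h3) hpi, ?_⟩
    rw [div_lt_iff₀ hpi, add_mul, div_mul_cancel₀ _ hpi.ne', one_mul, ← hperθ]
    exact hmono h4

end Normal


/-! ### The differential of the conjugation action -/

section Orbit

variable {d : ℕ}

/-- Conjugation as a function on a normed space of pairs. -/
def conjMap (p : (Fin 2 → Fin 2 → ℂ) × Coeff d) : Coeff d := conjCoeff (Matrix.of p.1) p.2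

section PolySmooth

variable {E : Type*} [NormedAddCommGroup E] [NormedSpace ℂ E] {n : WithTop ℕ∞}

lemma contDiff_coeff_mul {P Q : E → ℂ[X]} (hP : ∀ k, ContDiff ℂ n fun x => (P x).coeff k)
    (hQ : ∀ k, ContDiff ℂ n fun x => (Q x).coeff k) (k : ℕ) :
    ContDiff ℂ n fun x => (P x * Q x).coeff k := by
  simp only [coeff_mul]
  exact ContDiff.sum fun i _ => (hP _).mul (hQ _)

lemma contDiff_coeff_pow {P : E → ℂ[X]} (hP : ∀ k, ContDiff ℂ n fun x => (P x).coeff k)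
    (m k : ℕ) : ContDiff ℂ n fun x => (P x ^ m).coeff k := by
  induction m generalizing k with
  | zero => simp only [pow_zero]; exact contDiff_const
  | succ m ih =>
    simp only [pow_succ]
    exact contDiff_coeff_mul ih hP k

lemma contDiff_coeff_C {a : E → ℂ} (ha : ContDiff ℂ n a) (k : ℕ) :
    ContDiff ℂ n fun x => (C (a x)).coeff k := by
  simp only [coeff_C]
  split_ifs
  · exact ha
  · exact contDiff_const

lemma contDiff_coeff_C_mul_X {a : E → ℂ} (ha : ContDiff ℂ n a) (k : ℕ) :
    ContDiff ℂ n fun x => (C (a x) * X).coeff k :=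
  contDiff_coeff_mul (contDiff_coeff_C ha) (fun _ => contDiff_const) k

lemma contDiff_coeff_sub {P Q : E → ℂ[X]} (hP : ∀ k, ContDiff ℂ n fun x => (P x).coeff k)
    (hQ : ∀ k, ContDiff ℂ n fun x => (Q x).coeff k) (k : ℕ) :
    ContDiff ℂ n fun x => (P x - Q x).coeff k := by
  simp only [coeff_sub]
  exact (hP k).sub (hQ k)

lemma contDiff_coeff_substAdj {g : E → Fin 2 → Fin 2 → ℂ} {a : E → Fin (d + 1) → ℂ}
    (hg : ContDiff ℂ n g) (ha : ContDiff ℂ n a) (k : ℕ) :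
    ContDiff ℂ n fun x => (substAdj (Matrix.of (g x)) (a x)).coeff k := by
  have hg' : ∀ i j, ContDiff ℂ n fun x => g x i j := fun i j =>
    contDiff_pi.1 (contDiff_pi.1 hg i) j
  simp only [substAdj, finsetSum_coeff, Matrix.of_apply]
  refine ContDiff.sum fun j _ => contDiff_coeff_mul (contDiff_coeff_mul
    (contDiff_coeff_C (contDiff_pi.1 ha j)) ?_) ?_ k
  · exact contDiff_coeff_pow (contDiff_coeff_sub (contDiff_coeff_C_mul_X (hg' 1 1))
      (contDiff_coeff_C (hg' 0 1))) _
  · exact contDiff_coeff_pow (contDiff_coeff_sub (contDiff_coeff_C (hg' 0 0))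
      (contDiff_coeff_C_mul_X (hg' 1 0))) _

end PolySmooth

lemma contDiff_conjMap {n : WithTop ℕ∞} : ContDiff ℂ n (conjMap (d := d)) := by
  have hg : ∀ i j, ContDiff ℂ n fun x : (Fin 2 → Fin 2 → ℂ) × Coeff d => x.1 i j := fun i j =>
    contDiff_pi.1 (contDiff_pi.1 contDiff_fst i) j
  refine ContDiff.prodMk (contDiff_pi.2 fun k => ?_) (contDiff_pi.2 fun k => ?_)
  all_goals
    refine ContDiff.add (ContDiff.mul (hg _ _) ?_) (ContDiff.mul (hg _ _) ?_)
    · exact contDiff_coeff_substAdj contDiff_fst (contDiff_fst.comp contDiff_snd) k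
    · exact contDiff_coeff_substAdj contDiff_fst (contDiff_snd.comp contDiff_snd) k

/-- The infinitesimal action of a matrix. -/
def infAction (F : Coeff d) (ξ : Matrix (Fin 2) (Fin 2) ℂ) : Coeff d :=
  deriv (fun s : ℂ => conjCoeff (1 + s • ξ) F) 0

/-- The identity matrix as a family of numbers. -/
def idFam : Fin 2 → Fin 2 → ℂ := Matrix.of.symm 1

lemma hasFDerivAt_conjMap (F : Coeff d) :
    HasFDerivAt conjMap (fderiv ℂ conjMap (idFam, F)) (idFam, F) :=
  ((contDiff_conjMap (n := 1)).differentiable one_ne_zero _).hasFDerivAt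

lemma hasDerivAt_infAction (F : Coeff d) (ξ : Matrix (Fin 2) (Fin 2) ℂ) :
    HasDerivAt (fun s : ℂ => conjCoeff (1 + s • ξ) F)
      (fderiv ℂ conjMap (idFam, F) (Matrix.of.symm ξ, 0)) 0 := by
  have hpath : HasDerivAt (fun s : ℂ => ((idFam + s • Matrix.of.symm ξ, F) :
      (Fin 2 → Fin 2 → ℂ) × Coeff d)) (Matrix.of.symm ξ, 0) 0 := by
    refine HasDerivAt.prodMk ?_ (hasDerivAt_const _ _)
    simpa using ((hasDerivAt_id (0 : ℂ)).smul_const (Matrix.of.symm ξ)).const_add idFam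
  have h := hasFDerivAt_conjMap F
  have e : ((idFam, F) : (Fin 2 → Fin 2 → ℂ) × Coeff d) =
      (idFam + (0 : ℂ) • Matrix.of.symm ξ, F) := by simp
  rw [e] at h
  have := HasFDerivAt.comp_hasDerivAt (0 : ℂ) h hpath
  rw [← e] at this
  exact this

lemma infAction_eq (F : Coeff d) (ξ : Matrix (Fin 2) (Fin 2) ℂ) :
    infAction F ξ = fderiv ℂ conjMap (idFam, F) (Matrix.of.symm ξ, 0) :=
  (hasDerivAt_infAction F ξ).deriv

lemma hasDerivAt_conjCoeff_one_add (F : Coeff d) (ξ : Matrix (Fin 2) (Fin 2) ℂ) :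
    HasDerivAt (fun s : ℂ => conjCoeff (1 + s • ξ) F) (infAction F ξ) 0 := by
  rw [infAction_eq]; exact hasDerivAt_infAction F ξ

lemma infAction_add (F : Coeff d) (ξ η : Matrix (Fin 2) (Fin 2) ℂ) :
    infAction F (ξ + η) = infAction F ξ + infAction F η := by
  rw [infAction_eq, infAction_eq, infAction_eq, ← map_add]
  congr 1
  exact Prod.ext rfl (by simp)

lemma infAction_smul (F : Coeff d) (c : ℂ) (ξ : Matrix (Fin 2) (Fin 2) ℂ) :
    infAction F (c • ξ) = c • infAction F ξ := by
  rw [infAction_eq, infAction_eq, ← map_smul]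
  congr 1
  exact Prod.ext rfl (by simp)

/-- The infinitesimal action as a linear map. -/
def infActionLin (F : Coeff d) : Matrix (Fin 2) (Fin 2) ℂ →ₗ[ℂ] Coeff d where
  toFun := infAction F
  map_add' := infAction_add F
  map_smul' := infAction_smul F

/-- The derivative is linear in ξ because the action is differentiable jointly, so the span in the
definition is already a range. -/
lemma mem_orbitTangent_iff {F v : Coeff d} :
    v ∈ orbitTangent F ↔ ∃ ξ, infAction F ξ = v := by
  have : orbitTangent F = LinearMap.range (infActionLin F) := by
    refine le_antisymm (Submodule.span_le.2 ?_) ?_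
    · rintro _ ⟨ξ, rfl⟩
      exact ⟨ξ, rfl⟩
    · rintro _ ⟨ξ, rfl⟩
      exact Submodule.subset_span ⟨ξ, rfl⟩
  rw [this]; rfl

/-- The product rule for a moving map conjugated by a moving matrix. -/
lemma hasDerivAt_conjCoeff {g : ℝ → Fin 2 → Fin 2 → ℂ} {c : ℝ → Coeff d}
    {ξ : Fin 2 → Fin 2 → ℂ} {v : Coeff d} (hg : HasDerivAt g ξ 0) (hg0 : g 0 = idFam)
    (hc : HasDerivAt c v 0) : HasDerivAt (fun t => conjCoeff (Matrix.of (g t)) (c t))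
      (infAction (c 0) (Matrix.of ξ) + v) 0 := by
  have h := (hasFDerivAt_conjMap (c 0)).restrictScalars ℝ
  rw [← hg0] at h
  have h2 := h.comp_hasDerivAt (0 : ℝ) (hg.prodMk hc)
  rw [hg0] at h2
  have e : (fderiv ℂ conjMap (idFam, c 0)) (ξ, v) = infAction (c 0) (Matrix.of ξ) + v := by
    have e1 : ((ξ, v) : (Fin 2 → Fin 2 → ℂ) × Coeff d) = (ξ, 0) + (0, v) := by simp
    -- Conjugation by the identity is the identity of coefficients, so the partial derivative in the
    -- coefficients is the identity.
    have e2 : (fderiv ℂ conjMap (idFam, c 0)) (0, v) = v := by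
      have hp : HasDerivAt (fun s : ℂ => ((idFam, c 0 + s • v) :
          (Fin 2 → Fin 2 → ℂ) × Coeff d)) (0, v) 0 := by
        refine HasDerivAt.prodMk (hasDerivAt_const _ _) ?_
        simpa using ((hasDerivAt_id (0 : ℂ)).smul_const v).const_add (c 0)
      have h3 := hasFDerivAt_conjMap (c 0)
      have e3 : ((idFam, c 0) : (Fin 2 → Fin 2 → ℂ) × Coeff d) = (idFam, c 0 + (0 : ℂ) • v) := by
        simp
      rw [e3] at h3
      have h4 := HasFDerivAt.comp_hasDerivAt (0 : ℂ) h3 hp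
      rw [← e3] at h4
      have h5 : HasDerivAt (fun s : ℂ => c 0 + s • v) v 0 := by
        simpa using ((hasDerivAt_id (0 : ℂ)).smul_const v).const_add (c 0)
      have h6 : conjMap ∘ (fun s : ℂ => ((idFam, c 0 + s • v) :
          (Fin 2 → Fin 2 → ℂ) × Coeff d)) = fun s => c 0 + s • v :=
        funext fun s => conjCoeff_one _
      rw [h6] at h4
      exact h4.unique h5
    rw [e1, map_add, e2, infAction_eq]
    rfl
  rw [← e]
  exact h2

/-- One factor c comes from acting on values and cᵈ from the adjugate substituted into forms of
degree d. -/
lemma conjCoeff_smul_one (c : ℂ) (F : Coeff d) :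
    conjCoeff (c • (1 : Matrix (Fin 2) (Fin 2) ℂ)) F = c ^ (d + 1) • F := by
  refine coeff_ext (fun u => ?_) fun u => ?_
  · rw [hom_conjCoeff_fst, Prod.smul_fst, hom_smul]
    simp only [Matrix.smul_apply, Matrix.one_apply_eq, smul_eq_mul, mul_one,
      Matrix.one_apply_ne (show (0 : Fin 2) ≠ 1 by decide),
      Matrix.one_apply_ne (show (1 : Fin 2) ≠ 0 by decide), mul_zero, zero_mul, add_zero, sub_zero]
    have := hom_mul_mul F.1 c u 1
    rw [mul_one] at this
    rw [this, pow_succ']; ring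
  · rw [hom_conjCoeff_snd, Prod.smul_snd, hom_smul]
    simp only [Matrix.smul_apply, Matrix.one_apply_eq, smul_eq_mul, mul_one,
      Matrix.one_apply_ne (show (0 : Fin 2) ≠ 1 by decide),
      Matrix.one_apply_ne (show (1 : Fin 2) ≠ 0 by decide), mul_zero, zero_mul, zero_add, sub_zero]
    have := hom_mul_mul F.2 c u 1
    rw [mul_one] at this
    rw [this, pow_succ']; ring

lemma infAction_one (F : Coeff d) : infAction F 1 = ((d : ℂ) + 1) • F := by
  have h1 := hasDerivAt_conjCoeff_one_add F 1
  have e : (fun s : ℂ => conjCoeff (1 + s • (1 : Matrix (Fin 2) (Fin 2) ℂ)) F) =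
      fun s => (1 + s) ^ (d + 1) • F := by
    ext1 s
    rw [← conjCoeff_smul_one, add_smul, one_smul]
  rw [e] at h1
  have h2 : HasDerivAt (fun s : ℂ => (1 + s) ^ (d + 1)) ((d : ℂ) + 1) 0 := by
    simpa using ((hasDerivAt_id (0 : ℂ)).const_add 1).fun_pow (d + 1)
  exact h1.unique (h2.smul_const F)

/-- Rescaling coordinates is infinitesimally a conjugation by scalar matrices, so dividing by the
orbit tangent also removes the projective ambiguity. -/
lemma smul_mem_orbitTangent (F : Coeff d) (c : ℂ) : c • F ∈ orbitTangent F := by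
  have hd : (d : ℂ) + 1 ≠ 0 := by exact_mod_cast Nat.succ_ne_zero d
  refine mem_orbitTangent_iff.2 ⟨(c / ((d : ℂ) + 1)) • 1, ?_⟩
  rw [infAction_smul, infAction_one, smul_smul, div_mul_cancel₀ _ hd]

/-- Conjugation by g turns the family 1 + sξ into 1 + s gξg⁻¹; differentiate at s = 0. -/
lemma conjCoeff_infAction (g : GL (Fin 2) ℂ) (F : Coeff d) (ξ : Matrix (Fin 2) (Fin 2) ℂ) :
    conjCoeff g (infAction F ξ) =
      infAction (conjCoeff g F) ((g : Matrix (Fin 2) (Fin 2) ℂ) * ξ * (g⁻¹ : GL (Fin 2) ℂ)) := by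
  have h1 := hasDerivAt_conjCoeff_one_add F ξ
  set L : Coeff d →L[ℂ] Coeff d := LinearMap.toContinuousLinearMap
    (conjLin (g : Matrix (Fin 2) (Fin 2) ℂ)) with hL
  have h2 := L.hasFDerivAt.comp_hasDerivAt (0 : ℂ) h1
  have h3 := hasDerivAt_conjCoeff_one_add (conjCoeff (g : Matrix (Fin 2) (Fin 2) ℂ) F)
    ((g : Matrix (Fin 2) (Fin 2) ℂ) * ξ * (g⁻¹ : GL (Fin 2) ℂ))
  have hgg : (g : Matrix (Fin 2) (Fin 2) ℂ) * (g⁻¹ : GL (Fin 2) ℂ) = 1 := by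
    rw [← Units.val_mul, mul_inv_cancel, Units.val_one]
  have hgg' : ((g⁻¹ : GL (Fin 2) ℂ) : Matrix (Fin 2) (Fin 2) ℂ) * g = 1 := by
    rw [← Units.val_mul, inv_mul_cancel, Units.val_one]
  have e : (L ∘ fun s : ℂ => conjCoeff (1 + s • ξ) F) = fun s : ℂ => conjCoeff
      (1 + s • ((g : Matrix (Fin 2) (Fin 2) ℂ) * ξ * (g⁻¹ : GL (Fin 2) ℂ)))
      (conjCoeff (g : Matrix (Fin 2) (Fin 2) ℂ) F) := by
    ext1 s
    change conjCoeff _ _ = _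
    rw [← conjCoeff_mul, ← conjCoeff_mul]
    congr 1
    rw [add_mul, one_mul, smul_mul_assoc, mul_assoc _ _ (g : Matrix (Fin 2) (Fin 2) ℂ), hgg', mul_one, mul_add, mul_one,
      mul_smul_comm]
  rw [e] at h2
  exact h2.unique h3

lemma conjCoeff_mem_orbitTangent (g : GL (Fin 2) ℂ) {F v : Coeff d} (hv : v ∈ orbitTangent F) :
    conjCoeff g v ∈ orbitTangent (conjCoeff (g : Matrix (Fin 2) (Fin 2) ℂ) F) := by
  obtain ⟨ξ, rfl⟩ := mem_orbitTangent_iff.1 hv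
  rw [conjCoeff_infAction]
  exact mem_orbitTangent_iff.2 ⟨_, rfl⟩

lemma conjCoeff_inv_conjCoeff (g : GL (Fin 2) ℂ) (F : Coeff d) :
    conjCoeff (g⁻¹ : GL (Fin 2) ℂ) (conjCoeff (g : Matrix (Fin 2) (Fin 2) ℂ) F) = F := by
  rw [← conjCoeff_mul, ← Units.val_mul, inv_mul_cancel, Units.val_one, conjCoeff_one]

lemma conjCoeff_conjCoeff_inv (g : GL (Fin 2) ℂ) (F : Coeff d) :
    conjCoeff g (conjCoeff ((g⁻¹ : GL (Fin 2) ℂ) : Matrix (Fin 2) (Fin 2) ℂ) F) = F := by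
  rw [← conjCoeff_mul, ← Units.val_mul, mul_inv_cancel, Units.val_one, conjCoeff_one]

/-! ### The displacement of the fixed points `0`, `∞` and `1` -/

/-- The partial derivative of a form in the first variable. -/
def homU (a : Fin (d + 1) → ℂ) (u v : ℂ) : ℂ :=
  ∑ j : Fin (d + 1), a j * ((j : ℕ) * u ^ ((j : ℕ) - 1)) * v ^ (d - (j : ℕ))

/-- The partial derivative of a form in the second variable. -/
def homV (a : Fin (d + 1) → ℂ) (u v : ℂ) : ℂ :=
  ∑ j : Fin (d + 1), a j * u ^ (j : ℕ) * ((d - (j : ℕ) : ℕ) * v ^ (d - (j : ℕ) - 1))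

lemma hasDerivAt_hom (a : Fin (d + 1) → ℂ) {α β : ℂ → ℂ} {α' β' s : ℂ} (hα : HasDerivAt α α' s)
    (hβ : HasDerivAt β β' s) : HasDerivAt (fun s => hom a (α s) (β s))
      (homU a (α s) (β s) * α' + homV a (α s) (β s) * β') s := by
  have : ∀ j ∈ Finset.univ, HasDerivAt (fun s => a j * α s ^ (j : ℕ) * β s ^ (d - (j : ℕ)))
      (a j * ((j : ℕ) * α s ^ ((j : ℕ) - 1) * α') * β s ^ (d - (j : ℕ)) +
        a j * α s ^ (j : ℕ) * ((d - (j : ℕ) : ℕ) * β s ^ (d - (j : ℕ) - 1) * β')) s :=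
    fun j _ => ((hα.fun_pow _).const_mul (a j)).fun_mul (hβ.fun_pow _)
  have e : homU a (α s) (β s) * α' + homV a (α s) (β s) * β' = ∑ j : Fin (d + 1),
      (a j * ((j : ℕ) * α s ^ ((j : ℕ) - 1) * α') * β s ^ (d - (j : ℕ)) +
        a j * α s ^ (j : ℕ) * ((d - (j : ℕ) : ℕ) * β s ^ (d - (j : ℕ) - 1) * β')) := by
    unfold homU homV
    rw [Finset.sum_mul, Finset.sum_mul, ← Finset.sum_add_distrib]
    refine Finset.sum_congr rfl fun j _ => ?_
    ring
  rw [e]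
  exact HasDerivAt.fun_sum this

lemma euler_hom (a : Fin (d + 1) → ℂ) (u v : ℂ) :
    homU a u v * u + homV a u v * v = d * hom a u v := by
  have h1 : HasDerivAt (fun s : ℂ => hom a (s * u) (s * v))
      (homU a u v * u + homV a u v * v) 1 := by
    simpa using hasDerivAt_hom a (s := 1) ((hasDerivAt_id (1 : ℂ)).mul_const u)
      ((hasDerivAt_id (1 : ℂ)).mul_const v)
  have h2 : HasDerivAt (fun s : ℂ => hom a (s * u) (s * v)) (d * hom a u v) 1 := by
    simp only [hom_mul_mul]
    simpa using ((hasDerivAt_id (1 : ℂ)).pow d).mul_const (hom a u v)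
  exact h1.unique h2

lemma homU_one (a : Fin (d + 1) → ℂ) (z : ℂ) :
    homU a z 1 = (derivative (toPoly a)).eval z := by
  have h1 : HasDerivAt (fun s : ℂ => hom a s 1) (homU a z 1) z := by
    simpa using hasDerivAt_hom a (s := z) (hasDerivAt_id z) (hasDerivAt_const z 1)
  simp only [hom_one] at h1
  exact h1.unique ((toPoly a).hasDerivAt z)

lemma homV_starForm (a : Fin (d + 1) → ℂ) (u v : ℂ) :
    homV (starForm a) u v = starRingEnd ℂ (homU a (starRingEnd ℂ v) (starRingEnd ℂ u)) := by
  unfold homV homU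
  rw [map_sum, ← Equiv.sum_comp Fin.revPerm]
  refine Finset.sum_congr rfl fun j _ => ?_
  have hj := j.2
  have e1 : ((Fin.revPerm j : Fin (d + 1)) : ℕ) = d - j := by simp [Fin.val_rev]
  have e2 : d - (d - (j : ℕ)) = j := by omega
  rw [e1, e2]
  simp [starForm, mul_right_comm]

/-- Coefficients of a map with simple fixed points `0`, `∞` and `1`. -/
structure SimpleNormal (F : Coeff d) : Prop where
  zero : F.1 0 = 0
  infty : F.2 (Fin.last d) = 0
  one : hom F.1 1 1 = hom F.2 1 1
  simple_zero : hom F.2 0 1 - homU F.1 0 1 ≠ 0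
  simple_infty : hom F.1 1 0 - homV F.2 1 0 ≠ 0
  simple_one : hom F.2 1 1 + homU F.2 1 1 - homU F.1 1 1 ≠ 0

lemma linear_infAction (F : Coeff d) (ξ : Matrix (Fin 2) (Fin 2) ℂ) (l : Coeff d →ₗ[ℂ] ℂ) :
    HasDerivAt (fun s : ℂ => l (conjCoeff (1 + s • ξ) F)) (l (infAction F ξ)) 0 :=
  (LinearMap.toContinuousLinearMap l).hasFDerivAt.comp_hasDerivAt (0 : ℂ)
    (hasDerivAt_conjCoeff_one_add F ξ)

lemma hasDerivAt_one_add_smul_apply (ξ : Matrix (Fin 2) (Fin 2) ℂ) (i j : Fin 2) :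
    HasDerivAt (fun s : ℂ => (1 + s • ξ) i j) (ξ i j) 0 := by
  simpa using ((hasDerivAt_id (0 : ℂ)).mul_const (ξ i j)).const_add
    ((1 : Matrix (Fin 2) (Fin 2) ℂ) i j)

/-- The value of a form at a point, as a linear function. -/
def homLin (u v : ℂ) : (Fin (d + 1) → ℂ) →ₗ[ℂ] ℂ where
  toFun a := hom a u v
  map_add' a b := hom_add a b u v
  map_smul' c a := hom_smul c a u v

lemma hasDerivAt_hom_infAction (ξ : Matrix (Fin 2) (Fin 2) ℂ) (u v : ℂ)
    (a : Fin (d + 1) → ℂ) :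
    HasDerivAt (fun s : ℂ => hom a ((1 + s • ξ) 1 1 * u - (1 + s • ξ) 0 1 * v)
      ((1 + s • ξ) 0 0 * v - (1 + s • ξ) 1 0 * u))
      (homU a u v * (ξ 1 1 * u - ξ 0 1 * v) + homV a u v * (ξ 0 0 * v - ξ 1 0 * u)) 0 := by
  have h := hasDerivAt_one_add_smul_apply ξ
  simpa using hasDerivAt_hom a (((h 1 1).mul_const u).fun_sub ((h 0 1).mul_const v))
    (((h 0 0).mul_const v).fun_sub ((h 1 0).mul_const u))

lemma hom_infAction_fst (F : Coeff d) (ξ : Matrix (Fin 2) (Fin 2) ℂ) (u v : ℂ) :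
    hom (infAction F ξ).1 u v = ξ 0 0 * hom F.1 u v + ξ 0 1 * hom F.2 u v +
      (homU F.1 u v * (ξ 1 1 * u - ξ 0 1 * v) + homV F.1 u v * (ξ 0 0 * v - ξ 1 0 * u)) := by
  have h := linear_infAction F ξ ((homLin u v).comp (LinearMap.fst ℂ _ _))
  change HasDerivAt (fun s : ℂ => hom (conjCoeff (1 + s • ξ) F).1 u v)
    (hom (infAction F ξ).1 u v) 0 at h
  simp only [hom_conjCoeff_fst] at h
  have e := hasDerivAt_one_add_smul_apply ξ
  have h2 := ((e 0 0).fun_mul (hasDerivAt_hom_infAction ξ u v F.1)).fun_add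
    ((e 0 1).fun_mul (hasDerivAt_hom_infAction ξ u v F.2))
  have := h.unique h2
  rw [this]
  simp
  ring

lemma hom_infAction_snd (F : Coeff d) (ξ : Matrix (Fin 2) (Fin 2) ℂ) (u v : ℂ) :
    hom (infAction F ξ).2 u v = ξ 1 0 * hom F.1 u v + ξ 1 1 * hom F.2 u v +
      (homU F.2 u v * (ξ 1 1 * u - ξ 0 1 * v) + homV F.2 u v * (ξ 0 0 * v - ξ 1 0 * u)) := by
  have h := linear_infAction F ξ ((homLin u v).comp (LinearMap.snd ℂ _ _))
  change HasDerivAt (fun s : ℂ => hom (conjCoeff (1 + s • ξ) F).2 u v)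
    (hom (infAction F ξ).2 u v) 0 at h
  simp only [hom_conjCoeff_snd] at h
  have e := hasDerivAt_one_add_smul_apply ξ
  have h2 := ((e 1 0).fun_mul (hasDerivAt_hom_infAction ξ u v F.1)).fun_add
    ((e 1 1).fun_mul (hasDerivAt_hom_infAction ξ u v F.2))
  have := h.unique h2
  rw [this]
  simp
  ring

/-- Coefficients of the maps that fix `0`, `∞` and `1`. -/
def normalSpace (d : ℕ) : Submodule ℂ (Coeff d) where
  carrier := {F | F.1 0 = 0 ∧ F.2 (Fin.last d) = 0 ∧ hom F.1 1 1 = hom F.2 1 1}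
  add_mem' := by
    rintro F G ⟨h1, h2, h3⟩ ⟨h1', h2', h3'⟩
    refine ⟨by simp [h1, h1'], by simp [h2, h2'], ?_⟩
    rw [Prod.fst_add, Prod.snd_add, hom_add, hom_add, h3, h3']
  zero_mem' := by simp [hom]
  smul_mem' := by
    rintro c F ⟨h1, h2, h3⟩
    refine ⟨by simp [h1], by simp [h2], ?_⟩
    rw [Prod.smul_fst, Prod.smul_snd, hom_smul, hom_smul, h3]

lemma refl_mem_normalSpace {F : Coeff d} (hF : F ∈ normalSpace d) : refl F ∈ normalSpace d := by
  obtain ⟨h1, h2, h3⟩ := hF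
  refine ⟨?_, ?_, ?_⟩
  · simp [refl_fst, starForm, h2]
  · simp [refl_snd, starForm, h1]
  · rw [refl_fst, refl_snd, hom_starForm, hom_starForm, map_one, h3]

namespace SimpleNormal

variable {F : Coeff d} (hF : SimpleNormal F)
include hF

/-- An infinitesimal Möbius map displaces the fixed point 0 only through ξ₀₁; the remaining factor
is F.2 0 times one minus the multiplier at 0. The next two lemmas treat ∞ and 1 likewise. -/
lemma infAction_zero (ξ : Matrix (Fin 2) (Fin 2) ℂ) :
    (infAction F ξ).1 0 = ξ 0 1 * (hom F.2 0 1 - homU F.1 0 1) := by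
  have h := hom_infAction_fst F ξ 0 1
  have e := euler_hom F.1 0 1
  have h0 : hom F.1 0 1 = 0 := by rw [hom_zero_left, hF.zero, zero_mul]
  rw [hom_zero_left, one_pow, mul_one] at h
  rw [h0] at h e
  rw [h]
  linear_combination ξ 0 0 * e

lemma infAction_infty (ξ : Matrix (Fin 2) (Fin 2) ℂ) :
    (infAction F ξ).2 (Fin.last d) = ξ 1 0 * (hom F.1 1 0 - homV F.2 1 0) := by
  have h := hom_infAction_snd F ξ 1 0
  have e := euler_hom F.2 1 0
  have h0 : hom F.2 1 0 = 0 := by rw [hom_zero_right, hF.infty, zero_mul]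
  rw [hom_zero_right, one_pow, mul_one] at h
  rw [h0] at h e
  rw [h]
  linear_combination ξ 1 1 * e

lemma infAction_one_one (ξ : Matrix (Fin 2) (Fin 2) ℂ) :
    hom (infAction F ξ).2 1 1 - hom (infAction F ξ).1 1 1 =
      (ξ 1 1 - ξ 0 1 - ξ 0 0 + ξ 1 0) * (hom F.2 1 1 + homU F.2 1 1 - homU F.1 1 1) := by
  rw [hom_infAction_fst, hom_infAction_snd]
  have e1 := euler_hom F.1 1 1
  have e2 := euler_hom F.2 1 1
  have h := hF.one
  rw [h] at e1 ⊢
  linear_combination (ξ 0 0 - ξ 1 0) * e2 - (ξ 0 0 - ξ 1 0) * e1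

lemma exists_sub_mem_normalSpace (v : Coeff d) :
    ∃ x ∈ orbitTangent F, v - x ∈ normalSpace d := by
  -- Solve successively for the displacements of 0, ∞ and 1, dividing by the simplicity constants.
  -- The upper left entry may be 0, since adding a scalar matrix moves no point.
  set r01 := v.1 0 / (hom F.2 0 1 - homU F.1 0 1) with h01
  set r10 := v.2 (Fin.last d) / (hom F.1 1 0 - homV F.2 1 0) with h10
  set r11 := (hom v.2 1 1 - hom v.1 1 1) / (hom F.2 1 1 + homU F.2 1 1 - homU F.1 1 1) +
    r01 - r10 with h11
  refine ⟨_, mem_orbitTangent_iff.2 ⟨!![0, r01; r10, r11], rfl⟩, ?_, ?_, ?_⟩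
  · rw [Prod.fst_sub, Pi.sub_apply, hF.infAction_zero]
    simp [h01, div_mul_cancel₀ _ hF.simple_zero]
  · rw [Prod.snd_sub, Pi.sub_apply, hF.infAction_infty]
    simp [h10, div_mul_cancel₀ _ hF.simple_infty]
  · have h := hF.infAction_one_one !![0, r01; r10, r11]
    have e : ∀ a b : Fin (d + 1) → ℂ, hom (a - b) 1 1 = hom a 1 1 - hom b 1 1 := fun a b =>
      (homLin (1 : ℂ) 1).map_sub a b
    have h2 : ((!![0, r01; r10, r11] : Matrix (Fin 2) (Fin 2) ℂ) 1 1 -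
        (!![0, r01; r10, r11] : Matrix (Fin 2) (Fin 2) ℂ) 0 1 -
        (!![0, r01; r10, r11] : Matrix (Fin 2) (Fin 2) ℂ) 0 0 +
        (!![0, r01; r10, r11] : Matrix (Fin 2) (Fin 2) ℂ) 1 0) =
        (hom v.2 1 1 - hom v.1 1 1) / (hom F.2 1 1 + homU F.2 1 1 - homU F.1 1 1) := by
      simp [h11]
      ring
    rw [h2, div_mul_cancel₀ _ hF.simple_one] at h
    rw [Prod.fst_sub, Prod.snd_sub, e, e]
    linear_combination h

/-- An infinitesimal Möbius map that does not displace three points is trivial: ξ is scalar and only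
rescales F. -/
lemma eq_smul_of_mem {v : Coeff d} (hv : v ∈ orbitTangent F) (hN : v ∈ normalSpace d) :
    ∃ c : ℂ, v = c • F := by
  obtain ⟨ξ, rfl⟩ := mem_orbitTangent_iff.1 hv
  obtain ⟨h1, h2, h3⟩ := hN
  rw [hF.infAction_zero] at h1
  rw [hF.infAction_infty] at h2
  have h01 := (mul_eq_zero.1 h1).resolve_right hF.simple_zero
  have h10 := (mul_eq_zero.1 h2).resolve_right hF.simple_infty
  have h4 := hF.infAction_one_one ξ
  rw [h3, sub_self, h01, h10] at h4
  have h11 := (mul_eq_zero.1 h4.symm).resolve_right hF.simple_one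
  have : ξ = ξ 0 0 • (1 : Matrix (Fin 2) (Fin 2) ℂ) := by
    ext i j
    fin_cases i <;> fin_cases j
    · simp
    · simpa using h01
    · simpa using h10
    · simp; linear_combination h11
  rw [this, infAction_smul, infAction_one, smul_smul]
  exact ⟨_, rfl⟩

end SimpleNormal

end Orbit


/-! ### Branches of fixed points -/

section Branch

lemma exists_root_branch {E : Type*} [NormedAddCommGroup E] [NormedSpace ℂ E] [CompleteSpace E]
    {Φ : E × ℂ → ℂ} {x : E} {z κ : ℂ} (hΦ : ContDiffAt ℂ 1 Φ (x, z)) (h0 : Φ (x, z) = 0)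
    (hd : HasDerivAt (fun s => Φ (x, s)) κ z) (hκ : κ ≠ 0) :
    ∃ ψ : E → ℂ, ψ x = z ∧ ContDiffAt ℂ 1 ψ x ∧ ∀ᶠ p in 𝓝 (x, z), Φ p = 0 ↔ ψ p.1 = p.2 := by
  have hinv : (fderiv ℂ Φ (x, z) ∘L .inr ℂ E ℂ).IsInvertible := by
    refine ⟨ContinuousLinearEquiv.unitsEquivAut ℂ (Units.mk0 κ hκ), ?_⟩
    have h1 := (hΦ.differentiableAt one_ne_zero).hasFDerivAt.comp_hasDerivAt z
      ((hasDerivAt_const z x).prodMk (hasDerivAt_id z))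
    have h2 := h1.unique hd
    ext1
    simp only [ContinuousLinearEquiv.coe_coe, ContinuousLinearEquiv.unitsEquivAut_apply,
      Units.val_mk0, one_mul]
    exact h2.symm
  refine ⟨hΦ.implicitFunction one_ne_zero hinv, hΦ.implicitFunction_apply_self one_ne_zero hinv,
    hΦ.contDiffAt_implicitFunction one_ne_zero hinv, ?_⟩
  have h := hΦ.eventually_apply_eq_iff_implicitFunction one_ne_zero hinv
  rwa [h0] at h

variable {d : ℕ}

lemma contDiff_hom {E : Type*} [NormedAddCommGroup E] [NormedSpace ℂ E] {n : WithTop ℕ∞}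
    {a : E → Fin (d + 1) → ℂ} {u v : E → ℂ} (ha : ContDiff ℂ n a) (hu : ContDiff ℂ n u)
    (hv : ContDiff ℂ n v) : ContDiff ℂ n fun x => hom (a x) (u x) (v x) :=
  ContDiff.sum fun j _ => ((contDiff_pi.1 ha j).mul (hu.pow _)).mul (hv.pow _)

/-- The form of degree `d + 1` whose zeros are the fixed points. -/
def fixForm (F : Coeff d) (u v : ℂ) : ℂ := u * hom F.2 u v - v * hom F.1 u v

/-- The implicit function theorem for the fixed-point form in an affine chart, serving finite points
and ∞ alike. The last clause is local uniqueness: it identifies a continuously moving mark with the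
differentiable branch. -/
lemma exists_fixed_branch {F : Coeff d} {u₀ u₁ v₀ v₁ z κ : ℂ}
    (hne : ∀ s : ℂ, u₀ + u₁ * s ≠ 0 ∨ v₀ + v₁ * s ≠ 0)
    (hnhds : 𝓝 (pt (u₀ + u₁ * z) (v₀ + v₁ * z)) =
      Filter.map (fun s => pt (u₀ + u₁ * s) (v₀ + v₁ * s)) (𝓝 z))
    (h0 : fixForm F (u₀ + u₁ * z) (v₀ + v₁ * z) = 0)
    (hd : HasDerivAt (fun s => fixForm F (u₀ + u₁ * s) (v₀ + v₁ * s)) κ z) (hκ : κ ≠ 0) :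
    ∃ ψ : Coeff d → ℂ, ψ F = z ∧ ContDiffAt ℂ 1 ψ F ∧
      (∀ᶠ G in 𝓝 F, NonDeg G →
        toMap G (pt (u₀ + u₁ * ψ G) (v₀ + v₁ * ψ G)) = pt (u₀ + u₁ * ψ G) (v₀ + v₁ * ψ G)) ∧
      ∀ᶠ x in 𝓝 F ×ˢ 𝓝 (pt (u₀ + u₁ * z) (v₀ + v₁ * z)), NonDeg x.1 → toMap x.1 x.2 = x.2 →
        x.2 = pt (u₀ + u₁ * ψ x.1) (v₀ + v₁ * ψ x.1) := by
  have hΦ : ContDiff ℂ 1 fun p : Coeff d × ℂ => fixForm p.1 (u₀ + u₁ * p.2) (v₀ + v₁ * p.2) := by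
    have hu : ContDiff ℂ 1 fun p : Coeff d × ℂ => u₀ + u₁ * p.2 :=
      contDiff_const.add (contDiff_const.mul contDiff_snd)
    have hv : ContDiff ℂ 1 fun p : Coeff d × ℂ => v₀ + v₁ * p.2 :=
      contDiff_const.add (contDiff_const.mul contDiff_snd)
    exact (hu.mul (contDiff_hom (contDiff_snd.comp contDiff_fst) hu hv)).sub
      (hv.mul (contDiff_hom (contDiff_fst.comp contDiff_fst) hu hv))
  obtain ⟨ψ, hψ, hψd, hψe⟩ := exists_root_branch (hΦ.contDiffAt (x := (F, z))) h0 hd hκ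
  refine ⟨ψ, hψ, hψd, ?_, ?_⟩
  · have ht : Tendsto (fun G => (G, ψ G)) (𝓝 F) (𝓝 (F, z)) := by
      have := (continuousAt_id (x := F)).prodMk hψd.continuousAt
      rw [ContinuousAt, hψ] at this
      exact this
    filter_upwards [ht.eventually hψe] with G hG hN
    exact (toMap_pt_eq_self_iff hN (hne _)).2 (hG.2 rfl)
  · rw [nhds_prod_eq] at hψe
    have hm : Filter.map (fun x : Coeff d × ℂ => (x.1, pt (u₀ + u₁ * x.2) (v₀ + v₁ * x.2)))
        (𝓝 F ×ˢ 𝓝 z) = 𝓝 F ×ˢ 𝓝 (pt (u₀ + u₁ * z) (v₀ + v₁ * z)) := by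
      rw [hnhds]
      exact (Filter.prod_map_map_eq' id (fun s => pt (u₀ + u₁ * s) (v₀ + v₁ * s)) _ _).symm.trans
        (by rw [Filter.map_id])
    rw [← hm, Filter.eventually_map]
    filter_upwards [hψe] with x hx hN hfix
    rw [hx.1 ((toMap_pt_eq_self_iff hN (hne _)).1 hfix)]

/-- The branch through a simple finite fixed point. -/
lemma exists_fixed_branch_coe {F : Coeff d} {z : ℂ} (h0 : fixForm F z 1 = 0)
    (hs : hom F.2 z 1 + z * homU F.2 z 1 - homU F.1 z 1 ≠ 0) :
    ∃ ψ : Coeff d → ℂ, ψ F = z ∧ ContDiffAt ℂ 1 ψ F ∧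
      (∀ᶠ G in 𝓝 F, NonDeg G → toMap G (ψ G : OnePoint ℂ) = (ψ G : OnePoint ℂ)) ∧
      ∀ᶠ x in 𝓝 F ×ˢ 𝓝 (z : OnePoint ℂ), NonDeg x.1 → toMap x.1 x.2 = x.2 →
        x.2 = (ψ x.1 : OnePoint ℂ) := by
  have hh : ∀ a : Fin (d + 1) → ℂ, HasDerivAt (fun s => hom a s 1) (homU a z 1) z := fun a => by
    simpa using hasDerivAt_hom a (s := z) (hasDerivAt_id z) (hasDerivAt_const z 1)
  have hd : HasDerivAt (fun s => fixForm F s 1)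
      (hom F.2 z 1 + z * homU F.2 z 1 - homU F.1 z 1) z := by
    simpa [fixForm] using ((hasDerivAt_id z).fun_mul (hh F.2)).fun_sub (hh F.1)
  have h := exists_fixed_branch (F := F) (u₀ := 0) (u₁ := 1) (v₀ := 1) (v₁ := 0) (z := z)
    (κ := hom F.2 z 1 + z * homU F.2 z 1 - homU F.1 z 1) (by simp)
    (by simpa [pt_one] using OnePoint.nhds_coe_eq z) (by simpa using h0) (by simpa using hd) hs
  simpa [pt_one] using h

/-- The branch through a simple fixed point at infinity. -/
lemma exists_fixed_branch_infty {F : Coeff d} (h0 : F.2 (Fin.last d) = 0)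
    (hs : hom F.1 1 0 - homV F.2 1 0 ≠ 0) :
    ∃ ψ : Coeff d → ℂ, ψ F = 0 ∧ ContDiffAt ℂ 1 ψ F ∧
      ∀ᶠ x in 𝓝 F ×ˢ 𝓝 (∞ : OnePoint ℂ), NonDeg x.1 → toMap x.1 x.2 = x.2 →
        x.2 = pt 1 (ψ x.1) := by
  have hh : ∀ a : Fin (d + 1) → ℂ, HasDerivAt (fun s => hom a 1 s) (homV a 1 0) 0 := fun a => by
    simpa using hasDerivAt_hom a (s := 0) (hasDerivAt_const (0 : ℂ) (1 : ℂ)) (hasDerivAt_id 0)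
  have hd : HasDerivAt (fun s => fixForm F 1 s) (homV F.2 1 0 - hom F.1 1 0) 0 := by
    simpa [fixForm] using (hh F.2).fun_sub ((hasDerivAt_id (0 : ℂ)).fun_mul (hh F.1))
  have h := exists_fixed_branch (F := F) (u₀ := 1) (u₁ := 0) (v₀ := 0) (v₁ := 1) (z := 0)
    (κ := homV F.2 1 0 - hom F.1 1 0) (by simp)
    (by simpa [pt_one_left, coordInfty_zero] using nhds_infty_eq_map)
    (by simp [fixForm, hom_zero_right, h0]) (by simpa using hd)
    (by rw [← neg_sub]; exact neg_ne_zero.2 hs)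
  obtain ⟨ψ, h1, h2, -, h3⟩ := h
  refine ⟨ψ, h1, h2, ?_⟩
  simpa using h3

/-- Distinct fixed points are simple. -/
lemma MarkedRat.simple_of_injective (hd : 2 ≤ d) {m : MarkedRat d}
    (hm : Function.Injective m.mark) {z : ℂ} (hz : m.map z = z) :
    hom m.coeff.2 z 1 + z * homU m.coeff.2 z 1 - homU m.coeff.1 z 1 ≠ 0 := by
  have hroot := (toMap_coe_eq_self_iff m.nonDeg z).1 hz
  have hne := fixPoly_ne_zero hd m.nonDeg
  have hnd : (fixedPoints m.coeff).Nodup := by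
    rw [← m.mark_eq]
    exact Finset.univ.nodup.map hm
  have hnd2 : (fixPoly m.coeff).roots.Nodup :=
    Multiset.Nodup.of_map _ (Multiset.nodup_of_le (Multiset.le_add_right _ _) hnd)
  intro h
  have h1 : 1 < (fixPoly m.coeff).rootMultiplicity z := by
    refine (one_lt_rootMultiplicity_iff_isRoot hne).2 ⟨hroot, ?_⟩
    rw [homU_one, homU_one, hom_one] at h
    simpa [fixPoly, IsRoot, derivative_mul] using h
  rw [← count_roots] at h1
  exact absurd (Multiset.nodup_iff_count_le_one.1 hnd2 z) (not_le.2 h1)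

lemma Good.simple_zero {F : Coeff d} (hG : Good F) : hom F.2 0 1 - homU F.1 0 1 ≠ 0 := by
  intro h
  rw [homU_one, hom_one, sub_eq_zero] at h
  have h1 := hG.mult
  have e1 : (toPoly F.2).eval 0 = F.2 0 := by
    rw [← hom_one, hom_zero_left, one_pow, mul_one]
  have e2 : (derivative (toPoly F.1)).eval 0 = (toPoly F.1).coeff 1 := by
    rw [← coeff_zero_eq_eval_zero, coeff_derivative]; simp
  rw [← e1, h, e2] at h1
  exact lt_irrefl _ h1

/-- The reflection carries the simple fixed point 0 to ∞. -/
lemma Good.simple_infty {F : Coeff d} (hG : Good F) : hom F.1 1 0 - homV F.2 1 0 ≠ 0 := by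
  have h := hG.simple_zero
  have e : F.2 = starForm F.1 := by rw [← refl_snd, hG.symm]
  rw [hG.hom_fst, e, homV_starForm, ← map_sub, map_one, map_zero, ← e]
  exact (_root_.map_ne_zero _).2 h

/-- A good map with the first three marked fixed points at `0`, `∞` and `1`. -/
structure Normalized (hd : 2 ≤ d) (n : MarkedRat d) : Prop where
  good : Good n.coeff
  inj : Function.Injective n.mark
  zero : n.mark 0 = ((0 : ℂ) : OnePoint ℂ)
  infty : n.mark 1 = ∞
  one : n.mark ⟨2, by omega⟩ = ((1 : ℂ) : OnePoint ℂ)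

lemma mem_normalSpace_of_marks (hd : 2 ≤ d) {n : MarkedRat d}
    (h0 : n.mark 0 = ((0 : ℂ) : OnePoint ℂ)) (h1 : n.mark 1 = ∞)
    (h2 : n.mark ⟨2, by omega⟩ = ((1 : ℂ) : OnePoint ℂ)) : n.coeff ∈ normalSpace d := by
  have e0 := n.map_mark hd 0
  have e1 := n.map_mark hd 1
  have e2 := n.map_mark hd ⟨2, by omega⟩
  rw [h0] at e0
  rw [h1] at e1
  rw [h2] at e2
  have e0' := (toMap_coe_eq_self_iff n.nonDeg 0).1 e0
  have e2' := (toMap_coe_eq_self_iff n.nonDeg 1).1 e2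
  rw [IsRoot, fixPoly_eval] at e0' e2'
  refine ⟨?_, toMap_infty_eq_self_iff.1 e1, ?_⟩
  · simpa [hom_zero_left] using e0'
  · linear_combination -e2'

lemma Normalized.simpleNormal {hd : 2 ≤ d} {n : MarkedRat d} (h : Normalized hd n) :
    SimpleNormal n.coeff := by
  obtain ⟨h0, h1, h2⟩ := mem_normalSpace_of_marks hd h.zero h.infty h.one
  refine ⟨h0, h1, h2, h.good.simple_zero, h.good.simple_infty, ?_⟩
  have e := n.map_mark hd ⟨2, by omega⟩
  rw [h.one] at e
  simpa using MarkedRat.simple_of_injective hd h.inj e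

end Branch

/-! ### Slices transverse to the orbits -/

section Slice

variable {d : ℕ}

/-- The velocities at `m`, in homogeneous coordinates, of the smooth curves of marked maps whose
classes stay in `S`. -/
def coeffVelocities (S : Set (Moduli d)) (m : MarkedRat d) : Set (Coeff d) :=
  {v | ∃ ε > 0, ∃ c : ℝ → MarkedRat d, c 0 = m ∧
    ContDiffOn ℝ ((⊤ : ℕ∞) : WithTop ℕ∞) (fun t => (c t).coeff) (Ioo (-ε) ε) ∧
    ContinuousOn (fun t => (c t).mark) (Ioo (-ε) ε) ∧
    (∀ t ∈ Ioo (-ε) ε, (c t).toModuli ∈ S) ∧ deriv (fun t => (c t).coeff) 0 = v}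

lemma velocities_eq_image (S : Set (Moduli d)) (m : MarkedRat d) :
    velocities S m = (orbitTangent m.coeff).mkQ '' coeffVelocities S m := by
  ext v
  constructor
  · rintro ⟨ε, hε, c, h1, h2, h3, h4, rfl⟩
    exact ⟨_, ⟨ε, hε, c, h1, h2, h3, h4, rfl⟩, rfl⟩
  · rintro ⟨_, ⟨ε, hε, c, h1, h2, h3, h4, rfl⟩, rfl⟩
    exact ⟨ε, hε, c, h1, h2, h3, h4, rfl⟩

/-- `W` is a real space of coordinate vectors that represents the velocities in `S` modulo the
tangent space of the orbit, and is totally real of half the dimension modulo that space. -/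
structure IsRealSlice (S : Set (Moduli d)) (m : MarkedRat d) (W : Submodule ℝ (Coeff d)) :
    Prop where
  decomp : ∀ v : Coeff d, ∃ w₁ ∈ W, ∃ w₂ ∈ W, v - (w₁ + Complex.I • w₂) ∈ orbitTangent m.coeff
  indep : ∀ w₁ ∈ W, ∀ w₂ ∈ W, w₁ - Complex.I • w₂ ∈ orbitTangent m.coeff →
    w₁ ∈ orbitTangent m.coeff
  lift : ∀ w ∈ W, ∃ u ∈ coeffVelocities S m, u - w ∈ orbitTangent m.coeff
  proj : ∀ u ∈ coeffVelocities S m, ∃ w ∈ W, u - w ∈ orbitTangent m.coeff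

lemma IsRealSlice.exists_isCompl {S : Set (Moduli d)} {m : MarkedRat d}
    {W : Submodule ℝ (Coeff d)} (hW : IsRealSlice S m W) :
    ∃ T : Submodule ℝ (ModuliTangent m), (T : Set (ModuliTangent m)) = velocities S m ∧
      IsCompl T (T.map (almostComplex m)) := by
  set q := (orbitTangent m.coeff).mkQ with hq
  have hqe : ∀ u w : Coeff d, u - w ∈ orbitTangent m.coeff → q u = q w := fun u w h =>
    (Submodule.Quotient.eq _).2 h
  have hJ : ∀ w, almostComplex m (q w) = q (Complex.I • w) := fun w => (map_smul q _ _).symm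
  refine ⟨W.map (q.restrictScalars ℝ), ?_, ?_, ?_⟩
  · rw [velocities_eq_image]
    ext x
    constructor
    · rintro ⟨w, hw, rfl⟩
      obtain ⟨u, hu, h⟩ := hW.lift w hw
      exact ⟨u, hu, hqe u w h⟩
    · rintro ⟨u, hu, rfl⟩
      obtain ⟨w, hw, h⟩ := hW.proj u hu
      exact ⟨w, hw, (hqe u w h).symm⟩
  · rw [Submodule.disjoint_def]
    rintro _ ⟨w₁, h1, rfl⟩ ⟨_, ⟨w₂, h2, rfl⟩, h⟩
    change almostComplex m (q w₂) = q w₁ at h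
    rw [hJ] at h
    have := (Submodule.Quotient.eq _).1 h.symm
    exact (Submodule.Quotient.mk_eq_zero _).2 (hW.indep w₁ h1 w₂ h2 this)
  · rw [codisjoint_iff, eq_top_iff]
    rintro x -
    obtain ⟨v, rfl⟩ := (orbitTangent m.coeff).mkQ_surjective x
    obtain ⟨w₁, h1, w₂, h2, h⟩ := hW.decomp v
    refine Submodule.mem_sup.2 ⟨q w₁, ⟨w₁, h1, rfl⟩, almostComplex m (q w₂),
      ⟨_, ⟨w₂, h2, rfl⟩, rfl⟩, ?_⟩
    rw [hJ, ← map_add]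
    exact (hqe _ _ h).symm

lemma MarkedRat.eq_of_coeff_eq {m n : MarkedRat d} (h : m.coeff = n.coeff) (h' : m.mark = n.mark) :
    m = n := by
  cases m; cases n; cases h; cases h'; rfl

lemma MarkedRat.conj_conj_of_mul_eq_one (hd : 2 ≤ d) {m : MarkedRat d}
    (hm : Function.Injective m.mark) {g h : GL (Fin 2) ℂ} (hgh : h * g = 1) :
    (m.conj hd g).conj hd h = m := by
  have hm' : Function.Injective (m.conj hd g).mark :=
    injective_mark_of_toModuli_eq (m.toModuli_conj hd g hm).symm hm
  refine MarkedRat.eq_of_coeff_eq ?_ (funext fun i => ?_)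
  · rw [conj_coeff hd h hm', conj_coeff hd g hm, ← conjCoeff_mul, ← Units.val_mul, hgh,
      Units.val_one, conjCoeff_one]
  · rw [conj_mark hd h hm', conj_mark hd g hm, smul_smul, hgh, one_smul]

/-- Conjugate the whole curve by the fixed g. Injectivity of the marks on S ensures that `conj` is
the actual conjugate at the relevant times. -/
lemma conjCoeff_mem_coeffVelocities (hd : 2 ≤ d) {S : Set (Moduli d)}
    (hS : ∀ n : MarkedRat d, n.toModuli ∈ S → Function.Injective n.mark) {m : MarkedRat d}
    (g : GL (Fin 2) ℂ) {u : Coeff d} (hu : u ∈ coeffVelocities S m) :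
    conjCoeff g u ∈ coeffVelocities S (m.conj hd g) := by
  obtain ⟨ε, hε, c, h1, h2, h3, h4, rfl⟩ := hu
  set L : Coeff d →L[ℝ] Coeff d := (LinearMap.toContinuousLinearMap
    (conjLin (g : Matrix (Fin 2) (Fin 2) ℂ))).restrictScalars ℝ with hL
  have hinj : ∀ t ∈ Ioo (-ε) ε, Function.Injective (c t).mark := fun t ht => hS _ (h4 t ht)
  have hnhds : Ioo (-ε) ε ∈ 𝓝 (0 : ℝ) := Ioo_mem_nhds (by linarith) hε
  have hc : ∀ t ∈ Ioo (-ε) ε, ((c t).conj hd g).coeff = L (c t).coeff := fun t ht =>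
    MarkedRat.conj_coeff hd g (hinj t ht)
  refine ⟨ε, hε, fun t => (c t).conj hd g, by simp only [h1], ?_, ?_, ?_, ?_⟩
  · exact (L.contDiff.comp_contDiffOn h2).congr hc
  · refine ContinuousOn.congr (f := fun t i => g • (c t).mark i) (continuousOn_pi.2 fun i =>
      (continuous_gl_smul g).comp_continuousOn (continuousOn_pi.1 h3 i)) fun t ht => ?_
    exact funext fun i => MarkedRat.conj_mark hd g (hinj t ht) i
  · intro t ht
    rw [MarkedRat.toModuli_conj hd g (hinj t ht)]
    exact h4 t ht
  · have hd0 : DifferentiableAt ℝ (fun t => (c t).coeff) 0 :=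
      (h2.contDiffAt hnhds).differentiableAt (by simp)
    have h5 := L.hasFDerivAt.comp_hasDerivAt (0 : ℝ) hd0.hasDerivAt
    have h6 : (fun t => ((c t).conj hd g).coeff) =ᶠ[𝓝 0] L ∘ fun t => (c t).coeff :=
      Filter.eventually_of_mem hnhds hc
    rw [h6.deriv_eq, h5.deriv]
    rfl

/-- Reduces the theorem to a convenient representative of the conjugacy class. -/
lemma IsRealSlice.conj (hd : 2 ≤ d) {S : Set (Moduli d)}
    (hS : ∀ n : MarkedRat d, n.toModuli ∈ S → Function.Injective n.mark) {m : MarkedRat d}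
    (hm : Function.Injective m.mark) (g : GL (Fin 2) ℂ) {W : Submodule ℝ (Coeff d)}
    (hW : IsRealSlice S m W) : IsRealSlice S (m.conj hd g)
      (W.map ((conjLin (g : Matrix (Fin 2) (Fin 2) ℂ)).restrictScalars ℝ)) := by
  set L := conjLin (d := d) (g : Matrix (Fin 2) (Fin 2) ℂ) with hL
  set L' := conjLin (d := d) ((g⁻¹ : GL (Fin 2) ℂ) : Matrix (Fin 2) (Fin 2) ℂ) with hL'
  have hLL' : ∀ v, L (L' v) = v := conjCoeff_conjCoeff_inv g
  have hL'L : ∀ v, L' (L v) = v := conjCoeff_inv_conjCoeff g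
  have hO : ∀ v ∈ orbitTangent m.coeff, L v ∈ orbitTangent (m.conj hd g).coeff := fun v hv => by
    rw [MarkedRat.conj_coeff hd g hm]
    exact conjCoeff_mem_orbitTangent g hv
  have hO' : ∀ v, L v ∈ orbitTangent (m.conj hd g).coeff → v ∈ orbitTangent m.coeff := by
    intro v hv
    rw [MarkedRat.conj_coeff hd g hm] at hv
    have := conjCoeff_mem_orbitTangent g⁻¹ hv
    rw [conjCoeff_inv_conjCoeff] at this
    rw [← hL'L v]
    exact this
  refine ⟨fun v => ?_, ?_, ?_, fun u hu => ?_⟩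
  · obtain ⟨w₁, h1, w₂, h2, h⟩ := hW.decomp (L' v)
    refine ⟨L w₁, ⟨w₁, h1, rfl⟩, L w₂, ⟨w₂, h2, rfl⟩, ?_⟩
    have := hO _ h
    rwa [map_sub, map_add, hLL', map_smul] at this
  · rintro _ ⟨w₁, h1, rfl⟩ _ ⟨w₂, h2, rfl⟩ h
    change L w₁ - Complex.I • L w₂ ∈ _ at h
    rw [← map_smul, ← map_sub] at h
    exact hO _ (hW.indep w₁ h1 w₂ h2 (hO' _ h))
  · rintro _ ⟨w, hw, rfl⟩
    obtain ⟨u, hu, h⟩ := hW.lift w hw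
    refine ⟨L u, conjCoeff_mem_coeffVelocities hd hS g hu, ?_⟩
    change L u - L w ∈ _
    rw [← map_sub]
    exact hO _ h
  · have h1 := conjCoeff_mem_coeffVelocities hd hS g⁻¹ hu
    rw [MarkedRat.conj_conj_of_mul_eq_one hd hm (inv_mul_cancel g)] at h1
    obtain ⟨w, hw, h⟩ := hW.proj _ h1
    refine ⟨L w, ⟨w, hw, rfl⟩, ?_⟩
    have := hO _ h
    rw [map_sub] at this
    rwa [show L (conjCoeff ((g⁻¹ : GL (Fin 2) ℂ) : Matrix (Fin 2) (Fin 2) ℂ) u) = u from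
      hLL' u] at this

/-- Symmetric coefficients of the maps that fix `0`, `∞` and `1`. -/
def symmNormalSpace (d : ℕ) : Submodule ℝ (Coeff d) where
  carrier := {w | refl w = w ∧ w ∈ normalSpace d}
  add_mem' := fun h h' => ⟨by rw [map_add, h.1, h'.1], add_mem h.2 h'.2⟩
  zero_mem' := ⟨map_zero _, zero_mem _⟩
  smul_mem' := fun c w h => ⟨by rw [map_smul, h.1], by
    have := (normalSpace d).smul_mem (c : ℂ) h.2
    simpa using this⟩

/-- Move v into the normal space along the orbit, then split y = (y + y*) / 2 + i · (-i (y - y*) /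
2), where y* denotes `refl y`; both components are symmetric and normal. -/
lemma Normalized.decomp {hd : 2 ≤ d} {n : MarkedRat d} (h : Normalized hd n) (v : Coeff d) :
    ∃ w₁ ∈ symmNormalSpace d, ∃ w₂ ∈ symmNormalSpace d,
      v - (w₁ + Complex.I • w₂) ∈ orbitTangent n.coeff := by
  obtain ⟨x, hx, hv⟩ := h.simpleNormal.exists_sub_mem_normalSpace v
  set y := v - x with hy
  have hI : starRingEnd ℂ (Complex.I) = -Complex.I := Complex.conj_I
  have hinv : starRingEnd ℂ (2⁻¹ : ℂ) = 2⁻¹ := by rw [map_inv₀, map_ofNat]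
  have hry := refl_mem_normalSpace hv
  refine ⟨(2⁻¹ : ℂ) • (y + refl y), ⟨?_, ?_⟩, (-Complex.I * 2⁻¹) • (y - refl y), ⟨?_, ?_⟩, ?_⟩
  · rw [refl_smul, map_add, refl_refl, add_comm (refl y) y, hinv]
  · exact (normalSpace d).smul_mem _ (add_mem hv hry)
  · rw [refl_smul, map_sub, refl_refl, map_mul, map_neg, hI, hinv, ← neg_sub y, smul_neg, ← neg_smul]
    simp
  · exact (normalSpace d).smul_mem _ (sub_mem hv hry)
  · have e : v - ((2⁻¹ : ℂ) • (y + refl y) +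
        Complex.I • (-Complex.I * 2⁻¹) • (y - refl y)) = x := by
      have e1 : Complex.I * (-Complex.I * 2⁻¹) = 2⁻¹ := by
        rw [← mul_assoc, mul_neg, Complex.I_mul_I]; ring
      rw [smul_smul, e1, ← smul_add, add_add_sub_cancel, ← two_smul ℂ y, smul_smul,
        inv_mul_cancel₀ two_ne_zero, one_smul, hy, sub_sub_cancel]
    rw [e]
    exact hx

/-- A normal vector tangent to the orbit is cF. Adding w₁ - i w₂ = cF to its reflection gives w₁ =
Re(c) F, again tangent to the orbit. -/
lemma Normalized.indep {hd : 2 ≤ d} {n : MarkedRat d} (h : Normalized hd n) :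
    ∀ w₁ ∈ symmNormalSpace d, ∀ w₂ ∈ symmNormalSpace d,
      w₁ - Complex.I • w₂ ∈ orbitTangent n.coeff → w₁ ∈ orbitTangent n.coeff := by
  rintro w₁ ⟨h1, h1'⟩ w₂ ⟨h2, h2'⟩ ho
  obtain ⟨c, hc⟩ := h.simpleNormal.eq_smul_of_mem ho
    (sub_mem h1' ((normalSpace d).smul_mem _ h2'))
  have hc' := congrArg refl hc
  rw [map_sub, refl_smul, refl_smul, h1, h2, h.good.symm, Complex.conj_I, neg_smul,
    sub_neg_eq_add] at hc'
  have : w₁ = (2⁻¹ * (c + starRingEnd ℂ c)) • n.coeff := by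
    rw [mul_smul, add_smul, ← hc, ← hc', sub_add_add_cancel, ← two_smul ℂ w₁, smul_smul,
      inv_mul_cancel₀ two_ne_zero, one_smul]
  rw [this]
  exact smul_mem_orbitTangent _ _

end Slice

/-! ### Normalisation of the first three marked points -/

section Normalize

variable {d : ℕ}

/-- A scalar matrix. -/
def scalarGL (k : ℂ) (hk : k ≠ 0) : GL (Fin 2) ℂ :=
  Matrix.GeneralLinearGroup.mkOfDetNeZero (k • 1) (by simpa [Matrix.det_smul] using hk)

lemma scalarGL_smul {k : ℂ} (hk : k ≠ 0) (p : OnePoint ℂ) : scalarGL k hk • p = p := by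
  obtain ⟨u, v, h, rfl⟩ := exists_pt p
  have e : ((scalarGL k hk : GL (Fin 2) ℂ) : Matrix (Fin 2) (Fin 2) ℂ) = k • 1 := rfl
  rw [smul_pt _ u v h, e]
  simpa using pt_smul hk u v

lemma exists_gl_smul_eq {p q r : OnePoint ℂ} (hpq : p ≠ q) (hpr : p ≠ r) (hqr : q ≠ r) :
    ∃ g : GL (Fin 2) ℂ, g • p = ((0 : ℂ) : OnePoint ℂ) ∧ g • q = ∞ ∧
      g • r = ((1 : ℂ) : OnePoint ℂ) := by
  obtain ⟨u₀, v₀, h₀, rfl⟩ := exists_pt p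
  obtain ⟨u₁, v₁, h₁, rfl⟩ := exists_pt q
  obtain ⟨u₂, v₂, h₂, rfl⟩ := exists_pt r
  rw [Ne, pt_eq_pt_iff h₀ h₁] at hpq
  rw [Ne, pt_eq_pt_iff h₀ h₂] at hpr
  rw [Ne, pt_eq_pt_iff h₁ h₂] at hqr
  have e₀₁ : u₀ * v₁ - u₁ * v₀ ≠ 0 := fun h => hpq (by linear_combination h)
  have e₀₂ : v₀ * u₂ - u₀ * v₂ ≠ 0 := fun h => hpr (by linear_combination -h)
  have e₁₂ : v₁ * u₂ - u₁ * v₂ ≠ 0 := fun h => hqr (by linear_combination -h)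
  -- The rows are linear forms vanishing at p and at q, scaled to take equal values at r.
  set A : Matrix (Fin 2) (Fin 2) ℂ := !![(v₁ * u₂ - u₁ * v₂) * v₀, -((v₁ * u₂ - u₁ * v₂) * u₀);
    (v₀ * u₂ - u₀ * v₂) * v₁, -((v₀ * u₂ - u₀ * v₂) * u₁)] with hA
  have hdet : A.det ≠ 0 := by
    have : A.det = (v₁ * u₂ - u₁ * v₂) * (v₀ * u₂ - u₀ * v₂) * (u₀ * v₁ - u₁ * v₀) := by
      rw [Matrix.det_fin_two, hA]
      simp
      ring
    rw [this]
    exact mul_ne_zero (mul_ne_zero e₁₂ e₀₂) e₀₁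
  set g := Matrix.GeneralLinearGroup.mkOfDetNeZero A hdet with hg
  have h00 : g 0 0 = (v₁ * u₂ - u₁ * v₂) * v₀ := rfl
  have h01 : g 0 1 = -((v₁ * u₂ - u₁ * v₂) * u₀) := rfl
  have h10 : g 1 0 = (v₀ * u₂ - u₀ * v₂) * v₁ := rfl
  have h11 : g 1 1 = -((v₀ * u₂ - u₀ * v₂) * u₁) := rfl
  refine ⟨g, ?_, ?_, ?_⟩
  · have hn := gl_apply_ne_zero g h₀
    rw [smul_pt g _ _ h₀, ← pt_one, pt_eq_pt_iff hn (by simp), h00, h01]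
    ring
  · have hn := gl_apply_ne_zero g h₁
    rw [smul_pt g _ _ h₁, ← pt_zero 1, pt_eq_pt_iff hn (by simp), h10, h11]
    ring
  · have hn := gl_apply_ne_zero g h₂
    rw [smul_pt g _ _ h₂, ← pt_one, pt_eq_pt_iff hn (by simp), h00, h01, h10, h11]
    ring

lemma wellMarked_of_mem_blaschkeLocus (hd : 2 ≤ d) {m : MarkedRat d}
    (hm : m.toModuli ∈ blaschkeLocus d) : WellMarked m :=
  wellMarked_of_mem_quasiBlaschkeSpace hd hm.1

theorem exists_normalized_conj (hd : 2 ≤ d) {m : MarkedRat d}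
    (hm : m.toModuli ∈ blaschkeLocus d) : ∃ g : GL (Fin 2) ℂ, Normalized hd (m.conj hd g) := by
  have hinj : Function.Injective m.mark := (wellMarked_of_mem_blaschkeLocus hd hm).inj
  have hne : ∀ i j : Fin (d + 1), (i : ℕ) ≠ j → m.mark i ≠ m.mark j := fun i j hij h =>
    hij (congrArg _ (hinj h))
  have h1 : ((1 : Fin (d + 1)) : ℕ) = 1 := by
    rw [Fin.val_one', Nat.mod_eq_of_lt (by omega)]
  obtain ⟨g, hg0, hg1, hg2⟩ := exists_gl_smul_eq (hne 0 1 (by rw [h1]; simp))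
    (hne 0 ⟨2, by omega⟩ (by simp)) (hne 1 ⟨2, by omega⟩ (by rw [h1]; simp))
  have hn := MarkedRat.toModuli_conj hd g hinj
  obtain ⟨μ, hμ, hG⟩ := exists_good_smul hd (n := m.conj hd g) (by rwa [hn])
    (by rw [MarkedRat.conj_mark hd g hinj, hg0]) (by rw [MarkedRat.conj_mark hd g hinj, hg1])
    (by rw [MarkedRat.conj_mark hd g hinj, hg2])
  -- A scalar matrix k multiplies coefficients by kᵈ⁺¹, so a (d + 1)-st root absorbs μ into the
  -- conjugation.
  obtain ⟨k, hk⟩ := IsAlgClosed.exists_pow_nat_eq μ (Nat.succ_pos d)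
  have hk0 : k ≠ 0 := by
    rintro rfl
    exact hμ (by rw [← hk, zero_pow (Nat.succ_ne_zero d)])
  refine ⟨scalarGL k hk0 * g, ?_, ?_, ?_, ?_, ?_⟩
  · have : (m.conj hd (scalarGL k hk0 * g)).coeff = μ • (m.conj hd g).coeff := by
      rw [MarkedRat.conj_coeff hd _ hinj, MarkedRat.conj_coeff hd _ hinj, Units.val_mul,
        conjCoeff_mul, ← hk]
      exact conjCoeff_smul_one k _
    rw [this]
    exact hG
  · exact injective_mark_of_toModuli_eq (MarkedRat.toModuli_conj hd _ hinj).symm hinj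
  all_goals rw [MarkedRat.conj_mark hd _ hinj, mul_smul, scalarGL_smul]
  · exact hg0
  · exact hg1
  · exact hg2

end Normalize

/-! ### Deformations of a normalised Blaschke product -/

section Deform

variable {d : ℕ}

/-- A continuous choice of the angle of a moving point on the unit circle. -/
lemma exists_angle {E : Type*} [TopologicalSpace E] {x : E} {ψ : E → ℂ} {s : ℝ}
    (hψ : ContinuousAt ψ x) (hs : ψ x = Complex.exp (2 * Real.pi * Complex.I * s)) :
    ∃ σ : E → ℝ, σ x = s ∧ ContinuousAt σ x ∧
      ∀ y, ‖ψ y‖ = 1 → ψ y = Complex.exp (2 * Real.pi * Complex.I * σ y) := by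
  have hx : ψ x ≠ 0 := by rw [hs]; exact Complex.exp_ne_zero _
  have hpi : (Real.pi : ℂ) ≠ 0 := by exact_mod_cast Real.pi_ne_zero
  have hnx : ‖ψ x‖ = 1 := by
    rw [hs, show (2 * Real.pi * Complex.I * s : ℂ) = ((2 * Real.pi * s : ℝ) : ℂ) * Complex.I by
      push_cast; ring, Complex.norm_exp_ofReal_mul_I]
  refine ⟨fun y => s + Complex.arg (ψ y / ψ x) / (2 * Real.pi), ?_, ?_, ?_⟩
  · simp [div_self hx]
  · have ha : ContinuousAt Complex.arg (ψ x / ψ x) := by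
      rw [div_self hx]
      exact Complex.continuousAt_arg Complex.one_mem_slitPlane
    have hq : ContinuousAt (fun y => ψ y / ψ x) x := hψ.div_const _
    exact continuousAt_const.add
      ((ContinuousAt.comp (f := fun y => ψ y / ψ x) (g := Complex.arg) ha hq).div_const _)
  · intro y hy
    have h := Complex.norm_mul_exp_arg_mul_I (ψ y / ψ x)
    rw [norm_div, hy, hnx, div_one, Complex.ofReal_one, one_mul] at h
    have e : (2 * Real.pi * Complex.I * ((s + Complex.arg (ψ y / ψ x) / (2 * Real.pi) : ℝ) : ℂ)) =
        2 * Real.pi * Complex.I * s + Complex.arg (ψ y / ψ x) * Complex.I := by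
      push_cast
      field_simp
    rw [e, Complex.exp_add, h, ← hs, mul_div_cancel₀ _ hx]

namespace Normalized

variable {hd : 2 ≤ d} {n : MarkedRat d}

/-- Simple fixed points move continuously. For symmetric maps near F they remain different from 0
and ∞, hence stay on the circle, and the strict inequalities between their angles persist. -/
lemma exists_branches (h : Normalized hd n) (hm : n.toModuli ∈ blaschkeLocus d) :
    ∃ ψ : Fin (d + 1) → Coeff d → ℂ,
      (∀ i : Fin (d + 1), 2 ≤ (i : ℕ) → n.mark i = (ψ i n.coeff : OnePoint ℂ)) ∧
      (∀ᶠ G in 𝓝 n.coeff, ∀ i : Fin (d + 1), 2 ≤ (i : ℕ) → ContinuousAt (ψ i) G) ∧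
      ∀ᶠ G in 𝓝 n.coeff, refl G = G → G.1 0 = 0 → Good G ∧
        (∀ i : Fin (d + 1), 2 ≤ (i : ℕ) → toMap G (ψ i G : OnePoint ℂ) = (ψ i G : OnePoint ℂ)) ∧
        ∃ s : Fin (d + 1) → ℝ, (∀ i : Fin (d + 1), 2 ≤ (i : ℕ) →
            ψ i G = Complex.exp (2 * Real.pi * Complex.I * s i)) ∧
          ∀ i j : Fin (d + 1), 2 ≤ (i : ℕ) → i < j → s i < s j ∧ s j < s i + 1 := by
  obtain ⟨s, hs, hord⟩ := exists_ordered_angles (μ := 1) hm.1 one_ne_zero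
    (by rw [one_smul]; exact h.good) h.zero h.infty
  -- The guard 2 ≤ i makes the choice of branches total; the marks 0 and ∞ need none.
  have hex : ∀ i : Fin (d + 1), ∃ ψ : Coeff d → ℂ, ∃ σ : Coeff d → ℝ, 2 ≤ (i : ℕ) →
      n.mark i = (ψ n.coeff : OnePoint ℂ) ∧ ContDiffAt ℂ 1 ψ n.coeff ∧
      (∀ᶠ G in 𝓝 n.coeff, NonDeg G → toMap G (ψ G : OnePoint ℂ) = (ψ G : OnePoint ℂ)) ∧
      σ n.coeff = s i ∧ ContinuousAt σ n.coeff ∧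
      ∀ G, ‖ψ G‖ = 1 → ψ G = Complex.exp (2 * Real.pi * Complex.I * σ G) := by
    intro i
    by_cases hi : 2 ≤ (i : ℕ)
    · have hfix := n.map_mark hd i
      rw [hs i hi] at hfix
      obtain ⟨ψ, h1, h2, h3, -⟩ := exists_fixed_branch_coe
        (z := Complex.exp (2 * Real.pi * Complex.I * s i))
        (by rw [fixForm, ← toMap_pt_eq_self_iff n.nonDeg (by simp), pt_one]; exact hfix)
        (MarkedRat.simple_of_injective hd h.inj hfix)
      obtain ⟨σ, h4, h5, h6⟩ := exists_angle h2.continuousAt h1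
      exact ⟨ψ, σ, fun _ => ⟨by rw [hs i hi, h1], h2, h3, h4, h5, h6⟩⟩
    · exact ⟨0, 0, fun h => absurd h hi⟩
  choose ψ σ hψ using hex
  refine ⟨ψ, fun i hi => (hψ i hi).1, ?_, ?_⟩
  · refine Filter.eventually_all.2 fun i => ?_
    by_cases hi : 2 ≤ (i : ℕ)
    · filter_upwards [(hψ i hi).2.1.eventually (by simp)] with G hG _ using hG.continuousAt
    · exact Eventually.of_forall fun G h => absurd h hi
  · have e1 : ∀ᶠ G in 𝓝 n.coeff, ∀ i : Fin (d + 1), 2 ≤ (i : ℕ) → ψ i G ≠ 0 ∧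
        (NonDeg G → toMap G (ψ i G : OnePoint ℂ) = (ψ i G : OnePoint ℂ)) := by
      refine Filter.eventually_all.2 fun i => ?_
      by_cases hi : 2 ≤ (i : ℕ)
      · have hne : ψ i n.coeff ≠ 0 := by
          have h1 := (hψ i hi).1
          rw [hs i hi] at h1
          rw [← OnePoint.coe_injective h1]
          exact Complex.exp_ne_zero _
        filter_upwards [(hψ i hi).2.2.1, (hψ i hi).2.1.continuousAt.eventually_ne hne]
          with G hG hG' _ using ⟨hG', hG⟩
      · exact Eventually.of_forall fun G h => absurd h hi
    have e2 : ∀ᶠ G in 𝓝 n.coeff, ∀ i j : Fin (d + 1), 2 ≤ (i : ℕ) → i < j →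
        σ i G < σ j G ∧ σ j G < σ i G + 1 := by
      refine Filter.eventually_all.2 fun i => Filter.eventually_all.2 fun j => ?_
      by_cases hi : 2 ≤ (i : ℕ)
      · by_cases hij : i < j
        · have hj : 2 ≤ (j : ℕ) := hi.trans hij.le
          obtain ⟨-, -, -, hi1, hi2, -⟩ := hψ i hi
          obtain ⟨-, -, -, hj1, hj2, -⟩ := hψ j hj
          obtain ⟨o1, o2⟩ := hord i j hi hij
          filter_upwards [hi2.eventually_lt hj2 (by rw [hi1, hj1]; exact o1),
            hj2.eventually_lt (g := fun G => σ i G + 1) (hi2.add continuousAt_const)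
              (by rw [hi1, hj1]; exact o2)] with G g1 g2 _ _ using ⟨g1, g2⟩
        · exact Eventually.of_forall fun G _ h => absurd h hij
      · exact Eventually.of_forall fun G h => absurd h hi
    filter_upwards [e1, e2, h.good.eventually_good (by omega)] with G g1 g2 g3 hr h0
    have hG := g3 hr h0
    refine ⟨hG, fun i hi => (g1 i hi).2 hG.nonDeg, fun i => σ i G, fun i hi => ?_, g2⟩
    refine (hψ i hi).2.2.2.2.2 G ?_
    rw [← coe_mem_unitCircle_iff]
    exact hG.mem_unitCircle_of_fixed ((g1 i hi).2 hG.nonDeg)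
      (fun hc => (g1 i hi).1 (OnePoint.coe_injective hc)) (OnePoint.coe_ne_infty _)

/-- The straight line F + tw realises w. Symmetry and fixing 0, ∞, 1 are real linear conditions and
hold for all t; goodness, distinct marks and their order hold for small t. -/
theorem mem_coeffVelocities (h : Normalized hd n) (hm : n.toModuli ∈ blaschkeLocus d)
    {w : Coeff d} (hw : w ∈ symmNormalSpace d) : w ∈ coeffVelocities (blaschkeLocus d) n := by
  classical
  obtain ⟨ψ, hψ0, hψc, hψ⟩ := h.exists_branches hm
  have h1v : ((1 : Fin (d + 1)) : ℕ) = 1 := by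
    rw [Fin.val_one', Nat.mod_eq_of_lt (by omega)]
  have h01 : (1 : Fin (d + 1)) ≠ 0 := fun hc => by
    have := congrArg Fin.val hc
    rw [h1v] at this
    simp at this
  set Y : Coeff d → Fin (d + 1) → OnePoint ℂ := fun G i =>
    if i = 0 then ((0 : ℂ) : OnePoint ℂ) else if i = 1 then ∞ else (ψ i G : OnePoint ℂ) with hY
  have hY0 : ∀ G, Y G 0 = ((0 : ℂ) : OnePoint ℂ) := fun G => by simp [hY]
  have hY1 : ∀ G, Y G 1 = ∞ := fun G => by simp [hY, h01]
  have hY2 : ∀ G (i : Fin (d + 1)), 2 ≤ (i : ℕ) → Y G i = (ψ i G : OnePoint ℂ) := by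
    intro G i hi
    have e0 : i ≠ 0 := by rintro rfl; simp at hi
    have e1 : i ≠ 1 := by rintro rfl; omega
    simp [hY, e0, e1]
  set γ : ℝ → Coeff d := fun t => n.coeff + t • w with hγ
  have hγ0 : γ 0 = n.coeff := by simp [hγ]
  have hγc : ContDiff ℝ ((⊤ : ℕ∞) : WithTop ℕ∞) γ :=
    contDiff_const.add (contDiff_id.smul contDiff_const)
  obtain ⟨h00, h0l, -⟩ := mem_normalSpace_of_marks hd h.zero h.infty h.one
  have hγr : ∀ t, refl (γ t) = γ t := fun t => by
    simp only [hγ]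
    rw [map_add, map_smul, h.good.symm, hw.1]
  have hγz : ∀ t, (γ t).1 0 = 0 := fun t => by simp [hγ, h00, hw.2.1]
  have hγl : ∀ t, (γ t).2 (Fin.last d) = 0 := fun t => by simp [hγ, h0l, hw.2.2.1]
  have hev : ∀ᶠ t in 𝓝 (0 : ℝ), (∀ i : Fin (d + 1), 2 ≤ (i : ℕ) → ContinuousAt (ψ i) (γ t)) ∧
      Good (γ t) ∧ (∀ i : Fin (d + 1), 2 ≤ (i : ℕ) →
        toMap (γ t) (ψ i (γ t) : OnePoint ℂ) = (ψ i (γ t) : OnePoint ℂ)) ∧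
        ∃ s : Fin (d + 1) → ℝ, (∀ i : Fin (d + 1), 2 ≤ (i : ℕ) →
            ψ i (γ t) = Complex.exp (2 * Real.pi * Complex.I * s i)) ∧
          ∀ i j : Fin (d + 1), 2 ≤ (i : ℕ) → i < j → s i < s j ∧ s j < s i + 1 := by
    have ht : Tendsto γ (𝓝 0) (𝓝 n.coeff) := by
      have := hγc.continuous.tendsto 0
      rwa [hγ0] at this
    filter_upwards [ht.eventually hψc, ht.eventually hψ] with t h1 h2
    exact ⟨h1, h2 (hγr t) (hγz t)⟩
  obtain ⟨ε, hε, hball⟩ := Metric.eventually_nhds_iff.1 hev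
  have hI : ∀ t ∈ Ioo (-ε) ε, dist t 0 < ε := fun t ht => by
    rw [Real.dist_eq, sub_zero]; exact abs_lt.2 ht
  have hinj : ∀ t ∈ Ioo (-ε) ε, Function.Injective (Y (γ t)) := by
    intro t ht
    obtain ⟨-, -, -, s, hs, hord⟩ := hball (hI t ht)
    have key : ∀ i j, i < j → Y (γ t) i ≠ Y (γ t) j := by
      intro i j hij heq
      have hij' : (i : ℕ) < j := hij
      rcases fin_cases_two_le j with rfl | rfl | hj
      · exact absurd hij' (by simp)
      · have : i = 0 := by
          apply Fin.ext
          rw [h1v] at hij'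
          simpa using hij'
        rw [this, hY0, hY1] at heq
        exact OnePoint.coe_ne_infty _ heq
      · rw [hY2 _ j hj, hs j hj] at heq
        rcases fin_cases_two_le i with rfl | rfl | hi
        · rw [hY0] at heq
          exact Complex.exp_ne_zero _ (OnePoint.coe_injective heq).symm
        · rw [hY1] at heq
          exact OnePoint.coe_ne_infty _ heq.symm
        · rw [hY2 _ i hi, hs i hi] at heq
          obtain ⟨k, hk⟩ := Good.exp_eq_exp_imp (OnePoint.coe_injective heq)
          obtain ⟨o1, o2⟩ := hord i j hi hij
          have k1 : (k : ℝ) < 0 := by linarith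
          have k2 : (-1 : ℝ) < k := by linarith
          have k1' : k < 0 := by exact_mod_cast k1
          have k2' : -1 < k := by exact_mod_cast k2
          omega
    intro i j hij
    rcases lt_trichotomy i j with hlt | rfl | hlt
    · exact absurd hij (key i j hlt)
    · rfl
    · exact absurd hij.symm (key j i hlt)
  have hfix : ∀ t ∈ Ioo (-ε) ε, ∀ i, toMap (γ t) (Y (γ t) i) = Y (γ t) i := by
    intro t ht i
    obtain ⟨-, hG, hf, -⟩ := hball (hI t ht)
    rcases fin_cases_two_le i with rfl | rfl | hi
    · rw [hY0, toMap_coe_eq_self_iff hG.nonDeg, IsRoot, fixPoly_eval, hom_zero_left, hom_zero_left, hγz]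
      simp
    · rw [hY1]
      exact toMap_infty_eq_self_iff.2 (hγl t)
    · rw [hY2 _ i hi]
      exact hf i hi
  have hnd : ∀ t ∈ Ioo (-ε) ε, NonDeg (γ t) := fun t ht => (hball (hI t ht)).2.1.nonDeg
  -- Outside the interval the value n is arbitrary.
  set c : ℝ → MarkedRat d := fun t => if ht : t ∈ Ioo (-ε) ε then
    MarkedRat.ofInjective hd (γ t) (Y (γ t)) (hnd t ht) (hinj t ht) (hfix t ht) else n with hc
  have hcc : ∀ t ∈ Ioo (-ε) ε, (c t).coeff = γ t := fun t ht => by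
    simp only [hc]; rw [dif_pos ht]; rfl
  have hcm : ∀ t ∈ Ioo (-ε) ε, (c t).mark = Y (γ t) := fun t ht => by
    simp only [hc]; rw [dif_pos ht]; rfl
  have h0mem : (0 : ℝ) ∈ Ioo (-ε) ε := ⟨by linarith, hε⟩
  refine ⟨ε, hε, c, ?_, hγc.contDiffOn.congr hcc, ?_, ?_, ?_⟩
  · refine MarkedRat.eq_of_coeff_eq ((hcc 0 h0mem).trans hγ0) ?_
    rw [hcm 0 h0mem, hγ0]
    funext i
    rcases fin_cases_two_le i with rfl | rfl | hi
    · rw [hY0, h.zero]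
    · rw [hY1, h.infty]
    · rw [hY2 _ i hi, hψ0 i hi]
  · refine ContinuousOn.congr (f := fun t => Y (γ t)) (continuousOn_pi.2 fun i => ?_) hcm
    rcases fin_cases_two_le i with rfl | rfl | hi
    · simp only [hY0]; exact continuousOn_const
    · simp only [hY1]; exact continuousOn_const
    · simp only [hY2 _ i hi]
      intro t ht
      have h1 := (hball (hI t ht)).1 i hi
      exact (OnePoint.continuous_coe.continuousAt.comp
        (h1.comp hγc.continuous.continuousAt)).continuousWithinAt
  · intro t ht
    obtain ⟨-, hG, -, s, hs, hord⟩ := hball (hI t ht)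
    have hG' : Good (c t).coeff := by rw [hcc t ht]; exact hG
    refine hG'.toModuli_mem_blaschkeLocus (by omega)
      (hG'.isStandardOrdered (by rw [hcm t ht, hY0]) (by rw [hcm t ht, hY1]) s
        (fun i hi => ?_) hord)
    rw [hcm t ht, hY2 _ i hi, hs i hi]
  · have h1 : (fun t => (c t).coeff) =ᶠ[𝓝 0] γ :=
      Filter.eventually_of_mem (Ioo_mem_nhds (by linarith) hε) hcc
    rw [h1.deriv_eq]
    have h2 : HasDerivAt γ w 0 := by
      simpa [hγ] using (hasDerivAt_id (0 : ℝ)).smul_const w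
    exact h2.deriv

end Normalized

end Deform

/-! ### Velocities of curves of Blaschke products -/

section Velocity

variable {d : ℕ}

lemma apply_deriv_eq_zero {E F : Type*} [NormedAddCommGroup E] [NormedSpace ℝ E]
    [NormedAddCommGroup F] [NormedSpace ℝ F] (L : E →L[ℝ] F) {f : ℝ → E} {f' : E}
    (hf : HasDerivAt f f' 0) (h : ∀ᶠ t in 𝓝 (0 : ℝ), L (f t) = 0) : L f' = 0 := by
  have h1 := L.hasFDerivAt.comp_hasDerivAt (0 : ℝ) hf
  exact h1.unique ((hasDerivAt_const (0 : ℝ) (0 : F)).congr_of_eventuallyEq h)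

lemma deriv_mem_normalSpace {f : ℝ → Coeff d} {f' : Coeff d} (hf : HasDerivAt f f' 0)
    (h : ∀ᶠ t in 𝓝 (0 : ℝ), f t ∈ normalSpace d) : f' ∈ normalSpace d := by
  have key : ∀ l : Coeff d →ₗ[ℂ] ℂ, (∀ᶠ t in 𝓝 (0 : ℝ), l (f t) = 0) → l f' = 0 := fun l hl =>
    apply_deriv_eq_zero ((LinearMap.toContinuousLinearMap l).restrictScalars ℝ) hf hl
  refine ⟨?_, ?_, ?_⟩
  · exact key ((LinearMap.proj 0).comp (LinearMap.fst ℂ _ _)) (h.mono fun t ht => ht.1)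
  · exact key ((LinearMap.proj (Fin.last d)).comp (LinearMap.snd ℂ _ _)) (h.mono fun t ht => ht.2.1)
  · have := key ((homLin 1 1).comp (LinearMap.fst ℂ _ _) - (homLin 1 1).comp (LinearMap.snd ℂ _ _))
      (h.mono fun t ht => sub_eq_zero.2 ht.2.2)
    exact sub_eq_zero.1 this

/-- If a curve stays, up to scalars, among the symmetric coefficients, its velocity is symmetric up
to the direction of the scalars. -/
lemma exists_refl_deriv_eq {f : ℝ → Coeff d} {f' : Coeff d} (hf : HasDerivAt f f' 0)
    (h0 : refl (f 0) = f 0) (hb : (f 0).2 0 ≠ 0)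
    (h : ∀ᶠ t in 𝓝 (0 : ℝ), ∃ c : ℂ, refl (f t) = c • f t) :
    ∃ c : ℂ, refl f' - f' = c • f 0 := by
  set R : Coeff d →L[ℝ] Coeff d := LinearMap.toContinuousLinearMap refl with hR
  set l : Coeff d →L[ℝ] ℂ := (LinearMap.toContinuousLinearMap
    ((LinearMap.proj (0 : Fin (d + 1))).comp (LinearMap.snd ℂ (Fin (d + 1) → ℂ)
      (Fin (d + 1) → ℂ)))).restrictScalars ℝ with hl
  have hRf : HasDerivAt (fun t => R (f t)) (R f') 0 := R.hasFDerivAt.comp_hasDerivAt (0 : ℝ) hf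
  have hlf : HasDerivAt (fun t => l (f t)) (l f') 0 := l.hasFDerivAt.comp_hasDerivAt (0 : ℝ) hf
  have hlR : HasDerivAt (fun t => l (R (f t))) (l (R f')) 0 :=
    l.hasFDerivAt.comp_hasDerivAt (0 : ℝ) hRf
  -- The factor c(t) need not be differentiable. Cross-multiplying by the coefficient l, nonzero at
  -- t = 0, expresses the proportionality without it.
  have h1 := (hlf.fun_smul hRf).fun_sub (hlR.fun_smul hf)
  have h2 : (fun t => l (f t) • R (f t) - l (R (f t)) • f t) =ᶠ[𝓝 0] fun _ => (0 : Coeff d) := by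
    filter_upwards [h] with t ⟨c, hc⟩
    have e1 : R (f t) = c • f t := hc
    have e2 : l (c • f t) = c * l (f t) := rfl
    rw [e1, e2, smul_smul, mul_comm, sub_self]
  have h3 := h1.unique ((hasDerivAt_const (0 : ℝ) (0 : Coeff d)).congr_of_eventuallyEq h2)
  have e0 : R (f 0) = f 0 := h0
  have el : l (f 0) ≠ 0 := hb
  rw [e0] at h3
  refine ⟨(l (f 0))⁻¹ * (l (R f') - l f'), ?_⟩
  have h4 : l (f 0) • (R f' - f') = (l (R f') - l f') • f 0 := by
    rw [smul_sub, sub_smul, sub_eq_sub_iff_add_eq_add, ← sub_eq_zero, ← h3]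
    abel
  rw [mul_smul, ← h4, inv_smul_smul₀ el]
  rfl

namespace Normalized

variable {hd : 2 ≤ d} {n : MarkedRat d}

/-- A moving matrix that keeps the first three marked points at `0`, `∞` and `1`. -/
lemma exists_gl_curve (h : Normalized hd n) {c : ℝ → MarkedRat d} (hc0 : c 0 = n)
    (hc : DifferentiableAt ℝ (fun t => (c t).coeff) 0) (hm : ContinuousAt (fun t => (c t).mark) 0) :
    ∃ g : ℝ → Fin 2 → Fin 2 → ℂ, DifferentiableAt ℝ g 0 ∧ g 0 = idFam ∧
      ∀ᶠ t in 𝓝 (0 : ℝ), ∃ γ : GL (Fin 2) ℂ, (γ : Matrix (Fin 2) (Fin 2) ℂ) = Matrix.of (g t) ∧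
        γ • (c t).mark 0 = ((0 : ℂ) : OnePoint ℂ) ∧ γ • (c t).mark 1 = ∞ ∧
        γ • (c t).mark ⟨2, by omega⟩ = ((1 : ℂ) : OnePoint ℂ) := by
  have hF := h.simpleNormal
  have hm0 := n.map_mark hd 0
  have hm2 := n.map_mark hd ⟨2, by omega⟩
  rw [h.zero] at hm0
  rw [h.one] at hm2
  have hfix : ∀ z : ℂ, n.map z = z → fixForm n.coeff z 1 = 0 := fun z hz => by
    rw [fixForm, ← toMap_pt_eq_self_iff n.nonDeg (by simp), pt_one]; exact hz
  obtain ⟨ψ₀, h01, h02, -, h03⟩ := exists_fixed_branch_coe (hfix 0 hm0)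
    (MarkedRat.simple_of_injective hd h.inj hm0)
  obtain ⟨ψ₁, h11, h12, h13⟩ := exists_fixed_branch_infty hF.infty hF.simple_infty
  obtain ⟨ψ₂, h21, h22, -, h23⟩ := exists_fixed_branch_coe (hfix 1 hm2)
    (MarkedRat.simple_of_injective hd h.inj hm2)
  have hcoeff0 : (c 0).coeff = n.coeff := by rw [hc0]
  have hdiff : ∀ ψ : Coeff d → ℂ, ContDiffAt ℂ 1 ψ n.coeff →
      DifferentiableAt ℝ (fun t => ψ (c t).coeff) 0 := by
    intro ψ hψ
    have h1 : DifferentiableAt ℝ ψ (c 0).coeff := by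
      rw [hcoeff0]
      exact (hψ.differentiableAt one_ne_zero).restrictScalars ℝ
    exact DifferentiableAt.comp (0 : ℝ) (f := fun t => (c t).coeff) h1 hc
  have htend : ∀ (i : Fin (d + 1)) (p : OnePoint ℂ), n.mark i = p →
      Tendsto (fun t => ((c t).coeff, (c t).mark i)) (𝓝 0) (𝓝 n.coeff ×ˢ 𝓝 p) := by
    rintro i _ rfl
    refine Tendsto.prodMk ?_ ?_
    · have := hc.continuousAt.tendsto
      rwa [hcoeff0] at this
    · have : Tendsto (fun t => (c t).mark i) (𝓝 0) (𝓝 ((c 0).mark i)) :=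
        (continuousAt_pi.1 hm i)
      rwa [hc0] at this
  -- The marks are only continuous in t; local uniqueness equates them with the branches, which are
  -- differentiable.
  have m0 := (htend 0 _ h.zero).eventually h03
  have m1 := (htend 1 _ h.infty).eventually h13
  have m2 := (htend ⟨2, by omega⟩ _ h.one).eventually h23
  have d0 := hdiff ψ₀ h02
  have d1 := hdiff ψ₁ h12
  have d2 := hdiff ψ₂ h22
  set z₀ : ℝ → ℂ := fun t => ψ₀ (c t).coeff with hz0
  set w₁ : ℝ → ℂ := fun t => ψ₁ (c t).coeff with hw1
  set z₂ : ℝ → ℂ := fun t => ψ₂ (c t).coeff with hz2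
  have z00 : z₀ 0 = 0 := by simp only [hz0, hcoeff0, h01]
  have w10 : w₁ 0 = 0 := by simp only [hw1, hcoeff0, h11]
  have z20 : z₂ 0 = 1 := by simp only [hz2, hcoeff0, h21]
  have dk : DifferentiableAt ℝ (fun t => (1 - w₁ t * z₂ t) / (z₂ t - z₀ t)) 0 :=
    ((differentiableAt_const _).fun_sub (d1.fun_mul d2)).fun_div (d2.fun_sub d0)
      (by rw [z20, z00]; simp)
  -- The Möbius map is z ↦ k (z - z₀) / (1 - w₁ z), taking z₀ to 0 and 1 / w₁ to ∞; k is determined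
  -- by z₂ ↦ 1. At t = 0 it is the identity.
  set k : ℝ → ℂ := fun t => (1 - w₁ t * z₂ t) / (z₂ t - z₀ t) with hk
  have k0 : k 0 = 1 := by simp [hk, z00, w10, z20]
  refine ⟨fun t => Matrix.of.symm !![k t, -(k t * z₀ t); -w₁ t, 1], ?_, ?_, ?_⟩
  · refine differentiableAt_pi.2 fun i => differentiableAt_pi.2 fun j => ?_
    fin_cases i <;> fin_cases j
    · exact dk
    · exact (dk.fun_mul d0).fun_neg
    · exact d1.fun_neg
    · exact differentiableAt_const _
  · simp only [k0, z00, w10]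
    rw [idFam, Matrix.one_fin_two]
    simp
  · have e1 : ∀ᶠ t in 𝓝 (0 : ℝ), 1 - w₁ t * z₂ t ≠ 0 := ContinuousAt.eventually_ne
      (continuousAt_const.sub (d1.continuousAt.mul d2.continuousAt)) (by simp [w10])
    have e2 : ∀ᶠ t in 𝓝 (0 : ℝ), z₂ t - z₀ t ≠ 0 := ContinuousAt.eventually_ne
      (d2.continuousAt.sub d0.continuousAt) (by simp [z20, z00])
    have e3 : ∀ᶠ t in 𝓝 (0 : ℝ), 1 - w₁ t * z₀ t ≠ 0 := ContinuousAt.eventually_ne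
      (continuousAt_const.sub (d1.continuousAt.mul d0.continuousAt)) (by simp [w10])
    filter_upwards [m0, m1, m2, e1, e2, e3] with t a0 a1 a2 b1 b2 b3
    replace a0 := a0 (c t).nonDeg ((c t).map_mark hd _)
    replace a1 := a1 (c t).nonDeg ((c t).map_mark hd _)
    replace a2 := a2 (c t).nonDeg ((c t).map_mark hd _)
    change (c t).mark 0 = (z₀ t : OnePoint ℂ) at a0
    change (c t).mark 1 = pt 1 (w₁ t) at a1
    change (c t).mark ⟨2, _⟩ = (z₂ t : OnePoint ℂ) at a2
    have hkt : k t * (z₂ t - z₀ t) = 1 - w₁ t * z₂ t := div_mul_cancel₀ _ b2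
    have hkt0 : k t ≠ 0 := div_ne_zero b1 b2
    have hdet : (!![k t, -(k t * z₀ t); -w₁ t, 1] : Matrix (Fin 2) (Fin 2) ℂ).det ≠ 0 := by
      rw [Matrix.det_fin_two_of]
      have : k t * 1 - -(k t * z₀ t) * -w₁ t = k t * (1 - w₁ t * z₀ t) := by ring
      rw [this]
      exact mul_ne_zero hkt0 b3
    set γ := Matrix.GeneralLinearGroup.mkOfDetNeZero
      (!![k t, -(k t * z₀ t); -w₁ t, 1] : Matrix (Fin 2) (Fin 2) ℂ) hdet with hγ
    have g00 : γ 0 0 = k t := rfl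
    have g01 : γ 0 1 = -(k t * z₀ t) := rfl
    have g10 : γ 1 0 = -w₁ t := rfl
    have g11 : γ 1 1 = 1 := rfl
    refine ⟨γ, rfl, ?_, ?_, ?_⟩
    · have hn := gl_apply_ne_zero γ (u := z₀ t) (v := 1) (by simp)
      rw [a0, ← pt_one, smul_pt γ _ _ (by simp), ← pt_one, pt_eq_pt_iff hn (by simp), g00, g01]
      ring
    · have hn := gl_apply_ne_zero γ (u := 1) (v := w₁ t) (by simp)
      rw [a1, smul_pt γ _ _ (by simp), ← pt_zero 1, pt_eq_pt_iff hn (by simp), g10, g11]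
      ring
    · have hn := gl_apply_ne_zero γ (u := z₂ t) (v := 1) (by simp)
      rw [a2, ← pt_one, smul_pt γ _ _ (by simp), ← pt_one, pt_eq_pt_iff hn (by simp), g00, g01,
        g10, g11]
      linear_combination hkt

/-- Renormalising the curve changes its velocity u by a vector x tangent to the orbit. The new
velocity y = x + u is normal, and `refl y - y` lies in ℂF, so the symmetric part of y represents u
modulo the orbit tangent. -/
theorem exists_sub_mem_orbitTangent (h : Normalized hd n) {u : Coeff d}
    (hu : u ∈ coeffVelocities (blaschkeLocus d) n) :
    ∃ w ∈ symmNormalSpace d, u - w ∈ orbitTangent n.coeff := by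
  obtain ⟨ε, hε, c, h1, h2, h3, h4, rfl⟩ := hu
  have hnhds : Ioo (-ε) ε ∈ 𝓝 (0 : ℝ) := Ioo_mem_nhds (by linarith) hε
  have hdiff : DifferentiableAt ℝ (fun t => (c t).coeff) 0 :=
    (h2.contDiffAt hnhds).differentiableAt (by simp)
  obtain ⟨g, hg, hg0, hev⟩ := h.exists_gl_curve h1 hdiff (h3.continuousAt hnhds)
  set u := deriv (fun t => (c t).coeff) 0 with hu
  have hder := hasDerivAt_conjCoeff hg.hasDerivAt hg0 hdiff.hasDerivAt
  have hcoeff0 : (c 0).coeff = n.coeff := by rw [h1]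
  simp only [hcoeff0] at hder
  set f : ℝ → Coeff d := fun t => conjCoeff (Matrix.of (g t)) (c t).coeff with hf
  set x := infAction n.coeff (Matrix.of (deriv g 0)) with hx
  have hf0 : f 0 = n.coeff := by
    simp only [hf, hg0, hcoeff0]
    exact conjCoeff_one _
  have hcurve : ∀ᶠ t in 𝓝 (0 : ℝ), f t ∈ normalSpace d ∧ ∃ a : ℂ, refl (f t) = a • f t := by
    filter_upwards [hev, hnhds] with t ⟨γ, hγ, m0, m1, m2⟩ ht
    have hinj := (wellMarked_of_mem_blaschkeLocus hd (h4 t ht)).inj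
    have hft : f t = ((c t).conj hd γ).coeff := by
      rw [MarkedRat.conj_coeff hd γ hinj, hγ]
    have e0 := MarkedRat.conj_mark hd γ hinj 0
    have e1 := MarkedRat.conj_mark hd γ hinj 1
    have e2 := MarkedRat.conj_mark hd γ hinj ⟨2, by omega⟩
    rw [m0] at e0
    rw [m1] at e1
    rw [m2] at e2
    rw [hft]
    refine ⟨mem_normalSpace_of_marks hd e0 e1 e2, ?_⟩
    -- A normalised map of the locus is symmetric after scaling by some μ, so `refl` multiplies its
    -- coefficients by μ / conj μ.
    obtain ⟨μ, hμ, hG⟩ := exists_good_smul hd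
      (by rw [MarkedRat.toModuli_conj hd γ hinj]; exact h4 t ht) e0 e1 e2
    have hs := hG.symm
    rw [refl_smul] at hs
    have hμ' : starRingEnd ℂ μ ≠ 0 := (_root_.map_ne_zero _).2 hμ
    refine ⟨(starRingEnd ℂ μ)⁻¹ * μ, ?_⟩
    rw [mul_smul, ← hs, inv_smul_smul₀ hμ']
  have hN := deriv_mem_normalSpace hder (hcurve.mono fun t ht => ht.1)
  have hb : (f 0).2 0 ≠ 0 := by
    rw [hf0]
    have := h.good.denom 0 (by simp)
    rwa [hom_zero_left, one_pow, mul_one] at this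
  obtain ⟨a, ha⟩ := exists_refl_deriv_eq hder (by rw [hf0, h.good.symm]) hb
    (hcurve.mono fun t ht => ht.2)
  rw [hf0] at ha
  have hinv : starRingEnd ℂ (2⁻¹ : ℂ) = 2⁻¹ := by rw [map_inv₀, map_ofNat]
  set y := x + u with hy
  refine ⟨(2⁻¹ : ℂ) • (y + refl y), ⟨?_, ?_⟩, ?_⟩
  · rw [refl_smul, map_add, refl_refl, add_comm (refl y) y, hinv]
  · exact (normalSpace d).smul_mem _ (add_mem hN (refl_mem_normalSpace hN))
  · have e : u - (2⁻¹ : ℂ) • (y + refl y) = -x - (2⁻¹ * a) • n.coeff := by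
      rw [mul_smul, ← ha, smul_sub, smul_add]
      have : y = (2⁻¹ : ℂ) • y + (2⁻¹ : ℂ) • y := by
        rw [← add_smul]; norm_num
      have hu' : u = y - x := by rw [hy]; abel
      rw [hu']
      nth_rewrite 1 [this]
      abel
    rw [e]
    exact sub_mem (neg_mem (mem_orbitTangent_iff.2 ⟨_, rfl⟩)) (smul_mem_orbitTangent _ _)

lemma isRealSlice (h : Normalized hd n) (hm : n.toModuli ∈ blaschkeLocus d) :
    IsRealSlice (blaschkeLocus d) n (symmNormalSpace d) where
  decomp := h.decomp
  indep := h.indep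
  lift w hw := ⟨w, h.mem_coeffVelocities hm hw, by rw [sub_self]; exact zero_mem _⟩
  proj _ hu := h.exists_sub_mem_orbitTangent hu

end Normalized

/-- The slice at a normalised conjugate is transported back by g⁻¹. -/
theorem exists_isCompl_velocities_blaschkeLocus (hd : 2 ≤ d) {m : MarkedRat d}
    (hm : m.toModuli ∈ blaschkeLocus d) :
    ∃ T : Submodule ℝ (ModuliTangent m),
      (T : Set (ModuliTangent m)) = velocities (blaschkeLocus d) m ∧
      IsCompl T (T.map (almostComplex m)) := by
  have hS : ∀ n : MarkedRat d, n.toModuli ∈ blaschkeLocus d → Function.Injective n.mark :=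
    fun n hn => (wellMarked_of_mem_blaschkeLocus hd hn).inj
  obtain ⟨g, hg⟩ := exists_normalized_conj hd hm
  have hn : (m.conj hd g).toModuli = m.toModuli := MarkedRat.toModuli_conj hd g (hS m hm)
  have hslice := (hg.isRealSlice (by rwa [hn])).conj hd hS hg.inj g⁻¹
  rw [MarkedRat.conj_conj_of_mul_eq_one hd (hS m hm) (inv_mul_cancel g)] at hslice
  exact hslice.exists_isCompl

end Velocity

end QuasiBlaschke

end

theorem mainTheorem3 (d : ℕ) (hd : 2 ≤ d) (m : QuasiBlaschke.MarkedRat d)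
    (hm : m.toModuli ∈ QuasiBlaschke.blaschkeLocus d) :
    ∃ T : Submodule ℝ (QuasiBlaschke.ModuliTangent m),
      (T : Set (QuasiBlaschke.ModuliTangent m)) =
        QuasiBlaschke.velocities (QuasiBlaschke.blaschkeLocus d) m ∧
      IsCompl T (T.map (QuasiBlaschke.almostComplex m)) :=
  QuasiBlaschke.exists_isCompl_velocities_blaschkeLocus hd hm
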